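/- **Theorem.** Let $X_1,X_2,\dots$ be i.i.d. random variables with values in a measurable space $\mathcal X$ and common distribution $\nu$; let $X$ denote a variable with distribution $\nu$. Let $f:\mathcal X^2\to\mathbb R$ be measurable with $\mathbb E|f(X_1,X_2)|^2<\infty$, and put $$U_n^{-+}(f):=\sum_{1\le i<j\le n}(-1)^{i+1}f(X_i,X_j).$$ Let $\mu:=\mathbb E f(X_1,X_2)$, $f_1(x):=\mathbb E f(x,X)-\mu$, $f_2(y):=\mathbb E f(X,y)-\mu$, $f_{12}(x,y):=f(x,y)-f_1(x)-f_2(y)-\mu$. For a square integrable kernel $g$ on a probability space let $T_g\varphi(x)=\int g(x,y)\varphi(y)\,dy$ (integration with respect to the given probability measure) be the integral operator on its $L^2$ space. On $\widehat{\mathcal X}:=\mathcal X\times[0,1]$ with the measure $\nu\times\mathrm{Leb}$ define, for $g:\mathcal X^2\to\mathbb R$, the kernels $\widehat{g}((x,t),(y,u)):=g(x,y)$ if $t<u$ and $g(y,x)$ if $t>u$, and $g^{\vee}((x,t),(y,u)):=g(x,y)$ if $t<u$ and $-g(y,x)$ if $t>u$ (both $0$ if $t=u$). Infinite series of random variables below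 converge in $L^2$. Then $U_n^{-+}(f)\in L^2$ for every $n$, and the following hold, with limits as $n\to\infty$. 1. $\mathbb E\,U_n^{-+}(f)=\lfloor n/2\rfloor\,\mu$ for every $n$. 2. $n^{-3}\operatorname{Var}[U_n^{-+}(f)]\to\sigma^2:=\tfrac13\mathbb E[f_1(X)^2]$ and $n^{-3/2}\bigl(U_n^{-+}(f)-\mathbb E\,U_n^{-+}(f)\bigr)\xrightarrow{d}N(0,\sigma^2)$. 3. If $f_1(X)=0$ a.s., and thus $\sigma^2=0$, then $\operatorname{Var}[U_n^{-+}(f)]=\tfrac12n^2\operatorname{Var}[f_{12}(X_1,X_2)]+O(n)$. Moreover, the operator $$\frac12\begin{pmatrix}-T_{\widehat{f_{12}}}&T_{(f_{12})^{\vee}}\\-T_{(f_{12})^{\vee}}&T_{\widehat{f_{12}}}\end{pmatrix}\quad\text{on } L^2(\widehat{\mathcal X})\oplus L^2(\widehat{\mathcal X})$$ is self-adjoint, its nonzero eigenvalues, with multiplicities, form a finite or infinite sequence $(\lambda_r)_{r=1}^R$ of real numbers, and $$n^{-1}\bigl(U_n^{-+}(f)-\mathbb E\,U_n^{-+}(f)\bigr)\xrightarrow{d}W:=\sum_{r=1}^R\tfrac12\lambda_r(\zeta_r^2-1),$$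 where $(\zeta_r)_1^R$ are independent standard normal variables, and $\operatorname{Var}W=\tfrac12\sum_r\lambda_r^2=\tfrac12\operatorname{Var}[f_{12}(X_1,X_2)]<\infty$. 4. If $f_1(X)=0$ a.s. and $f$ is symmetric, then also $n^{-1}\bigl(U_n^{-+}(f)-\mathbb E\,U_n^{-+}(f)\bigr)\xrightarrow{d}W:=\sum_{r=1}^R\lambda_r\xi_r$, where $(\xi_r)_1^R$ are i.i.d. with characteristic function $\mathbb E e^{\mathrm i t\xi_r}=\cosh(t)^{-1/2}$ and $(\lambda_r)_1^R$ are the nonzero eigenvalues, with multiplicities, of $T_{f_{12}}$ on $L^2(\mathcal X,\nu)$; and $\operatorname{Var}W=\tfrac12\sum_r\lambda_r^2=\tfrac12\operatorname{Var}[f_{12}(X_1,X_2)]$. 5. If $f_1(X)=0$ a.s. and $f$ is antisymmetric, then $T_f$ is anti-self-adjoint on the complex space $L^2_{\mathbb C}(\mathcal X,\nu)$, and also $n^{-1}U_n^{-+}(f)\xrightarrow{d}W:=\sum_{q=1}^{Q}\lambda_q\eta_q$, where $(\eta_q)_1^Q$ are i.i.d. with the distribution of Lévy's stochastic area, i.e.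 with characteristic function $\mathbb E e^{\mathrm i t\eta_q}=1/\cosh t$, and $(\lambda_q)_1^Q$ are the positive numbers, counted with multiplicity, such that $\mathrm i\lambda_q$ is an eigenvalue of $T_f$ on $L^2_{\mathbb C}(\mathcal X,\nu)$; and $\operatorname{Var}W=\sum_q\lambda_q^2=\tfrac12\operatorname{Var}[f_{12}(X_1,X_2)]$. 6. If $f_1(X)=0$ a.s. and $f_{12}(X_1,X_2)=0$ a.s., then, with $\sigma_1^2:=\tfrac12\operatorname{Var}[f_2(X)]$, $\operatorname{Var}[U_n^{-+}(f)]=n\sigma_1^2+O(1)$ and $n^{-1/2}\bigl(U_n^{-+}(f)-\mathbb E\,U_n^{-+}(f)\bigr)\xrightarrow{d}N(0,\sigma_1^2)$. Symmetry and antisymmetry of $f$ need only hold $\nu\times\nu$-almost everywhere. -/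

import Mathlib

open MeasureTheory ProbabilityTheory Filter Topology Asymptotics
open scoped ENNReal NNReal unitInterval

noncomputable section

namespace AltU

/-! ### Integral operators on `L²` -/

section IntegralOperator

variable {𝒴 : Type*} [MeasurableSpace 𝒴] {𝕜 : Type*} [RCLike 𝕜]

/-- The function `x ↦ ∫ g(x,y) φ(y) dρ(y)`. -/
def integralFun (ρ : Measure 𝒴) (g : 𝒴 → 𝒴 → 𝕜) (φ : 𝒴 → 𝕜) (x : 𝒴) : 𝕜 :=
  ∫ y, g x y * φ y ∂ρ

theorem aestronglyMeasurable_integralFun {ρ : Measure 𝒴} [IsProbabilityMeasure ρ]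
    {g : 𝒴 → 𝒴 → 𝕜} (hg : MemLp (Function.uncurry g) 2 (ρ.prod ρ)) {φ : 𝒴 → 𝕜}
    (hφ : MemLp φ 2 ρ) : AEStronglyMeasurable (integralFun ρ g φ) ρ := by
  have h : AEStronglyMeasurable (fun z : 𝒴 × 𝒴 => Function.uncurry g z * φ z.2) (ρ.prod ρ) :=
    hg.1.mul hφ.1.comp_snd
  exact h.integral_prod_right'

theorem eLpNorm_integralFun_le {ρ : Measure 𝒴} [IsProbabilityMeasure ρ]
    {g : 𝒴 → 𝒴 → 𝕜} (hg : MemLp (Function.uncurry g) 2 (ρ.prod ρ)) {φ : 𝒴 → 𝕜}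
    (hφ : MemLp φ 2 ρ) :
    eLpNorm (integralFun ρ g φ) 2 ρ
      ≤ eLpNorm (Function.uncurry g) 2 (ρ.prod ρ) * eLpNorm φ 2 ρ := by
  have key : ∀ᵐ x ∂ρ, ‖integralFun ρ g φ x‖ₑ ^ (2 : ℝ)
      ≤ (∫⁻ y, ‖g x y‖ₑ ^ (2 : ℝ) ∂ρ) * ∫⁻ y, ‖φ y‖ₑ ^ (2 : ℝ) ∂ρ := by
    filter_upwards [hg.1.prodMk_left] with x hx
    have h1 : ‖integralFun ρ g φ x‖ₑ ≤ ∫⁻ y, ‖g x y‖ₑ * ‖φ y‖ₑ ∂ρ := by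
      refine (enorm_integral_le_lintegral_enorm _).trans (le_of_eq ?_)
      simp only [enorm_mul]
    have h2 := ENNReal.lintegral_mul_le_Lp_mul_Lq ρ Real.HolderConjugate.two_two
      (f := fun y => ‖g x y‖ₑ) (g := fun y => ‖φ y‖ₑ) hx.enorm hφ.1.enorm
    have h3 := h1.trans h2
    calc _ ≤ _ := ENNReal.rpow_le_rpow h3 (by norm_num : (0 : ℝ) ≤ 2)
      _ = _ := by
        rw [ENNReal.mul_rpow_of_nonneg _ _ (by norm_num), ← ENNReal.rpow_mul, ← ENNReal.rpow_mul]
        norm_num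
  rw [eLpNorm_eq_lintegral_rpow_enorm_toReal two_ne_zero ENNReal.ofNat_ne_top,
    eLpNorm_eq_lintegral_rpow_enorm_toReal two_ne_zero ENNReal.ofNat_ne_top,
    eLpNorm_eq_lintegral_rpow_enorm_toReal two_ne_zero ENNReal.ofNat_ne_top,
    ← ENNReal.mul_rpow_of_nonneg _ _ (by simp)]
  refine ENNReal.rpow_le_rpow ?_ (by simp)
  simp only [ENNReal.toReal_ofNat]
  rw [lintegral_prod _ (hg.1.enorm.pow_const _)]
  simp only [Function.uncurry_apply_pair]
  rw [← lintegral_mul_const'']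
  · exact lintegral_mono_ae key
  · have := (hg.1.enorm.pow_const (2 : ℝ)).lintegral_prod_right'
    simpa only [Function.uncurry_apply_pair] using this

theorem memLp_integralFun {ρ : Measure 𝒴} [IsProbabilityMeasure ρ]
    {g : 𝒴 → 𝒴 → 𝕜} (hg : MemLp (Function.uncurry g) 2 (ρ.prod ρ)) {φ : 𝒴 → 𝕜}
    (hφ : MemLp φ 2 ρ) : MemLp (integralFun ρ g φ) 2 ρ :=
  ⟨aestronglyMeasurable_integralFun hg hφ,
    (eLpNorm_integralFun_le hg hφ).trans_lt (ENNReal.mul_lt_top hg.2 hφ.2)⟩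

theorem ae_memLp_section {ρ : Measure 𝒴} [IsProbabilityMeasure ρ]
    {g : 𝒴 → 𝒴 → 𝕜} (hg : MemLp (Function.uncurry g) 2 (ρ.prod ρ)) :
    ∀ᵐ x ∂ρ, MemLp (g x) 2 ρ := by
  have h1 := hg.integrable_norm_pow (by norm_num)
  have h2 : ∀ᵐ x ∂ρ, Integrable (fun y => ‖g x y‖ ^ 2) ρ := by
    simpa using h1.prod_right_ae
  filter_upwards [h2, hg.1.prodMk_left] with x hx hx'
  exact (memLp_two_iff_integrable_sq_norm hx').2 hx

theorem integralFun_add {ρ : Measure 𝒴} [IsProbabilityMeasure ρ]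
    {g : 𝒴 → 𝒴 → 𝕜} (hg : MemLp (Function.uncurry g) 2 (ρ.prod ρ)) {φ ψ χ : 𝒴 → 𝕜}
    (hφ : MemLp φ 2 ρ) (hψ : MemLp ψ 2 ρ) (hχ : χ =ᵐ[ρ] φ + ψ) :
    integralFun ρ g χ =ᵐ[ρ] integralFun ρ g φ + integralFun ρ g ψ := by
  filter_upwards [ae_memLp_section hg] with x hx
  simp only [integralFun, Pi.add_apply]
  refine Eq.trans (integral_congr_ae ?_)
    (integral_add (hx.integrable_mul hφ) (hx.integrable_mul hψ))
  filter_upwards [hχ] with y hy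
  simp [hy, mul_add]

theorem integralFun_smul {ρ : Measure 𝒴} (g : 𝒴 → 𝒴 → 𝕜) {φ χ : 𝒴 → 𝕜} (c : 𝕜)
    (hχ : χ =ᵐ[ρ] c • φ) :
    integralFun ρ g χ = c • integralFun ρ g φ := by
  funext x
  simp only [integralFun, Pi.smul_apply, smul_eq_mul]
  rw [← integral_const_mul]
  refine integral_congr_ae ?_
  filter_upwards [hχ] with y hy
  simp only [hy, Pi.smul_apply, smul_eq_mul]
  ring

/-- The bounded integral operator `T_g φ (x) = ∫ g(x,y) φ(y) dρ(y)` on `L²(ρ)` with values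
in `𝕜` (which is `ℝ` or `ℂ`), for a kernel `g ∈ L²(ρ × ρ)`. -/
def integralOp (ρ : Measure 𝒴) [IsProbabilityMeasure ρ] (g : 𝒴 → 𝒴 → 𝕜)
    (hg : MemLp (Function.uncurry g) 2 (ρ.prod ρ)) : Lp 𝕜 2 ρ →L[𝕜] Lp 𝕜 2 ρ :=
  LinearMap.mkContinuous
    { toFun := fun φ => (memLp_integralFun hg (Lp.memLp φ)).toLp (integralFun ρ g φ)
      map_add' := fun φ ψ => by
        rw [← MemLp.toLp_add]
        exact MemLp.toLp_congr _ _
          (integralFun_add hg (Lp.memLp φ) (Lp.memLp ψ) (Lp.coeFn_add φ ψ))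
      map_smul' := fun c φ => by
        simp only [RingHom.id_apply]
        rw [← MemLp.toLp_const_smul]
        exact MemLp.toLp_congr _ _
          (Filter.EventuallyEq.of_eq (integralFun_smul g c (Lp.coeFn_smul c φ))) }
    (eLpNorm (Function.uncurry g) 2 (ρ.prod ρ)).toReal
    (fun φ => by
      simp only [LinearMap.coe_mk, AddHom.coe_mk]
      rw [Lp.norm_toLp, Lp.norm_def, ← ENNReal.toReal_mul]
      exact ENNReal.toReal_mono (ENNReal.mul_lt_top hg.2 (Lp.memLp φ).2).ne
        (eLpNorm_integralFun_le hg (Lp.memLp φ)))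

theorem integralOp_ae_eq (ρ : Measure 𝒴) [IsProbabilityMeasure ρ] (g : 𝒴 → 𝒴 → 𝕜)
    (hg : MemLp (Function.uncurry g) 2 (ρ.prod ρ)) (φ : Lp 𝕜 2 ρ) :
    integralOp ρ g hg φ =ᵐ[ρ] fun x => ∫ y, g x y * φ y ∂ρ :=
  MemLp.coeFn_toLp (memLp_integralFun hg (Lp.memLp φ))

end IntegralOperator

/-- The operator `(φ₁, φ₂) ↦ (A φ₁ + B φ₂, C φ₁ + D φ₂)` with block matrix `(A B; C D)`
on the Hilbert space direct sum `H ⊕ H`. -/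
def blockOp {𝕜 H : Type*} [RCLike 𝕜] [NormedAddCommGroup H] [InnerProductSpace 𝕜 H]
    (A B C D : H →L[𝕜] H) : WithLp 2 (H × H) →L[𝕜] WithLp 2 (H × H) :=
  ((WithLp.prodContinuousLinearEquiv 2 𝕜 H H).symm : H × H →L[𝕜] WithLp 2 (H × H)) ∘L
    ((A.coprod B).prod (C.coprod D)) ∘L
    (WithLp.prodContinuousLinearEquiv 2 𝕜 H H : WithLp 2 (H × H) →L[𝕜] H × H)

/-! ### Eigenvalues with multiplicities -/

/-- The dimension of the eigenspace of `T` at `z`, in `ℕ∞`. -/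
def eigenMult {𝕜 H : Type*} [RCLike 𝕜] [NormedAddCommGroup H] [InnerProductSpace 𝕜 H]
    (T : H →L[𝕜] H) (z : 𝕜) : ℕ∞ :=
  Cardinal.toENat (Module.rank 𝕜 (Module.End.eigenspace (T : H →ₗ[𝕜] H) z))

/-- The index set `{r : r < R}` of a finite or infinite sequence of length `R ∈ ℕ ∪ {∞}`. -/
abbrev Idx (R : ℕ∞) : Type := {r : ℕ // (r : ℕ∞) < R}

/-- `c` lists the nonzero eigenvalues of `T`, each as often as its multiplicity. -/
def ListsNonzeroEigenvalues {H : Type*} [NormedAddCommGroup H] [InnerProductSpace ℝ H]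
    (T : H →L[ℝ] H) {R : ℕ∞} (c : Idx R → ℝ) : Prop :=
  (∀ r, c r ≠ 0) ∧ ∀ z : ℝ, z ≠ 0 → {r | c r = z}.encard = eigenMult T z

/-- `c` lists the numbers `a > 0` such that the imaginary number `i a` is an eigenvalue of `T`,
each as often as the multiplicity of `i a`. -/
def ListsPosImaginaryEigenvalues {H : Type*} [NormedAddCommGroup H] [InnerProductSpace ℂ H]
    (T : H →L[ℂ] H) {Q : ℕ∞} (c : Idx Q → ℝ) : Prop :=
  (∀ q, 0 < c q) ∧
    ∀ a : ℝ, 0 < a → {q | c q = a}.encard = eigenMult T (Complex.I * (a : ℂ))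

/-! ### The kernels -/

section Kernels

variable {𝒳 : Type*} [MeasurableSpace 𝒳]

/-- `μ = E f(X₁, X₂)`. -/
def hoeffdingMean (ν : Measure 𝒳) (f : 𝒳 → 𝒳 → ℝ) : ℝ :=
  ∫ z, f z.1 z.2 ∂(ν.prod ν)

/-- `f₁(x) = E f(x, X) - μ`. -/
def hoeffding₁ (ν : Measure 𝒳) (f : 𝒳 → 𝒳 → ℝ) (x : 𝒳) : ℝ :=
  (∫ y, f x y ∂ν) - hoeffdingMean ν f

/-- `f₂(y) = E f(X, y) - μ`. -/
def hoeffding₂ (ν : Measure 𝒳) (f : 𝒳 → 𝒳 → ℝ) (y : 𝒳) : ℝ :=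
  (∫ x, f x y ∂ν) - hoeffdingMean ν f

/-- `f₁₂(x, y) = f(x, y) - f₁(x) - f₂(y) - μ`. -/
def hoeffding₁₂ (ν : Measure 𝒳) (f : 𝒳 → 𝒳 → ℝ) (x y : 𝒳) : ℝ :=
  f x y - hoeffding₁ ν f x - hoeffding₂ ν f y - hoeffdingMean ν f

/-- The symmetric kernel on `𝒳 × [0,1]` given by `f(x, y)` for `t < u` and `f(y, x)` for
`t > u`. -/
def hatKernel (f : 𝒳 → 𝒳 → ℝ) (p q : 𝒳 × I) : ℝ :=
  if p.2 < q.2 then f p.1 q.1 else if q.2 < p.2 then f q.1 p.1 else 0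

/-- The antisymmetric kernel on `𝒳 × [0,1]` given by `f(x, y)` for `t < u` and `-f(y, x)` for
`t > u`. -/
def checkKernel (f : 𝒳 → 𝒳 → ℝ) (p q : 𝒳 × I) : ℝ :=
  if p.2 < q.2 then f p.1 q.1 else if q.2 < p.2 then -f q.1 p.1 else 0

variable {ν : Measure 𝒳} [IsProbabilityMeasure ν] {f : 𝒳 → 𝒳 → ℝ}

theorem memLp_flip (hf : MemLp (Function.uncurry f) 2 (ν.prod ν)) :
    MemLp (Function.uncurry fun x y => f y x) 2 (ν.prod ν) :=
  hf.comp_measurePreserving Measure.measurePreserving_swap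

theorem memLp_hoeffding₁ (hf : MemLp (Function.uncurry f) 2 (ν.prod ν)) :
    MemLp (hoeffding₁ ν f) 2 ν := by
  have h := memLp_integralFun hf (memLp_const (1 : ℝ))
  have h' : MemLp (fun x => ∫ y, f x y ∂ν) 2 ν := by
    have e : integralFun ν f (fun _ => 1) = fun x => ∫ y, f x y ∂ν := by
      funext x
      simp [integralFun]
    exact e ▸ h
  exact h'.sub (memLp_const _)

theorem memLp_hoeffding₂ (hf : MemLp (Function.uncurry f) 2 (ν.prod ν)) :
    MemLp (hoeffding₂ ν f) 2 ν := by
  have h := memLp_integralFun (memLp_flip hf) (memLp_const (1 : ℝ))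
  have h' : MemLp (fun y => ∫ x, f x y ∂ν) 2 ν := by
    have e : integralFun ν (fun x y => f y x) (fun _ => 1) = fun y => ∫ x, f x y ∂ν := by
      funext y
      simp [integralFun]
    exact e ▸ h
  exact h'.sub (memLp_const _)

theorem memLp_hoeffding₁₂ (hf : MemLp (Function.uncurry f) 2 (ν.prod ν)) :
    MemLp (Function.uncurry (hoeffding₁₂ ν f)) 2 (ν.prod ν) :=
  ((hf.sub ((memLp_hoeffding₁ hf).comp_fst ν)).sub ((memLp_hoeffding₂ hf).comp_snd ν)).sub
    (memLp_const _)

theorem memLp_complex {ν : Measure 𝒳} {f : 𝒳 → 𝒳 → ℝ} (hf : MemLp (Function.uncurry f) 2 (ν.prod ν)) :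
    MemLp (Function.uncurry fun x y => (f x y : ℂ)) 2 (ν.prod ν) :=
  hf.ofReal

theorem memLp_lift (hf : MemLp (Function.uncurry f) 2 (ν.prod ν)) :
    MemLp (fun z : (𝒳 × I) × (𝒳 × I) => f z.1.1 z.2.1) 2
      ((ν.prod (volume : Measure I)).prod (ν.prod (volume : Measure I))) :=
  hf.comp_measurePreserving (measurePreserving_fst.prod measurePreserving_fst)

theorem measurableSet_lt_time :
    MeasurableSet {z : (𝒳 × I) × (𝒳 × I) | z.1.2 < z.2.2} :=
  measurableSet_lt (by fun_prop) (by fun_prop)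

theorem measurableSet_gt_time :
    MeasurableSet {z : (𝒳 × I) × (𝒳 × I) | z.2.2 < z.1.2} :=
  measurableSet_lt (by fun_prop) (by fun_prop)

theorem memLp_hatKernel (hf : MemLp (Function.uncurry f) 2 (ν.prod ν)) :
    MemLp (Function.uncurry (hatKernel f)) 2
      ((ν.prod (volume : Measure I)).prod (ν.prod (volume : Measure I))) := by
  have h := ((memLp_lift hf).indicator measurableSet_lt_time).add
    ((memLp_lift (memLp_flip hf)).indicator measurableSet_gt_time)
  convert h using 1
  funext z
  rcases lt_trichotomy z.1.2 z.2.2 with h | h | h <;>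
    simp [Function.uncurry_def, hatKernel, Set.indicator, h, h.not_gt]

theorem memLp_checkKernel (hf : MemLp (Function.uncurry f) 2 (ν.prod ν)) :
    MemLp (Function.uncurry (checkKernel f)) 2
      ((ν.prod (volume : Measure I)).prod (ν.prod (volume : Measure I))) := by
  have h := ((memLp_lift hf).indicator measurableSet_lt_time).sub
    ((memLp_lift (memLp_flip hf)).indicator measurableSet_gt_time)
  convert h using 1
  funext z
  rcases lt_trichotomy z.1.2 z.2.2 with h | h | h <;>
    simp [Function.uncurry_def, checkKernel, Set.indicator, h, h.not_gt]

/-- For `g ∈ L²(ν × ν)`, the operator `½ (-T_ĝ  T_ǧ; -T_ǧ  T_ĝ)` on the real Hilbert space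
`L²(𝒳 × [0,1]) ⊕ L²(𝒳 × [0,1])`, where `ĝ` is `hatKernel g` and `ǧ` is `checkKernel g`. -/
def altOp (ν : Measure 𝒳) [IsProbabilityMeasure ν] (g : 𝒳 → 𝒳 → ℝ)
    (hg : MemLp (Function.uncurry g) 2 (ν.prod ν)) :
    WithLp 2 (Lp ℝ 2 (ν.prod (volume : Measure I)) × Lp ℝ 2 (ν.prod (volume : Measure I))) →L[ℝ]
    WithLp 2 (Lp ℝ 2 (ν.prod (volume : Measure I)) × Lp ℝ 2 (ν.prod (volume : Measure I))) :=
  (1 / 2 : ℝ) • blockOp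
    (-integralOp (ν.prod (volume : Measure I)) (hatKernel g) (memLp_hatKernel hg))
    (integralOp (ν.prod (volume : Measure I)) (checkKernel g) (memLp_checkKernel hg))
    (-integralOp (ν.prod (volume : Measure I)) (checkKernel g) (memLp_checkKernel hg))
    (integralOp (ν.prod (volume : Measure I)) (hatKernel g) (memLp_hatKernel hg))

end Kernels

/-! ### The statistic and the limit variables -/

/-- The alternating statistic `∑_{1 ≤ i < j ≤ n} (-1)^{i+1} f(X_i, X_j)`. The sequence
`X_1, X_2, …` is indexed from `0` here: `X k` is `X_{k+1}`. -/
def altU {Ω 𝒳 : Type*} (f : 𝒳 → 𝒳 → ℝ) (X : ℕ → Ω → 𝒳) (n : ℕ) (ω : Ω) : ℝ :=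
  ∑ j ∈ Finset.range n, ∑ i ∈ Finset.range j, (-1 : ℝ) ^ ((i + 1) + 1) * f (X i ω) (X j ω)

/-- `Y` has the distribution of Lévy's stochastic area `∫₀¹ B₁ dB₂ - ∫₀¹ B₂ dB₁`, that is, its
characteristic function is `1 / cosh t`. -/
def HasStochasticAreaLaw {Ω : Type*} [MeasurableSpace Ω] (Y : Ω → ℝ) (P : Measure Ω) : Prop :=
  AEMeasurable Y P ∧ ∀ t : ℝ, charFun (P.map Y) t = ((1 / Real.cosh t : ℝ) : ℂ)

/-- `Y` has the distribution of `∫₀¹ B₁ dB₂`, that is, its characteristic function is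
`1 / √(cosh t)`. -/
def HasHalfStochasticAreaLaw {Ω : Type*} [MeasurableSpace Ω] (Y : Ω → ℝ) (P : Measure Ω) :
    Prop :=
  AEMeasurable Y P ∧ ∀ t : ℝ, charFun (P.map Y) t = ((1 / √(Real.cosh t) : ℝ) : ℂ)

/-- `W = ∑_r Y r`, with (unconditional) convergence in `L²`. -/
def IsL2Sum {Ω ι : Type*} [MeasurableSpace Ω] (Y : ι → Ω → ℝ) (W : Ω → ℝ) (P : Measure Ω) :
    Prop :=
  (∀ r, MemLp (Y r) 2 P) ∧ MemLp W 2 P ∧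
    Tendsto (fun s : Finset ι => eLpNorm (fun ω => W ω - ∑ r ∈ s, Y r ω) 2 P) atTop (𝓝 0)

end AltU

end

open MeasureTheory ProbabilityTheory Filter Topology Asymptotics
open scoped ENNReal NNReal unitInterval

noncomputable section

set_option linter.unusedSectionVars false

namespace AltU

/-! ### Characteristic functions and convergence in distribution -/

section CharFun

/-! The Hoeffding decomposition (`altU_eq`) splits the centred statistic into three orthogonal
parts: an alternating double sum of the completely degenerate kernel f₁₂, a sum of f₁(X i) with
weights ±(n-1-i), and a sum of f₂(X j) over every second j. Their variances have orders n², n³ and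
n, which explains the three normalizations. Two regimes follow from a central limit theorem for
weighted sums, `tendsto_charFun_weighted_sum`, once the smaller parts are discarded in L². All
limits are taken through characteristic functions, and `norm_charFun_map_sub_le` makes L² errors
harmless.

The remaining work is the double sum with a degenerate kernel g = f₁₂. Three moves turn it into a
classical U-statistic. Grouping the variables into consecutive pairs absorbs the alternating signs
into a kernel F on pairs, `pairKernel g`; the terms lost are negligible
(`tendsto_sum_sq_blockPairs`). The sum of F(Z k, Z l) over k < l is asymmetric, but independent
uniform times attached to the pairs, with the order of the labels replaced by that of the times,
give the symmetric kernel `hatKernel F` without changing the law (`charFun_hatKernel_eq`). As n is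
about twice the number m of pairs, the kernel to study is half of this one, normalized by m.

A symmetric degenerate kernel is Hilbert–Schmidt, so it expands in orthonormal eigenfunctions
(`hasSum_kernel`). For a finite expansion the U-statistic is a quadratic form in normalized sums
minus empirical second moments, and the central limit theorem with the law of large numbers gives
the sum of ½λ(ζ²-1); truncation is uniform in m (`tendsto_charFun_ustat`). The operator of the
kernel on pairs with times and the 2×2 block operator factor as AB and BA, so their nonzero
eigenvalues agree with multiplicities (`eigenMult_altOp`).

When g is a series of d_b p_b(x) q_b(y) over two orthonormal systems, the spectrum is explicit. The
indicator of t < u has an expansion with singular values 1/ω_k, ω_k = (k+½)π, so the kernel on pairs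
with times is diagonalized by `areaBasis` with eigenvalues ±d_b/ω_k. Opposite eigenvalues combine to
(1+(d_b t/ω_k)²)^(-1/2), and Euler's product turns these into cosh(d_b t)^(-1/2). Symmetric g gives
p = q, the eigenfunctions. For antisymmetric g the real and imaginary parts of the eigenfunctions of
-iT_g give two terms ±λ for each λ, hence the factor 1/cosh(λt). -/

theorem tendstoInDistribution_of_charFun {Ω Ω' : Type*} [MeasurableSpace Ω] [MeasurableSpace Ω']
    {P : Measure Ω} [IsProbabilityMeasure P] {P' : Measure Ω'} [IsProbabilityMeasure P']
    {V : ℕ → Ω → ℝ} {Z : Ω' → ℝ} (hV : ∀ n, AEMeasurable (V n) P) (hZ : AEMeasurable Z P')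
    (h : ∀ t, Tendsto (fun n => charFun (P.map (V n)) t) atTop (𝓝 (charFun (P'.map Z) t))) :
    TendstoInDistribution V atTop Z (fun _ => P) P' where
  forall_aemeasurable := hV
  aemeasurable_limit := hZ
  tendsto := ProbabilityMeasure.tendsto_iff_tendsto_charFun.2 h

theorem tendsto_charFun_of_tendstoInDistribution {E Ω Ω' : Type*} [MeasurableSpace Ω] [MeasurableSpace Ω']
    [NormedAddCommGroup E] [InnerProductSpace ℝ E] [FiniteDimensional ℝ E] [MeasurableSpace E]
    [BorelSpace E]
    {P : Measure Ω} [IsProbabilityMeasure P] {P' : Measure Ω'} [IsProbabilityMeasure P']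
    {V : ℕ → Ω → E} {Z : Ω' → E} (h : TendstoInDistribution V atTop Z (fun _ => P) P') (t : E) :
    Tendsto (fun n => charFun (P.map (V n)) t) atTop (𝓝 (charFun (P'.map Z) t)) :=
  ProbabilityMeasure.tendsto_iff_tendsto_charFun.1 h.tendsto t

theorem charFun_map_eq_integral {Ω : Type*} [MeasurableSpace Ω] {P : Measure Ω} {V : Ω → ℝ}
    (hV : AEMeasurable V P) (t : ℝ) :
    charFun (P.map V) t = ∫ ω, Complex.exp (t * V ω * Complex.I) ∂P := by
  rw [charFun_apply_real, integral_map hV (by fun_prop)]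

theorem norm_exp_mul_I_sub_le (a b : ℝ) :
    ‖Complex.exp (a * Complex.I) - Complex.exp (b * Complex.I)‖ ≤ |a - b| := by
  have h := Real.norm_exp_I_mul_ofReal_sub_one_le (x := a - b)
  have e : Complex.exp (a * Complex.I) - Complex.exp (b * Complex.I) =
      Complex.exp (b * Complex.I) * (Complex.exp (Complex.I * (a - b : ℝ)) - 1) := by
    rw [mul_sub, ← Complex.exp_add]
    congr 2
    · push_cast; ring
    · ring
  rw [e, norm_mul, Complex.norm_exp_ofReal_mul_I, one_mul]
  simpa using h

theorem integral_abs_le_sqrt {Ω : Type*} [MeasurableSpace Ω] {P : Measure Ω}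
    [IsProbabilityMeasure P] {D : Ω → ℝ} (hD : MemLp D 2 P) :
    ∫ ω, |D ω| ∂P ≤ √(∫ ω, D ω ^ 2 ∂P) := by
  refine Real.le_sqrt_of_sq_le ?_
  have h := variance_eq_sub hD.norm
  have h0 := variance_nonneg (fun ω => ‖D ω‖) P
  rw [h] at h0
  simp only [Pi.pow_apply, Real.norm_eq_abs, sq_abs] at h0
  linarith

/-- The function x ↦ exp(itx) is |t|-Lipschitz and the L¹ norm is at most the L² norm. Every term
that is small in L² is discarded by this bound. -/
theorem norm_charFun_map_sub_le {Ω : Type*} [MeasurableSpace Ω] {P : Measure Ω}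
    [IsProbabilityMeasure P] {V V' : Ω → ℝ} (hV : AEMeasurable V P) (hV' : AEMeasurable V' P)
    (hD : MemLp (fun ω => V ω - V' ω) 2 P) (t : ℝ) :
    ‖charFun (P.map V) t - charFun (P.map V') t‖ ≤ |t| * √(∫ ω, (V ω - V' ω) ^ 2 ∂P) := by
  have hi : ∀ {U : Ω → ℝ}, AEMeasurable U P →
      Integrable (fun ω => Complex.exp (t * U ω * Complex.I)) P := by
    intro U hU
    refine Integrable.of_bound (C := 1) (by fun_prop) (ae_of_all _ fun ω => ?_)
    rw [← Complex.ofReal_mul, Complex.norm_exp_ofReal_mul_I]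
  rw [charFun_map_eq_integral hV, charFun_map_eq_integral hV', ← integral_sub (hi hV) (hi hV')]
  refine (norm_integral_le_integral_norm _).trans ?_
  refine le_trans ?_ (mul_le_mul_of_nonneg_left (integral_abs_le_sqrt hD) (abs_nonneg t))
  rw [← integral_const_mul]
  refine integral_mono ((hi hV).sub (hi hV')).norm
    ((hD.integrable one_le_two).abs.const_mul _) fun ω => ?_
  have := norm_exp_mul_I_sub_le (t * V ω) (t * V' ω)
  rw [← mul_sub, abs_mul] at this
  simpa using this

theorem tendsto_charFun_of_sub {Ω : Type*} [MeasurableSpace Ω] {P : Measure Ω}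
    [IsProbabilityMeasure P] {V V' : ℕ → Ω → ℝ} (hV : ∀ n, AEMeasurable (V n) P)
    (hV' : ∀ n, AEMeasurable (V' n) P) (hD : ∀ n, MemLp (fun ω => V n ω - V' n ω) 2 P)
    (h0 : Tendsto (fun n => ∫ ω, (V n ω - V' n ω) ^ 2 ∂P) atTop (𝓝 0)) {t : ℝ} {z : ℂ}
    (h : Tendsto (fun n => charFun (P.map (V' n)) t) atTop (𝓝 z)) :
    Tendsto (fun n => charFun (P.map (V n)) t) atTop (𝓝 z) := by
  have h1 : Tendsto (fun n => |t| * √(∫ ω, (V n ω - V' n ω) ^ 2 ∂P)) atTop (𝓝 0) := by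
    simpa using (h0.sqrt).const_mul |t|
  have h2 := squeeze_zero_norm (fun n => norm_charFun_map_sub_le (hV n) (hV' n) (hD n) t) h1
  simpa using h2.add h

/-- Interchange of two limits under a uniform approximation. -/
theorem tendsto_of_approx {ι : Type*} {l : Filter ι} [l.NeBot] {a : ℕ → ℂ} {b : ι → ℕ → ℂ}
    {c : ι → ℂ} {z : ℂ} {ε : ι → ℝ} (hb : ∀ s, Tendsto (b s) atTop (𝓝 (c s)))
    (hc : Tendsto c l (𝓝 z)) (hε : Tendsto ε l (𝓝 0)) (hab : ∀ s n, ‖a n - b s n‖ ≤ ε s) :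
    Tendsto a atTop (𝓝 z) := by
  rw [Metric.tendsto_atTop]
  intro δ hδ
  have h1 := (Metric.tendsto_nhds.1 hc (δ / 3) (by positivity)).and
    (hε.eventually_lt_const (show (0 : ℝ) < δ / 3 by positivity))
  obtain ⟨s, hs1, hs2⟩ := h1.exists
  obtain ⟨N, hN⟩ := Metric.tendsto_atTop.1 (hb s) (δ / 3) (by positivity)
  refine ⟨N, fun n hn => ?_⟩
  have h2 := hN n hn
  have h3 := hab s n
  rw [← dist_eq_norm] at h3
  linarith [dist_triangle4 (a n) (b s n) (c s) z]

end CharFun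

/-! ### Sums of independent variables in `L²` -/

section L2Sum

variable {Ω ι : Type*} [MeasurableSpace Ω] {P : Measure Ω}

theorem eLpNorm_two_eq {D : Ω → ℝ} (hD : MemLp D 2 P) :
    eLpNorm D 2 P = ENNReal.ofReal (√(∫ ω, D ω ^ 2 ∂P)) := by
  rw [hD.eLpNorm_eq_integral_rpow_norm two_ne_zero ENNReal.ofNat_ne_top, Real.sqrt_eq_rpow]
  simp

theorem norm_toLp_sq {D : Ω → ℝ} (hD : MemLp D 2 P) : ‖hD.toLp D‖ ^ 2 = ∫ ω, D ω ^ 2 ∂P := by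
  rw [Lp.norm_toLp, eLpNorm_two_eq hD, ENNReal.toReal_ofReal (Real.sqrt_nonneg _),
    Real.sq_sqrt (integral_nonneg fun _ => sq_nonneg _)]

theorem toLp_finset_sum {E : Type*} [NormedAddCommGroup E] {m : Measure Ω} {Y : ι → Ω → E}
    (h2 : ∀ r, MemLp (Y r) 2 m) (s : Finset ι) (h : MemLp (fun ω => ∑ r ∈ s, Y r ω) 2 m) :
    h.toLp _ = ∑ r ∈ s, (h2 r).toLp (Y r) := by
  classical
  induction s using Finset.induction_on with
  | empty =>
    simp only [Finset.sum_empty]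
    exact MemLp.toLp_zero _
  | insert a s ha ih =>
    have hs : MemLp (fun ω => ∑ r ∈ s, Y r ω) 2 m := memLp_finsetSum s fun r _ => h2 r
    rw [Finset.sum_insert ha, ← ih hs, ← MemLp.toLp_add (h2 a) hs]
    exact MemLp.toLp_congr _ _ (ae_of_all _ fun ω => Finset.sum_insert ha)

/-- Independence and centring make the variables orthogonal, so square summability is unconditional
summability in L². Mean, variance and characteristic function then pass to the limit along finite
partial sums. In particular the infinite product of characteristic functions converges without any
estimate on its factors; later products rely on this. -/
theorem exists_isL2Sum [IsProbabilityMeasure P] {Y : ι → Ω → ℝ} (hind : iIndepFun Y P) (h2 : ∀ r, MemLp (Y r) 2 P)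
    (h0 : ∀ r, ∫ ω, Y r ω ∂P = 0) (hs : Summable fun r => ∫ ω, Y r ω ^ 2 ∂P) :
    ∃ W : Ω → ℝ, IsL2Sum Y W P ∧ ∫ ω, W ω ∂P = 0 ∧
      Var[W; P] = ∑' r, ∫ ω, Y r ω ^ 2 ∂P ∧
      ∀ t, HasProd (fun r => charFun (P.map (Y r)) t) (charFun (P.map W) t) := by
  set y : ι → Lp ℝ 2 P := fun r => (h2 r).toLp (Y r) with hy
  -- The lines spanned by the variables are used in place of normalized vectors, since some
  -- variables may vanish.
  have horth : Pairwise (Function.onFun (fun x1 x2 => x1 ⟂ x2)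
      fun r => Submodule.span ℝ {y r}) := by
    intro r q hrq
    rw [Function.onFun, Submodule.isOrtho_span]
    rintro _ rfl _ rfl
    rw [L2.inner_def]
    have e : (fun ω => inner ℝ (y r ω) (y q ω)) =ᵐ[P] fun ω => Y r ω * Y q ω := by
      filter_upwards [(h2 r).coeFn_toLp, (h2 q).coeFn_toLp] with ω h1 h2
      simp only [hy, h1, h2]
      simp [mul_comm]
    rw [integral_congr_ae e, (hind.indepFun hrq).integral_fun_mul_eq_mul_integral (h2 r).1 (h2 q).1,
      h0, zero_mul]
  have hOF := OrthogonalFamily.of_pairwise horth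
  let v : ∀ r, Submodule.span ℝ {y r} := fun r => ⟨y r, Submodule.mem_span_singleton_self _⟩
  have hv : ∀ r, ‖v r‖ ^ 2 = ∫ ω, Y r ω ^ 2 ∂P := fun r => norm_toLp_sq (h2 r)
  have hsum : Summable y := by
    have := (hOF.summable_iff_norm_sq_summable v).2 (by simpa only [hv] using hs)
    exact this
  obtain ⟨w, hw⟩ := hsum
  rw [HasSum, SummationFilter.unconditional_filter] at hw
  have hW : MemLp w 2 P := Lp.memLp w
  have hS : ∀ s : Finset ι, MemLp (fun ω => ∑ r ∈ s, Y r ω) 2 P :=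
    fun s => memLp_finsetSum s fun r _ => h2 r
  have hD : ∀ s : Finset ι, MemLp (fun ω => w ω - ∑ r ∈ s, Y r ω) 2 P := fun s => hW.sub (hS s)
  have hnorm : ∀ s : Finset ι, ∫ ω, (w ω - ∑ r ∈ s, Y r ω) ^ 2 ∂P = ‖w - ∑ r ∈ s, y r‖ ^ 2 := by
    intro s
    rw [← norm_toLp_sq (hD s)]
    congr 2
    refine (MemLp.toLp_sub hW (hS s)).trans ?_
    rw [Lp.toLp_coeFn, toLp_finset_sum h2]
  have hlim : Tendsto (fun s : Finset ι => √(∫ ω, (w ω - ∑ r ∈ s, Y r ω) ^ 2 ∂P)) atTop (𝓝 0) := by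
    simp only [hnorm, Real.sqrt_sq (norm_nonneg _)]
    have h := (tendsto_const_nhds (x := w)).sub hw
    simpa using h.norm
  have hz : ∫ ω, w ω ∂P = 0 := by
    have h1 : ∀ s : Finset ι, |∫ ω, w ω ∂P| ≤ √(∫ ω, (w ω - ∑ r ∈ s, Y r ω) ^ 2 ∂P) := by
      intro s
      refine le_trans ?_ (integral_abs_le_sqrt (hD s))
      refine le_trans (le_of_eq ?_) abs_integral_le_integral_abs
      rw [integral_sub (hW.integrable one_le_two) ((hS s).integrable one_le_two),
        integral_finsetSum _ fun r _ => (h2 r).integrable one_le_two]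
      simp [h0]
    exact abs_nonpos_iff.1 (ge_of_tendsto' hlim h1)
  refine ⟨w, ⟨h2, hW, ?_⟩, ?_, ?_, ?_⟩
  · simp only [eLpNorm_two_eq (hD _)]
    simpa using ENNReal.tendsto_ofReal hlim
  · exact hz
  · rw [variance_eq_sub hW, hz]
    simp only [Pi.pow_apply, ne_eq, OfNat.ofNat_ne_zero, not_false_eq_true, zero_pow, sub_zero]
    have e1 : ∫ ω, w ω ^ 2 ∂P = ‖w‖ ^ 2 := by
      rw [← norm_toLp_sq hW, Lp.toLp_coeFn]
    rw [e1]
    have h1 : Tendsto (fun s : Finset ι => ‖∑ r ∈ s, y r‖ ^ 2) atTop (𝓝 (‖w‖ ^ 2)) :=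
      (hw.norm).pow 2
    have h2 : ∀ s : Finset ι, ‖∑ r ∈ s, y r‖ ^ 2 = ∑ r ∈ s, ∫ ω, Y r ω ^ 2 ∂P := by
      intro s
      have := hOF.norm_sum v s
      simp only [hv] at this
      exact this
    simp only [h2] at h1
    exact (HasSum.tsum_eq (by simpa [HasSum] using h1)).symm
  · intro t
    rw [HasProd, SummationFilter.unconditional_filter]
    have e : ∀ s : Finset ι, ∏ r ∈ s, charFun (P.map (Y r)) t =
        charFun (P.map fun ω => ∑ r ∈ s, Y r ω) t := by
      intro s
      rw [iIndepFun.charFun_map_fun_finsetSum_eq_prod (fun i _ => (h2 i).1.aemeasurable)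
        (iIndepFun.precomp (g := ((↑) : s → ι)) Subtype.val_injective hind), Finset.prod_apply]
    simp only [e]
    have h3 : Tendsto (fun s : Finset ι => charFun (P.map w) t -
        charFun (P.map fun ω => ∑ r ∈ s, Y r ω) t) atTop (𝓝 0) := by
      refine squeeze_zero_norm (fun s => norm_charFun_map_sub_le hW.1.aemeasurable
        (hS s).1.aemeasurable (hD s) t) ?_
      simpa using hlim.const_mul |t|
    simpa using (tendsto_const_nhds (x := charFun (P.map w) t)).sub h3

end L2Sum

/-! ### Second moments for sequences of i.i.d. variables -/

/-- `Y 0, Y 1, …` are i.i.d. with distribution `ρ`. -/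
structure IsIID {Ω 𝒴 : Type*} [MeasurableSpace Ω] [MeasurableSpace 𝒴] (Y : ℕ → Ω → 𝒴)
    (ρ : Measure 𝒴) (P : Measure Ω) : Prop where
  meas : ∀ k, Measurable (Y k)
  law : ∀ k, P.map (Y k) = ρ
  indep : iIndepFun Y P

/-- `g` is completely degenerate: all its one-variable integrals vanish. -/
structure IsDegenerate {𝒴 : Type*} [MeasurableSpace 𝒴] (ρ : Measure 𝒴) (g : 𝒴 → 𝒴 → ℝ) :
    Prop where
  left : ∀ᵐ y ∂ρ, ∫ x, g x y ∂ρ = 0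
  right : ∀ᵐ x ∂ρ, ∫ y, g x y ∂ρ = 0

/-- The index pairs `(j, i)` with `i < j < n`. -/
def pairs (n : ℕ) : Finset (Σ _ : ℕ, ℕ) := (Finset.range n).sigma fun j => Finset.range j

theorem mem_pairs {n : ℕ} {p : Σ _ : ℕ, ℕ} : p ∈ pairs n ↔ p.1 < n ∧ p.2 < p.1 := by
  simp [pairs]

theorem card_pairs (n : ℕ) : ((pairs n).card : ℝ) = n * (n - 1) / 2 := by
  rw [pairs, Finset.card_sigma]
  simp only [Finset.card_range]
  induction n with
  | zero => simp
  | succ n ih =>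
    rw [Finset.sum_range_succ]
    push_cast at ih ⊢
    rw [ih]; ring

theorem sum_pairs {M : Type*} [AddCommMonoid M] (n : ℕ) (F : ℕ → ℕ → M) :
    ∑ p ∈ pairs n, F p.2 p.1 = ∑ j ∈ Finset.range n, ∑ i ∈ Finset.range j, F i j :=
  (Finset.sum_sigma _ _ _)

namespace IsIID

variable {Ω 𝒴 : Type*} [MeasurableSpace Ω] [MeasurableSpace 𝒴] {Y : ℕ → Ω → 𝒴}
  {ρ : Measure 𝒴} [IsProbabilityMeasure ρ] {P : Measure Ω} [IsProbabilityMeasure P]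

theorem measurePreserving (h : IsIID Y ρ P) (k : ℕ) : MeasurePreserving (Y k) P ρ :=
  ⟨h.meas k, h.law k⟩

theorem measurePreserving_pair (h : IsIID Y ρ P) {i j : ℕ} (hij : i ≠ j) :
    MeasurePreserving (fun ω => (Y i ω, Y j ω)) P (ρ.prod ρ) := by
  refine ⟨(h.meas i).prodMk (h.meas j), ?_⟩
  rw [(indepFun_iff_map_prod_eq_prod_map_map (h.meas i).aemeasurable (h.meas j).aemeasurable).1
    (h.indep.indepFun hij), h.law, h.law]

/-- The variable with index i enters only through the first argument of g and is independent of the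
others, so by Fubini it can be integrated first, which gives zero by degeneracy. All orthogonality
relations involving a degenerate kernel reduce to this one. -/
theorem integral_mul_eq_zero (h : IsIID Y ρ P) {g : 𝒴 → 𝒴 → ℝ}
    (hg : MemLp (Function.uncurry g) 2 (ρ.prod ρ)) (hd : ∀ᵐ y ∂ρ, ∫ x, g x y ∂ρ = 0)
    {i : ℕ} {S : Finset ℕ} (hi : i ∉ S) (j : S) {Φ : (S → 𝒴) → ℝ}
    (hΦ : AEStronglyMeasurable Φ (P.map fun ω (s : S) => Y s ω))
    (hΦ2 : MemLp (fun ω => Φ fun s : S => Y s ω) 2 P) :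
    ∫ ω, g (Y i ω) (Y j ω) * Φ (fun s : S => Y s ω) ∂P = 0 := by
  have hm : Measurable fun ω (s : S) => Y s ω := measurable_pi_lambda _ fun s => h.meas s
  set lam := P.map fun ω (s : S) => Y s ω with hlam
  have hlp : IsProbabilityMeasure lam := Measure.isProbabilityMeasure_map hm.aemeasurable
  have hS : MeasurePreserving (fun ω (s : S) => Y s ω) P lam := ⟨hm, rfl⟩
  have hij : i ≠ j := fun e => hi (e ▸ j.2)
  have hindep : IndepFun (Y i) (fun ω (s : S) => Y s ω) P := by
    have := h.indep.indepFun_finset {i} S (by simpa using hi) h.meas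
    exact this.comp (φ := fun u : ({i} : Finset ℕ) → 𝒴 => u ⟨i, by simp⟩) (ψ := id) (measurable_pi_apply _) measurable_id
  have hpair : MeasurePreserving (fun ω => (Y i ω, fun s : S => Y s ω)) P (ρ.prod lam) := by
    refine ⟨(h.meas i).prodMk hm, ?_⟩
    rw [(indepFun_iff_map_prod_eq_prod_map_map (h.meas i).aemeasurable hm.aemeasurable).1 hindep,
      h.law]
  have hj : MeasurePreserving (fun u : S → 𝒴 => u j) lam ρ := by
    refine ⟨measurable_pi_apply _, ?_⟩
    rw [hlam, Measure.map_map (measurable_pi_apply _) hm]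
    exact h.law j
  have hq : MeasurePreserving (Prod.map id fun u : S → 𝒴 => u j) (ρ.prod lam) (ρ.prod ρ) :=
    (MeasurePreserving.id ρ).prod hj
  have hmeas : AEStronglyMeasurable (fun z : 𝒴 × (S → 𝒴) => g z.1 (z.2 j) * Φ z.2)
      (ρ.prod lam) :=
    (hg.1.comp_measurePreserving hq).mul hΦ.comp_snd
  have hint : Integrable (fun ω => g (Y i ω) (Y j ω) * Φ (fun s : S => Y s ω)) P :=
    (hg.comp_measurePreserving (h.measurePreserving_pair hij)).integrable_mul hΦ2
  have hint' : Integrable (fun z : 𝒴 × (S → 𝒴) => g z.1 (z.2 j) * Φ z.2) (ρ.prod lam) :=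
    (hpair.integrable_comp hmeas).1 hint
  have e : ∫ ω, g (Y i ω) (Y j ω) * Φ (fun s : S => Y s ω) ∂P =
      ∫ z, g z.1 (z.2 j) * Φ z.2 ∂(ρ.prod lam) := by
    rw [← hpair.map_eq, integral_map hpair.aemeasurable (by rwa [hpair.map_eq])]
  rw [e, integral_prod_symm _ hint']
  refine integral_eq_zero_of_ae ?_
  filter_upwards [hj.quasiMeasurePreserving.ae hd] with u hu
  simp only [Pi.zero_apply, integral_mul_const, hu, zero_mul]

theorem memLp_pair (h : IsIID Y ρ P) {g : 𝒴 → 𝒴 → ℝ}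
    (hg : MemLp (Function.uncurry g) 2 (ρ.prod ρ)) {i j : ℕ} (hij : i ≠ j) :
    MemLp (fun ω => g (Y i ω) (Y j ω)) 2 P :=
  hg.comp_measurePreserving (h.measurePreserving_pair hij)

theorem memLp_single (h : IsIID Y ρ P) {φ : 𝒴 → ℝ} (hφ : MemLp φ 2 ρ) (i : ℕ) :
    MemLp (fun ω => φ (Y i ω)) 2 P :=
  hφ.comp_measurePreserving (h.measurePreserving i)

theorem integral_single (h : IsIID Y ρ P) {φ : 𝒴 → ℝ} (hφ : AEStronglyMeasurable φ ρ) (i : ℕ) :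
    ∫ ω, φ (Y i ω) ∂P = ∫ x, φ x ∂ρ := by
  rw [← h.law i, integral_map (h.meas i).aemeasurable (by rwa [h.law])]

theorem integral_pair (h : IsIID Y ρ P) {φ : 𝒴 × 𝒴 → ℝ}
    (hφ : AEStronglyMeasurable φ (ρ.prod ρ)) {i j : ℕ} (hij : i ≠ j) :
    ∫ ω, φ (Y i ω, Y j ω) ∂P = ∫ z, φ z ∂(ρ.prod ρ) := by
  have hp := h.measurePreserving_pair hij
  rw [← hp.map_eq, integral_map hp.aemeasurable (by rwa [hp.map_eq])]

/-- At least one of i and j differs from l, and that variable is integrated out, after a flip of the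
kernel if it is the second. -/
theorem integral_pair_mul_single (h : IsIID Y ρ P) {g : 𝒴 → 𝒴 → ℝ}
    (hg : MemLp (Function.uncurry g) 2 (ρ.prod ρ)) (hd : IsDegenerate ρ g)
    {φ : 𝒴 → ℝ} (hφ : MemLp φ 2 ρ) {i j : ℕ} (hij : i ≠ j) (l : ℕ) :
    ∫ ω, g (Y i ω) (Y j ω) * φ (Y l ω) ∂P = 0 := by
  have key : ∀ {g : 𝒴 → 𝒴 → ℝ}, MemLp (Function.uncurry g) 2 (ρ.prod ρ) →
      (∀ᵐ y ∂ρ, ∫ x, g x y ∂ρ = 0) → ∀ {i j : ℕ}, i ≠ j → i ≠ l →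
      ∫ ω, g (Y i ω) (Y j ω) * φ (Y l ω) ∂P = 0 := by
    intro g hg hd i j hij hil
    have hS : i ∉ ({j, l} : Finset ℕ) := by simp [hij, hil]
    refine h.integral_mul_eq_zero hg hd hS ⟨j, by simp⟩
      (Φ := fun u => φ (u ⟨l, by simp⟩)) ?_ (h.memLp_single hφ l)
    have hm : Measurable fun u : ({j, l} : Finset ℕ) → 𝒴 => u ⟨l, by simp⟩ :=
      measurable_pi_apply _
    refine hφ.1.comp_measurePreserving (f := fun u : ({j, l} : Finset ℕ) → 𝒴 => u ⟨l, by simp⟩)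
      ⟨hm, ?_⟩
    rw [Measure.map_map hm (measurable_pi_lambda _ fun s => h.meas s)]
    exact h.law l
  by_cases hil : i = l
  · exact key (memLp_flip hg) hd.right hij.symm (by rintro rfl; exact hij hil)
  · exact key hg hd.left hij hil

/-- Two different increasing pairs always leave i or j outside {k, l}: if i is one of k, l, then the
ordering forces j to be neither. -/
theorem integral_pair_mul_pair (h : IsIID Y ρ P) {g : 𝒴 → 𝒴 → ℝ}
    (hg : MemLp (Function.uncurry g) 2 (ρ.prod ρ)) (hd : IsDegenerate ρ g)
    {i j k l : ℕ} (hij : i < j) (hkl : k < l) (hne : ¬ (i = k ∧ j = l)) :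
    ∫ ω, g (Y i ω) (Y j ω) * g (Y k ω) (Y l ω) ∂P = 0 := by
  have key : ∀ {g' : 𝒴 → 𝒴 → ℝ}, MemLp (Function.uncurry g') 2 (ρ.prod ρ) →
      (∀ᵐ y ∂ρ, ∫ x, g' x y ∂ρ = 0) → ∀ {i j : ℕ}, i ≠ j → i ≠ k → i ≠ l →
      ∫ ω, g' (Y i ω) (Y j ω) * g (Y k ω) (Y l ω) ∂P = 0 := by
    intro g' hg' hd i j hij hik hil
    have hS : i ∉ ({j, k, l} : Finset ℕ) := by simp [hij, hil, hik]
    refine h.integral_mul_eq_zero hg' hd hS ⟨j, by simp⟩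
      (Φ := fun u => g (u ⟨k, by simp⟩) (u ⟨l, by simp⟩)) ?_ (h.memLp_pair hg hkl.ne)
    have hm : Measurable fun u : ({j, k, l} : Finset ℕ) → 𝒴 =>
        (u ⟨k, by simp⟩, u ⟨l, by simp⟩) :=
      (measurable_pi_apply _).prodMk (measurable_pi_apply _)
    refine hg.1.comp_measurePreserving (f := fun u : ({j, k, l} : Finset ℕ) → 𝒴 =>
      (u ⟨k, by simp⟩, u ⟨l, by simp⟩)) ⟨hm, ?_⟩
    rw [Measure.map_map hm (measurable_pi_lambda _ fun s => h.meas s)]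
    exact (h.measurePreserving_pair hkl.ne).map_eq
  by_cases hi : i ≠ k ∧ i ≠ l
  · exact key hg hd.left hij.ne hi.1 hi.2
  · exact key (memLp_flip hg) hd.right hij.ne' (by omega) (by omega)

theorem memLp_sum_pairs (h : IsIID Y ρ P) {g : 𝒴 → 𝒴 → ℝ}
    (hg : MemLp (Function.uncurry g) 2 (ρ.prod ρ)) {S : Finset (Σ _ : ℕ, ℕ)}
    (hS : ∀ p ∈ S, p.2 < p.1) (a : (Σ _ : ℕ, ℕ) → ℝ) :
    MemLp (fun ω => ∑ p ∈ S, a p * g (Y p.2 ω) (Y p.1 ω)) 2 P :=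
  memLp_finsetSum S fun p hp => (h.memLp_pair hg (hS p hp).ne).const_mul (a p)

theorem memLp_sum_single (h : IsIID Y ρ P) {φ : 𝒴 → ℝ} (hφ : MemLp φ 2 ρ) (S : Finset ℕ)
    (b : ℕ → ℝ) : MemLp (fun ω => ∑ j ∈ S, b j * φ (Y j ω)) 2 P :=
  memLp_finsetSum S fun j _ => (h.memLp_single hφ j).const_mul (b j)

/-- Only the diagonal of the double sum survives. The index set and the weights are arbitrary, since
the identity serves the signs of the statistic as well as differences of two normalizations. -/
theorem integral_sum_pairs_sq (h : IsIID Y ρ P) {g : 𝒴 → 𝒴 → ℝ}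
    (hg : MemLp (Function.uncurry g) 2 (ρ.prod ρ)) (hd : IsDegenerate ρ g)
    {S : Finset (Σ _ : ℕ, ℕ)} (hS : ∀ p ∈ S, p.2 < p.1) (a : (Σ _ : ℕ, ℕ) → ℝ) :
    ∫ ω, (∑ p ∈ S, a p * g (Y p.2 ω) (Y p.1 ω)) ^ 2 ∂P =
      (∑ p ∈ S, a p ^ 2) * ∫ z, g z.1 z.2 ^ 2 ∂(ρ.prod ρ) := by
  have hi : ∀ p ∈ S, ∀ q ∈ S, Integrable (fun ω => a p * g (Y p.2 ω) (Y p.1 ω) *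
      (a q * g (Y q.2 ω) (Y q.1 ω))) P := fun p hp q hq =>
    ((h.memLp_pair hg (hS p hp).ne).const_mul (a p)).integrable_mul
      ((h.memLp_pair hg (hS q hq).ne).const_mul (a q))
  simp only [pow_two, Finset.sum_mul_sum]
  rw [integral_finsetSum _ fun p hp => integrable_finsetSum _ fun q hq => hi p hp q hq,
    Finset.sum_mul]
  refine Finset.sum_congr rfl fun p hp => ?_
  rw [integral_finsetSum _ fun q hq => hi p hp q hq, Finset.sum_eq_single_of_mem p hp]
  · have e : ∀ ω, a p * g (Y p.2 ω) (Y p.1 ω) * (a p * g (Y p.2 ω) (Y p.1 ω)) =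
        a p * a p * (g (Y p.2 ω) (Y p.1 ω) * g (Y p.2 ω) (Y p.1 ω)) := fun ω => by ring
    simp only [e, integral_const_mul]
    congr 1
    exact h.integral_pair (φ := fun z => g z.1 z.2 * g z.1 z.2) (hg.1.mul hg.1) (hS p hp).ne
  · intro q hq hne
    have e : ∀ ω, a p * g (Y p.2 ω) (Y p.1 ω) * (a q * g (Y q.2 ω) (Y q.1 ω)) =
        a p * a q * (g (Y p.2 ω) (Y p.1 ω) * g (Y q.2 ω) (Y q.1 ω)) := fun ω => by ring
    simp only [e, integral_const_mul]
    rw [h.integral_pair_mul_pair hg hd (hS p hp) (hS q hq), mul_zero]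
    rintro ⟨h1, h2⟩
    exact hne (Sigma.ext h2.symm (heq_of_eq h1.symm))

theorem integral_sum_pairs_mul_sum_single (h : IsIID Y ρ P) {g : 𝒴 → 𝒴 → ℝ}
    (hg : MemLp (Function.uncurry g) 2 (ρ.prod ρ)) (hd : IsDegenerate ρ g)
    {φ : 𝒴 → ℝ} (hφ : MemLp φ 2 ρ)
    {S : Finset (Σ _ : ℕ, ℕ)} (hS : ∀ p ∈ S, p.2 < p.1) (a : (Σ _ : ℕ, ℕ) → ℝ)
    (S' : Finset ℕ) (b : ℕ → ℝ) :
    ∫ ω, (∑ p ∈ S, a p * g (Y p.2 ω) (Y p.1 ω)) * (∑ j ∈ S', b j * φ (Y j ω)) ∂P = 0 := by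
  have hi : ∀ p ∈ S, ∀ j ∈ S', Integrable (fun ω => a p * g (Y p.2 ω) (Y p.1 ω) *
      (b j * φ (Y j ω))) P := fun p hp j _ =>
    ((h.memLp_pair hg (hS p hp).ne).const_mul (a p)).integrable_mul
      ((h.memLp_single hφ j).const_mul (b j))
  simp only [Finset.sum_mul_sum]
  rw [integral_finsetSum _ fun p hp => integrable_finsetSum _ fun q hq => hi p hp q hq]
  refine Finset.sum_eq_zero fun p hp => ?_
  rw [integral_finsetSum _ fun q hq => hi p hp q hq]
  refine Finset.sum_eq_zero fun j _ => ?_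
  have e : ∀ ω, a p * g (Y p.2 ω) (Y p.1 ω) * (b j * φ (Y j ω)) =
      a p * b j * (g (Y p.2 ω) (Y p.1 ω) * φ (Y j ω)) := fun ω => by ring
  simp only [e, integral_const_mul]
  rw [h.integral_pair_mul_single hg hd hφ (hS p hp).ne, mul_zero]

theorem integral_sum_single_sq (h : IsIID Y ρ P) {φ : 𝒴 → ℝ} (hφ : MemLp φ 2 ρ)
    (h0 : ∫ x, φ x ∂ρ = 0) (S : Finset ℕ) (b : ℕ → ℝ) :
    ∫ ω, (∑ j ∈ S, b j * φ (Y j ω)) ^ 2 ∂P = (∑ j ∈ S, b j ^ 2) * ∫ x, φ x ^ 2 ∂ρ := by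
  have hi : ∀ p ∈ S, ∀ j ∈ S, Integrable (fun ω => b p * φ (Y p ω) * (b j * φ (Y j ω))) P :=
    fun p _ j _ => ((h.memLp_single hφ p).const_mul (b p)).integrable_mul
      ((h.memLp_single hφ j).const_mul (b j))
  simp only [pow_two, Finset.sum_mul_sum]
  rw [integral_finsetSum _ fun p hp => integrable_finsetSum _ fun q hq => hi p hp q hq,
    Finset.sum_mul]
  refine Finset.sum_congr rfl fun p hp => ?_
  rw [integral_finsetSum _ fun q hq => hi p hp q hq, Finset.sum_eq_single_of_mem p hp]
  · have e : ∀ ω, b p * φ (Y p ω) * (b p * φ (Y p ω)) =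
        b p * b p * (φ (Y p ω) * φ (Y p ω)) := fun ω => by ring
    simp only [e, integral_const_mul]
    congr 1
    exact h.integral_single (φ := fun x => φ x * φ x) (hφ.1.mul hφ.1) p
  · intro q _ hne
    have e : ∀ ω, b p * φ (Y p ω) * (b q * φ (Y q ω)) =
        b p * b q * (φ (Y p ω) * φ (Y q ω)) := fun ω => by ring
    simp only [e, integral_const_mul]
    have hind : IndepFun (fun ω => φ (Y p ω)) (fun ω => φ (Y q ω)) P :=
      (h.indep.indepFun hne.symm).comp₀ (h.meas p).aemeasurable (h.meas q).aemeasurable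
        (by rw [h.law]; exact hφ.1.aemeasurable) (by rw [h.law]; exact hφ.1.aemeasurable)
    rw [hind.integral_fun_mul_eq_mul_integral (h.memLp_single hφ p).1 (h.memLp_single hφ q).1,
      h.integral_single hφ.1, h0]
    simp

end IsIID

/-! ### Central limit theorems -/

section CLT

/-- Factors of modulus at most one are exchanged one at a time. -/
theorem norm_prod_sub_prod_le {ι : Type*} (s : Finset ι) {z w : ι → ℂ} (hz : ∀ i ∈ s, ‖z i‖ ≤ 1)
    (hw : ∀ i ∈ s, ‖w i‖ ≤ 1) : ‖∏ i ∈ s, z i - ∏ i ∈ s, w i‖ ≤ ∑ i ∈ s, ‖z i - w i‖ := by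
  classical
  induction s using Finset.induction_on with
  | empty => simp
  | insert a s ha ih =>
    rw [Finset.prod_insert ha, Finset.prod_insert ha, Finset.sum_insert ha]
    have h1 := ih (fun i hi => hz i (Finset.mem_insert_of_mem hi))
      (fun i hi => hw i (Finset.mem_insert_of_mem hi))
    have h2 : ‖∏ i ∈ s, w i‖ ≤ 1 := by
      rw [norm_prod]
      exact Finset.prod_le_one (fun _ _ => norm_nonneg _)
        fun i hi => hw i (Finset.mem_insert_of_mem hi)
    have h3 := hz a (Finset.mem_insert_self a s)
    calc _ = ‖z a * (∏ i ∈ s, z i - ∏ i ∈ s, w i) + (z a - w a) * ∏ i ∈ s, w i‖ := by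
          congr 1; ring
      _ ≤ ‖z a‖ * ‖∏ i ∈ s, z i - ∏ i ∈ s, w i‖ + ‖z a - w a‖ * ‖∏ i ∈ s, w i‖ := by
          rw [← norm_mul, ← norm_mul]; exact norm_add_le _ _
      _ ≤ 1 * ∑ i ∈ s, ‖z i - w i‖ + ‖z a - w a‖ * 1 := by gcongr
      _ = _ := by ring

variable {Ω 𝒴 : Type*} [MeasurableSpace Ω] [MeasurableSpace 𝒴] {Y : ℕ → Ω → 𝒴}
  {ρ : Measure 𝒴} [IsProbabilityMeasure ρ] {P : Measure Ω} [IsProbabilityMeasure P]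

/-- Both functions have the expansion 1 - t²/2 + o(t²); for the Gaussian this is the same Taylor
estimate applied to the standard normal law. -/
theorem charFun_sub_exp_isLittleO {φ : 𝒴 → ℝ} (hφ : AEMeasurable φ ρ) (h0 : ∫ x, φ x ∂ρ = 0)
    (h1 : ∫ x, φ x ^ 2 ∂ρ = 1) :
    (fun t : ℝ => charFun (ρ.map φ) t - Complex.exp (-(t : ℂ) ^ 2 / 2)) =o[𝓝 0]
      fun t : ℝ => t ^ 2 := by
  have h := taylor_charFun_two hφ h0 (by simpa using h1)
  have hg := taylor_charFun_two (P := gaussianReal 0 1) (X := id) aemeasurable_id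
    (by simp) (by
      have := variance_id_gaussianReal (μ := 0) (v := 1)
      rw [variance_eq_sub IsGaussian.memLp_two_id] at this
      simpa using this)
  refine (h.sub hg).congr_left fun t => ?_
  rw [Measure.map_id, charFun_gaussianReal]
  simp only [Complex.ofReal_zero, mul_zero, zero_mul, NNReal.coe_one, Complex.ofReal_one, one_mul,
    zero_sub, neg_div]
  ring

/-- Central limit theorem for weighted sums of i.i.d. variables, in terms of characteristic
functions, for a normalized summand. -/
theorem tendsto_charFun_weighted_sum_of_norm (h : IsIID Y ρ P) {φ : 𝒴 → ℝ} (hφ : MemLp φ 2 ρ)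
    (h0 : ∫ x, φ x ∂ρ = 0) (h1 : ∫ x, φ x ^ 2 ∂ρ = 1) {a : ℕ → ℕ → ℝ} {δ : ℕ → ℝ} {v : ℝ}
    (hδ : Tendsto δ atTop (𝓝 0)) (ha : ∀ n, ∀ j < n, |a n j| ≤ δ n)
    (hv : Tendsto (fun n => ∑ j ∈ Finset.range n, a n j ^ 2) atTop (𝓝 v)) (t : ℝ) :
    Tendsto (fun n => charFun (P.map fun ω => ∑ j ∈ Finset.range n, a n j * φ (Y j ω)) t) atTop
      (𝓝 (Complex.exp (-(v * t ^ 2 : ℝ) / 2))) := by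
  have hφm : AEMeasurable φ ρ := hφ.1.aemeasurable
  have hmeas : ∀ n j, AEMeasurable (fun ω => a n j * φ (Y j ω)) P := fun n j =>
    ((h.memLp_single hφ j).const_mul _).1.aemeasurable
  have hind : ∀ n, iIndepFun (fun j ω => a n j * φ (Y j ω)) P := fun n =>
    iIndepFun.comp₀ h.indep (fun j x => a n j * φ x) (fun j => (h.meas j).aemeasurable)
      (fun j => by rw [h.law]; exact hφm.const_mul _)
  have hlaw : ∀ n j, charFun (P.map fun ω => a n j * φ (Y j ω)) t =
      charFun (ρ.map φ) (a n j * t) := by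
    intro n j
    rw [charFun_map_mul_comp (h.memLp_single hφ j).1.aemeasurable]
    congr 1
    rw [← h.law j] at hφm ⊢
    rw [AEMeasurable.map_map_of_aemeasurable hφm (h.meas j).aemeasurable]
    rfl
  have e1 : ∀ n, charFun (P.map fun ω => ∑ j ∈ Finset.range n, a n j * φ (Y j ω)) t =
      ∏ j ∈ Finset.range n, charFun (ρ.map φ) (a n j * t) := by
    intro n
    rw [iIndepFun.charFun_map_fun_finsetSum_eq_prod (X := fun j ω => a n j * φ (Y j ω))
      (fun i _ => hmeas n i)
      (iIndepFun.precomp (g := ((↑) : Finset.range n → ℕ)) Subtype.val_injective (hind n)),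
      Finset.prod_apply]
    exact Finset.prod_congr rfl fun j _ => hlaw n j
  -- The Gaussian comparison product is exactly Gaussian, with variance the sum of the squared
  -- weights.
  have e2 : ∀ n, ∏ j ∈ Finset.range n, Complex.exp (-((a n j * t : ℝ) : ℂ) ^ 2 / 2) =
      Complex.exp (-((∑ j ∈ Finset.range n, a n j ^ 2) * t ^ 2 : ℝ) / 2) := by
    intro n
    rw [← Complex.exp_sum]
    congr 1
    push_cast
    rw [Finset.sum_mul, ← Finset.sum_neg_distrib, Finset.sum_div]
    exact Finset.sum_congr rfl fun j _ => by ring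
  have hprob : IsProbabilityMeasure (ρ.map φ) := Measure.isProbabilityMeasure_map hφm
  have key : Tendsto (fun n => ∏ j ∈ Finset.range n, charFun (ρ.map φ) (a n j * t) -
      ∏ j ∈ Finset.range n, Complex.exp (-((a n j * t : ℝ) : ℂ) ^ 2 / 2)) atTop (𝓝 0) := by
    have hbd : ∀ n, ‖∏ j ∈ Finset.range n, charFun (ρ.map φ) (a n j * t) -
        ∏ j ∈ Finset.range n, Complex.exp (-((a n j * t : ℝ) : ℂ) ^ 2 / 2)‖ ≤
        ∑ j ∈ Finset.range n, ‖charFun (ρ.map φ) (a n j * t) -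
          Complex.exp (-((a n j * t : ℝ) : ℂ) ^ 2 / 2)‖ := fun n => by
      refine norm_prod_sub_prod_le _ (fun j _ => norm_charFun_le_one _) fun j _ => ?_
      rw [Complex.norm_exp, Real.exp_le_one_iff, ← Complex.ofReal_pow, ← Complex.ofReal_neg]
      have : (((-(a n j * t) ^ 2 : ℝ) : ℂ) / 2).re = -(a n j * t) ^ 2 / 2 := by
        rw [show (2 : ℂ) = ((2 : ℝ) : ℂ) by simp, ← Complex.ofReal_div, Complex.ofReal_re]
      rw [this]
      nlinarith [sq_nonneg (a n j * t)]
    rw [Metric.tendsto_atTop]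
    intro ε hε
    -- For large n the sum of the squared weights is below |v| + 1, so t² times it is strictly below
    -- C; the last summand keeps C positive when t = 0.
    set C := t ^ 2 * (|v| + 1) + 1 with hC
    have hCpos : 0 < C := by positivity
    have hlo := (charFun_sub_exp_isLittleO hφm h0 h1).def (show 0 < ε / C by positivity)
    obtain ⟨r, hr, hr'⟩ := Metric.eventually_nhds_iff.1 hlo
    have hδt : Tendsto (fun n => δ n * |t|) atTop (𝓝 0) := by simpa using hδ.mul_const |t|
    obtain ⟨N, hN⟩ := eventually_atTop.1 ((hδt.eventually_lt_const hr).and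
      (hv.eventually_lt_const (show v < |v| + 1 by linarith [le_abs_self v])))
    refine ⟨N, fun n hn => ?_⟩
    rw [dist_zero_right]
    refine (hbd n).trans_lt ?_
    have h3 : ∀ j ∈ Finset.range n, ‖charFun (ρ.map φ) (a n j * t) -
          Complex.exp (-((a n j * t : ℝ) : ℂ) ^ 2 / 2)‖ ≤ ε / C * (a n j ^ 2 * t ^ 2) := by
      intro j hj
      have hsm : dist (a n j * t) 0 < r := by
        rw [dist_zero_right, Real.norm_eq_abs, abs_mul]
        refine lt_of_le_of_lt ?_ (hN n hn).1
        exact mul_le_mul_of_nonneg_right (ha n j (Finset.mem_range.1 hj)) (abs_nonneg t)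
      have := hr' hsm
      rwa [Real.norm_eq_abs, abs_of_nonneg (sq_nonneg (a n j * t)), mul_pow] at this
    refine (Finset.sum_le_sum h3).trans_lt ?_
    rw [← Finset.mul_sum, ← Finset.sum_mul]
    have h4 : (∑ j ∈ Finset.range n, a n j ^ 2) * t ^ 2 < C := by
      have := mul_le_mul_of_nonneg_right (hN n hn).2.le (sq_nonneg t)
      rw [hC]; linarith
    calc _ < ε / C * C := mul_lt_mul_of_pos_left h4 (by positivity)
      _ = ε := by field_simp
  simp only [e2] at key
  simp only [e1]
  have h5 : Tendsto (fun n => Complex.exp (-((∑ j ∈ Finset.range n, a n j ^ 2) * t ^ 2 : ℝ) / 2))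
      atTop (𝓝 (Complex.exp (-(v * t ^ 2 : ℝ) / 2))) := by
    have hcont : Continuous fun x : ℝ => Complex.exp (-(x * t ^ 2 : ℝ) / 2) := by fun_prop
    exact (hcont.tendsto v).comp hv
  simpa using key.add h5

/-- Central limit theorem for weighted sums of i.i.d. variables, in terms of characteristic
functions. -/
theorem tendsto_charFun_weighted_sum (h : IsIID Y ρ P) {φ : 𝒴 → ℝ} (hφ : MemLp φ 2 ρ)
    (h0 : ∫ x, φ x ∂ρ = 0) {a : ℕ → ℕ → ℝ} {δ : ℕ → ℝ} {v : ℝ}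
    (hδ : Tendsto δ atTop (𝓝 0)) (ha : ∀ n, ∀ j < n, |a n j| ≤ δ n)
    (hv : Tendsto (fun n => ∑ j ∈ Finset.range n, a n j ^ 2) atTop (𝓝 v)) (t : ℝ) :
    Tendsto (fun n => charFun (P.map fun ω => ∑ j ∈ Finset.range n, a n j * φ (Y j ω)) t) atTop
      (𝓝 (Complex.exp (-(v * (∫ x, φ x ^ 2 ∂ρ) * t ^ 2 : ℝ) / 2))) := by
  set s2 := ∫ x, φ x ^ 2 ∂ρ with hs2
  have hs0 : 0 ≤ s2 := integral_nonneg fun _ => sq_nonneg _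
  rcases hs0.eq_or_lt with hs | hs
  -- A function with zero second moment cannot be normalized, but then all sums vanish almost
  -- surely. Otherwise the standard deviation is moved from the function into the weights.
  · have hz : φ =ᵐ[ρ] 0 := by
      have := (integral_eq_zero_iff_of_nonneg (fun _ => sq_nonneg _) hφ.integrable_sq).1
        (hs2.symm.trans hs.symm)
      filter_upwards [this] with x hx
      simpa using hx
    have hz' : ∀ᵐ ω ∂P, ∀ j, φ (Y j ω) = 0 :=
      ae_all_iff.2 fun j => (h.measurePreserving j).quasiMeasurePreserving.ae hz
    have e : ∀ n, charFun (P.map fun ω => ∑ j ∈ Finset.range n, a n j * φ (Y j ω)) t = 1 := by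
      intro n
      have : (fun ω => ∑ j ∈ Finset.range n, a n j * φ (Y j ω)) =ᵐ[P] fun _ => 0 := by
        filter_upwards [hz'] with ω hω
        simp [hω]
      rw [Measure.map_congr this]
      simp
    simp only [e, ← hs]
    simp
  · set s := √s2 with hsdef
    have hspos : 0 < s := Real.sqrt_pos.2 hs
    have hss : s ^ 2 = s2 := Real.sq_sqrt hs0
    have := tendsto_charFun_weighted_sum_of_norm h (φ := fun x => s⁻¹ * φ x) (hφ.const_mul _)
      (by rw [integral_const_mul, h0, mul_zero])
      (by
        simp only [mul_pow]
        rw [integral_const_mul, ← hs2, ← hss]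
        field_simp)
      (a := fun n j => s * a n j) (δ := fun n => s * δ n) (v := s2 * v)
      (by simpa using hδ.const_mul s)
      (fun n j hj => by
        rw [abs_mul, abs_of_pos hspos]
        exact mul_le_mul_of_nonneg_left (ha n j hj) hspos.le)
      (by
        simp only [mul_pow, ← Finset.mul_sum, hss]
        exact hv.const_mul s2) t
    rw [mul_comm s2 v] at this
    refine this.congr fun n => ?_
    congr 2
    funext ω
    refine Finset.sum_congr rfl fun j _ => ?_
    field_simp

end CLT

/-! ### Degenerate U-statistics -/

section UStat

/-- The characteristic function of `½ (ζ² - 1)` with `ζ` standard normal. -/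
def quadChar (t : ℝ) : ℂ := charFun ((gaussianReal 0 1).map fun x => 1 / 2 * (x ^ 2 - 1)) t

variable {Ω 𝒴 : Type*} [MeasurableSpace Ω] [MeasurableSpace 𝒴] {Y : ℕ → Ω → 𝒴}
  {ρ : Measure 𝒴} [IsProbabilityMeasure ρ] {P : Measure Ω} [IsProbabilityMeasure P]

theorem integral_sum_orthonormal_sq {κ : Type*} (s : Finset κ) {ψ : κ → 𝒴 → ℝ}
    (hψ : ∀ α, MemLp (ψ α) 2 ρ)
    (hn : ∀ α, ∫ x, ψ α x ^ 2 ∂ρ = 1)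
    (ho : Pairwise fun α β => ∫ x, ψ α x * ψ β x ∂ρ = 0) (θ : κ → ℝ) :
    ∫ x, (∑ α ∈ s, θ α * ψ α x) ^ 2 ∂ρ = ∑ α ∈ s, θ α ^ 2 := by
  have hi : ∀ α β, Integrable (fun x => θ α * ψ α x * (θ β * ψ β x)) ρ := fun α β =>
    ((hψ α).const_mul _).integrable_mul ((hψ β).const_mul _)
  simp only [pow_two, Finset.sum_mul_sum]
  rw [integral_finsetSum _ fun α _ => integrable_finsetSum _ fun β _ => hi α β]
  refine Finset.sum_congr rfl fun α hα => ?_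
  rw [integral_finsetSum _ fun β _ => hi α β, Finset.sum_eq_single_of_mem α hα]
  · have e : ∀ x, θ α * ψ α x * (θ α * ψ α x) = θ α * θ α * ψ α x ^ 2 := fun x => by ring
    simp only [e, integral_const_mul, hn, mul_one]
  · intro β _ hne
    have e : ∀ x, θ α * ψ α x * (θ β * ψ β x) = θ α * θ β * (ψ α x * ψ β x) := fun x => by ring
    simp only [e, integral_const_mul]
    rw [ho hne.symm, mul_zero]

/-- The multivariate central limit theorem for orthonormal functions of i.i.d. variables. -/
theorem tendstoInDistribution_orthonormal (h : IsIID Y ρ P) {κ : Type*} [Fintype κ]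
    {ψ : κ → 𝒴 → ℝ} (hψ : ∀ α, MemLp (ψ α) 2 ρ) (h0 : ∀ α, ∫ x, ψ α x ∂ρ = 0)
    (hn : ∀ α, ∫ x, ψ α x ^ 2 ∂ρ = 1)
    (ho : Pairwise fun α β => ∫ x, ψ α x * ψ β x ∂ρ = 0) :
    TendstoInDistribution (fun (m : ℕ) ω => WithLp.toLp 2 fun α : κ =>
        ∑ k ∈ Finset.range m, (√m)⁻¹ * ψ α (Y k ω)) atTop
      (WithLp.toLp 2 : (κ → ℝ) → EuclideanSpace ℝ κ) (fun _ => P)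
      (Measure.pi fun _ => gaussianReal 0 1) := by
  have hm : ∀ m : ℕ, ∀ α, AEMeasurable (fun ω => ∑ k ∈ Finset.range m, (√m)⁻¹ * ψ α (Y k ω)) P :=
    fun m α => (h.memLp_sum_single (hψ α) _ fun _ => (√m)⁻¹).1.aemeasurable
  have hmE : ∀ m : ℕ, AEMeasurable (fun ω => WithLp.toLp 2 fun α : κ =>
        ∑ k ∈ Finset.range m, (√m)⁻¹ * ψ α (Y k ω)) P := fun m =>
    (WithLp.measurable_toLp 2 _).comp_aemeasurable (aemeasurable_pi_lambda _ fun α => hm m α)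
  refine ⟨hmE, (WithLp.measurable_toLp 2 _).aemeasurable, ?_⟩
  refine ProbabilityMeasure.tendsto_iff_tendsto_charFun.2 fun θ => ?_
  simp only [ProbabilityMeasure.coe_mk]
  -- Cramér–Wold: the inner product with θ is again a normalized i.i.d. sum, of a function whose
  -- variance is |θ|² by orthonormality. The scalar theorem is used at the argument 1.
  have hθ : MemLp (fun x => ∑ α, θ α * ψ α x) 2 ρ :=
    memLp_finsetSum _ fun α _ => (hψ α).const_mul _
  have hclt := tendsto_charFun_weighted_sum h hθ (by
      rw [integral_finsetSum _ fun α _ => ((hψ α).const_mul _).integrable one_le_two]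
      simp [integral_const_mul, h0]) (a := fun m _ => (√m)⁻¹) (δ := fun m => (√m)⁻¹) (v := 1)
    (tendsto_inv_atTop_zero.comp (Real.tendsto_sqrt_atTop.comp tendsto_natCast_atTop_atTop))
    (fun m j _ => by rw [abs_of_nonneg (by positivity)])
    (by
      refine tendsto_const_nhds.congr' ?_
      filter_upwards [eventually_gt_atTop 0] with m hm
      have : (0 : ℝ) < m := by exact_mod_cast hm
      simp only [Finset.sum_const, Finset.card_range, nsmul_eq_mul, inv_pow, Real.sq_sqrt this.le]
      field_simp) 1
  rw [charFun_pi]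
  simp only [charFun_gaussianReal, ← Complex.exp_sum]
  rw [integral_sum_orthonormal_sq _ hψ hn ho] at hclt
  convert hclt using 2 with m
  · rw [charFun_map_eq_integral (h.memLp_sum_single hθ _ fun _ => (√m)⁻¹).1.aemeasurable,
      charFun_apply, integral_map (hmE m) (by fun_prop)]
    refine integral_congr_ae (ae_of_all _ fun ω => ?_)
    simp only [PiLp.inner_apply, Complex.ofReal_one, one_mul]
    congr 3
    simp only [Finset.mul_sum]
    rw [Finset.sum_comm]
    refine Finset.sum_congr rfl fun α _ => ?_
    simp only [RCLike.inner_apply, conj_trivial, Finset.mul_sum]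
    exact Finset.sum_congr rfl fun k _ => by ring
  · congr 1
    push_cast
    simp [← Finset.sum_div, neg_div]

theorem tendsto_ae_mean_sq (h : IsIID Y ρ P) {φ : 𝒴 → ℝ} (hφ : MemLp φ 2 ρ)
    (hn : ∫ x, φ x ^ 2 ∂ρ = 1) :
    ∀ᵐ ω ∂P, Tendsto (fun m : ℕ => (∑ k ∈ Finset.range m, φ (Y k ω) ^ 2) / m) atTop (𝓝 1) := by
  have hφm : AEMeasurable (fun x => φ x ^ 2) ρ := hφ.1.aemeasurable.pow_const 2
  have := strong_law_ae_real (μ := P) (fun k ω => φ (Y k ω) ^ 2)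
    (h.memLp_single hφ 0).integrable_sq
    (fun i j hij => (h.indep.indepFun hij).comp₀ (φ := fun x => φ x ^ 2) (ψ := fun x => φ x ^ 2)
      (h.meas i).aemeasurable (h.meas j).aemeasurable (by rwa [h.law]) (by rwa [h.law]))
    (fun i => by
      have hid : IdentDistrib (Y i) (Y 0) P P :=
        ⟨(h.meas i).aemeasurable, (h.meas 0).aemeasurable, by rw [h.law, h.law]⟩
      exact hid.comp_of_aemeasurable (u := fun x => φ x ^ 2) (by rwa [h.law]))
  rw [h.integral_single (φ := fun x => φ x ^ 2) hφm.aestronglyMeasurable, hn] at this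
  exact this

theorem sum_pairs_mul (x : ℕ → ℝ) (m : ℕ) :
    ∑ p ∈ pairs m, x p.2 * x p.1 =
      1 / 2 * ((∑ k ∈ Finset.range m, x k) ^ 2 - ∑ k ∈ Finset.range m, x k ^ 2) := by
  rw [sum_pairs m fun i j => x i * x j]
  induction m with
  | zero => simp
  | succ m ih =>
    rw [Finset.sum_range_succ, ih, Finset.sum_range_succ (fun k => x k),
      Finset.sum_range_succ (fun k => x k ^ 2), ← Finset.sum_mul]
    ring

/-- By `sum_pairs_mul` the statistic is a fixed continuous function of the vector of normalized sums
and of the vector of empirical second moments. The first converges in law, the second in measure to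
the constant 1, and the continuous mapping theorem in Slutsky's form applies. -/
theorem tendsto_charFun_ustat_finite (h : IsIID Y ρ P) {κ : Type*} (s : Finset κ)
    {ψ : κ → 𝒴 → ℝ} (hψ : ∀ α, MemLp (ψ α) 2 ρ) (h0 : ∀ α, ∫ x, ψ α x ∂ρ = 0)
    (hn : ∀ α, ∫ x, ψ α x ^ 2 ∂ρ = 1)
    (ho : Pairwise fun α β => ∫ x, ψ α x * ψ β x ∂ρ = 0) (c : κ → ℝ) (t : ℝ) :
    Tendsto (fun m : ℕ => charFun (P.map fun ω => ∑ p ∈ pairs m,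
        (m : ℝ)⁻¹ * ∑ α ∈ s, c α * (ψ α (Y p.2 ω) * ψ α (Y p.1 ω))) t) atTop
      (𝓝 (∏ α ∈ s, quadChar (c α * t))) := by
  have hclt := tendstoInDistribution_orthonormal h (κ := s) (fun α => hψ α) (fun α => h0 α)
    (fun α => hn α) (fun α β hαβ => ho fun e => hαβ (Subtype.ext e))
  have hQm : ∀ m : ℕ, AEMeasurable (fun ω (α : s) =>
      (∑ k ∈ Finset.range m, ψ α (Y k ω) ^ 2) / m) P := fun m =>
    aemeasurable_pi_lambda _ fun α => (Finset.aemeasurable_fun_sum _ fun k _ =>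
      (h.memLp_single (hψ α) k).1.aemeasurable.pow_const 2).div_const _
  have hQ : TendstoInMeasure P (fun (m : ℕ) ω (α : s) =>
      (∑ k ∈ Finset.range m, ψ α (Y k ω) ^ 2) / m) atTop (fun _ _ => (1 : ℝ)) := by
    refine tendstoInMeasure_of_tendsto_ae (fun m => (hQm m).aestronglyMeasurable) ?_
    filter_upwards [ae_all_iff.2 fun α : s => tendsto_ae_mean_sq h (hψ α) (hn α)] with ω hω
    exact tendsto_pi_nhds.2 hω
  have hg : Continuous fun z : EuclideanSpace ℝ s × (s → ℝ) =>
      1 / 2 * ∑ α : s, c α * (z.1 α ^ 2 - z.2 α) := by fun_prop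
  have hT := tendsto_charFun_of_tendstoInDistribution
    (hclt.continuous_comp_prodMk_of_tendstoInMeasure_const hg hQ hQm) t
  have elim : charFun ((Measure.pi fun _ : s => gaussianReal 0 1).map
      fun ω => 1 / 2 * ∑ α : s, c α * ((WithLp.toLp 2 ω : EuclideanSpace ℝ s) α ^ 2 - 1)) t =
      ∏ α ∈ s, quadChar (c α * t) := by
    have hYm : ∀ α : s, Measurable fun ω : s → ℝ => 1 / 2 * c α * (ω α ^ 2 - 1) :=
      fun α => by fun_prop
    have hY : iIndepFun (fun (α : s) (ω : s → ℝ) => 1 / 2 * c α * (ω α ^ 2 - 1))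
        (Measure.pi fun _ : s => gaussianReal 0 1) :=
      iIndepFun_pi (X := fun (α : s) x => 1 / 2 * c α * (x ^ 2 - 1)) (fun α => by fun_prop)
    have := hY.charFun_map_fun_sum_eq_prod (fun α => (hYm α).aemeasurable)
    rw [← Finset.prod_coe_sort]
    have e : (fun ω : s → ℝ => 1 / 2 * ∑ α : s, c α *
        ((WithLp.toLp 2 ω : EuclideanSpace ℝ s) α ^ 2 - 1)) =
        fun ω => ∑ α : s, 1 / 2 * c α * (ω α ^ 2 - 1) := by
      funext ω
      rw [Finset.mul_sum]
      exact Finset.sum_congr rfl fun α _ => by ring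
    rw [e, this, Finset.prod_apply]
    refine Finset.prod_congr rfl fun α _ => ?_
    have hmap := Measure.map_map (μ := Measure.pi fun _ : s => gaussianReal 0 1)
      (g := fun x : ℝ => 1 / 2 * c α * (x ^ 2 - 1)) (f := Function.eval α) (by fun_prop)
      (by fun_prop)
    rw [(measurePreserving_eval (fun _ : s => gaussianReal 0 1) α).map_eq] at hmap
    rw [quadChar, ← charFun_map_mul, Measure.map_map (by fun_prop) (by fun_prop)]
    refine (congrArg (fun μ => charFun μ t) hmap.symm).trans ?_
    congr 2
    funext x
    simp only [Function.comp_apply]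
    ring
  rw [elim] at hT
  refine hT.congr fun m => ?_
  congr 2
  funext ω
  have eR : ∀ α, ∑ p ∈ pairs m, (m : ℝ)⁻¹ * (c α * (ψ α (Y p.2 ω) * ψ α (Y p.1 ω))) =
      1 / 2 * (c α * ((∑ k ∈ Finset.range m, (√m)⁻¹ * ψ α (Y k ω)) ^ 2 -
        (∑ k ∈ Finset.range m, ψ α (Y k ω) ^ 2) / m)) := by
    intro α
    have e := sum_pairs_mul (fun k => ψ α (Y k ω)) m
    rw [← Finset.mul_sum, ← Finset.mul_sum, e, ← Finset.mul_sum, mul_pow, inv_pow,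
      Real.sq_sqrt (by positivity)]
    ring
  simp only [Finset.mul_sum (a := (m : ℝ)⁻¹)]
  rw [Finset.sum_comm, Finset.mul_sum, ← Finset.sum_coe_sort s]
  exact Finset.sum_congr rfl fun α _ => (eR α).symm

theorem isDegenerate_sum {κ : Type*} (s : Finset κ) {ψ χ : κ → 𝒴 → ℝ}
    (hψ : ∀ α, MemLp (ψ α) 2 ρ) (h0 : ∀ α, ∫ x, ψ α x ∂ρ = 0)
    (hχ : ∀ α, MemLp (χ α) 2 ρ) (h0' : ∀ α, ∫ x, χ α x ∂ρ = 0) (c : κ → ℝ) :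
    IsDegenerate ρ fun x y => ∑ α ∈ s, c α * (ψ α x * χ α y) := by
  constructor
  · refine ae_of_all _ fun y => ?_
    rw [integral_finsetSum _ fun α _ =>
      (((hψ α).integrable one_le_two).mul_const _).const_mul _]
    simp [integral_const_mul, integral_mul_const, h0]
  · refine ae_of_all _ fun y => ?_
    rw [integral_finsetSum _ fun α _ =>
      (((hχ α).integrable one_le_two).const_mul _).const_mul _]
    simp [integral_const_mul, h0']

theorem IsDegenerate.sub {g g' : 𝒴 → 𝒴 → ℝ} (hg : IsDegenerate ρ g) (hg' : IsDegenerate ρ g')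
    (h2 : MemLp (Function.uncurry g) 2 (ρ.prod ρ)) (h2' : MemLp (Function.uncurry g') 2 (ρ.prod ρ)) :
    IsDegenerate ρ fun x y => g x y - g' x y := by
  have key : ∀ {g g' : 𝒴 → 𝒴 → ℝ}, MemLp (Function.uncurry g) 2 (ρ.prod ρ) →
      MemLp (Function.uncurry g') 2 (ρ.prod ρ) → (∀ᵐ x ∂ρ, ∫ y, g x y ∂ρ = 0) →
      (∀ᵐ x ∂ρ, ∫ y, g' x y ∂ρ = 0) → ∀ᵐ x ∂ρ, ∫ y, (g x y - g' x y) ∂ρ = 0 := by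
    intro g g' h2 h2' h h'
    filter_upwards [h, h', ae_memLp_section h2, ae_memLp_section h2'] with x h3 h4 h5 h6
    rw [integral_sub (h5.integrable one_le_two) (h6.integrable one_le_two), h3, h4, sub_zero]
  exact ⟨key (memLp_flip h2) (memLp_flip h2') hg.left hg'.left, key h2 h2' hg.right hg'.right⟩

theorem memLp_mul_prod {𝒵 : Type*} [MeasurableSpace 𝒵] {τ : Measure 𝒵} [IsProbabilityMeasure τ]
    {ψ : 𝒴 → ℝ} {χ : 𝒵 → ℝ} (hψ : MemLp ψ 2 ρ) (hχ : MemLp χ 2 τ) :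
    MemLp (fun z : 𝒴 × 𝒵 => ψ z.1 * χ z.2) 2 (ρ.prod τ) := by
  have hm : AEStronglyMeasurable (fun z : 𝒴 × 𝒵 => ψ z.1 * χ z.2) (ρ.prod τ) :=
    hψ.1.comp_fst.mul hχ.1.comp_snd
  refine (memLp_two_iff_integrable_sq hm).2 ?_
  simp only [mul_pow]
  exact hψ.integrable_sq.mul_prod hχ.integrable_sq

theorem memLp_sum_mul {κ : Type*} (s : Finset κ) {ψ χ : κ → 𝒴 → ℝ}
    (hψ : ∀ α, MemLp (ψ α) 2 ρ) (hχ : ∀ α, MemLp (χ α) 2 ρ) (c : κ → ℝ) :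
    MemLp (Function.uncurry fun x y => ∑ α ∈ s, c α * (ψ α x * χ α y)) 2 (ρ.prod ρ) :=
  memLp_finsetSum (f := fun α (z : 𝒴 × 𝒴) => c α * (ψ α z.1 * χ α z.2)) s
    fun α _ => (memLp_mul_prod (hψ α) (hχ α)).const_mul _

/-- The limit of the characteristic function of a degenerate U-statistic whose kernel has an
orthonormal expansion. -/
theorem tendsto_charFun_ustat (h : IsIID Y ρ P) {κ : Type*} {ψ : κ → 𝒴 → ℝ}
    (hψ : ∀ α, MemLp (ψ α) 2 ρ) (h0 : ∀ α, ∫ x, ψ α x ∂ρ = 0)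
    (hn : ∀ α, ∫ x, ψ α x ^ 2 ∂ρ = 1)
    (ho : Pairwise fun α β => ∫ x, ψ α x * ψ β x ∂ρ = 0) (c : κ → ℝ)
    {G : 𝒴 → 𝒴 → ℝ} (hG : MemLp (Function.uncurry G) 2 (ρ.prod ρ)) (hd : IsDegenerate ρ G)
    (hlim : Tendsto (fun s : Finset κ => ∫ z, (G z.1 z.2 -
      ∑ α ∈ s, c α * (ψ α z.1 * ψ α z.2)) ^ 2 ∂(ρ.prod ρ)) atTop (𝓝 0)) {t : ℝ} {z : ℂ}
    (hz : HasProd (fun α => quadChar (c α * t)) z) :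
    Tendsto (fun m : ℕ => charFun (P.map fun ω => ∑ p ∈ pairs m,
        (m : ℝ)⁻¹ * G (Y p.2 ω) (Y p.1 ω)) t) atTop (𝓝 z) := by
  rw [HasProd, SummationFilter.unconditional_filter] at hz
  refine tendsto_of_approx (l := (atTop : Filter (Finset κ)))
    (ε := fun s => |t| * √(∫ z : 𝒴 × 𝒴, (G z.1 z.2 -
      ∑ α ∈ s, c α * (ψ α z.1 * ψ α z.2)) ^ 2 ∂(ρ.prod ρ)))
    (fun s => tendsto_charFun_ustat_finite h s hψ h0 hn ho c t) hz
    (by simpa using hlim.sqrt.const_mul |t|) fun s m => ?_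
  have hSm := memLp_sum_mul s hψ hψ c
  have hpm : ∀ p ∈ pairs m, p.2 < p.1 := fun p hp => (mem_pairs.1 hp).2
  have hV := h.memLp_sum_pairs hG hpm fun _ => (m : ℝ)⁻¹
  have hV' := h.memLp_sum_pairs hSm hpm fun _ => (m : ℝ)⁻¹
  refine (norm_charFun_map_sub_le hV.1.aemeasurable hV'.1.aemeasurable (hV.sub hV') t).trans ?_
  refine mul_le_mul_of_nonneg_left (Real.sqrt_le_sqrt ?_) (abs_nonneg t)
  have hD : MemLp (Function.uncurry fun x y => G x y - ∑ α ∈ s, c α * (ψ α x * ψ α y)) 2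
      (ρ.prod ρ) := hG.sub hSm
  have hdD := hd.sub (isDegenerate_sum s hψ h0 hψ h0 c) hG hSm
  have e := h.integral_sum_pairs_sq hD hdD hpm fun _ => (m : ℝ)⁻¹
  simp only [mul_sub, Finset.sum_sub_distrib] at e
  rw [e]
  simp only [Finset.sum_const, nsmul_eq_mul, card_pairs]
  -- There are m(m-1)/2 pairs, each with weight 1/m, so the squared weights add up to at most 1 for
  -- every m. This makes the truncation error uniform in m.
  refine mul_le_of_le_one_left (integral_nonneg fun _ => sq_nonneg _) ?_
  rcases Nat.eq_zero_or_pos m with rfl | hm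
  · simp
  · have hm' : (1 : ℝ) ≤ m := by exact_mod_cast hm
    rw [inv_pow, mul_inv_le_iff₀ (by positivity)]
    nlinarith

end UStat

/-! ### Random times -/

section RandomTimes

/-- The sum of `F (z i) (z j)` over `i < j`. -/
def pairSum {𝒵 : Type*} {m : ℕ} (F : 𝒵 → 𝒵 → ℝ) (z : Fin m → 𝒵) : ℝ :=
  ∑ j, ∑ i, if i < j then F (z i) (z j) else 0

theorem sum_pairs_eq_pairSum {𝒵 : Type*} (F : 𝒵 → 𝒵 → ℝ) (z : ℕ → 𝒵) (m : ℕ) :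
    ∑ p ∈ pairs m, F (z p.2) (z p.1) = pairSum F fun i : Fin m => z i := by
  rw [sum_pairs m fun i j => F (z i) (z j), pairSum, Finset.sum_range]
  refine Finset.sum_congr rfl fun j _ => ?_
  have h : ∀ i : Fin m, (if i < j then F (z i) (z j) else 0) =
      (fun i : ℕ => if i < (j : ℕ) then F (z i) (z j) else 0) i := fun i => rfl
  simp only [h]
  rw [Fin.sum_univ_eq_sum_range (fun i : ℕ => if i < (j : ℕ) then F (z i) (z j) else 0),
    ← Finset.sum_filter]
  refine Finset.sum_congr ?_ fun _ _ => rfl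
  ext i
  simp only [Finset.mem_range, Finset.mem_filter]
  have := j.2
  omega

/-- The symmetric kernel orders each pair of points by time, whatever the order of the labels, so
the sum runs over all (i, j) with T i < T j. Sorting the labels by time turns it back into a sum
over increasing labels. -/
theorem pairSum_hatKernel {𝒵 : Type*} {m : ℕ} (F : 𝒵 → 𝒵 → ℝ) (z : Fin m → 𝒵)
    {T : Fin m → I} (hT : Function.Injective T) :
    pairSum (hatKernel F) (fun i => (z i, T i)) = pairSum F (z ∘ Tuple.sort T) := by
  have h1 : pairSum (hatKernel F) (fun i => (z i, T i)) =
      ∑ j, ∑ i, if T i < T j then F (z i) (z j) else 0 := by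
    have e1 : ∀ i j, (if i < j then hatKernel F (z i, T i) (z j, T j) else 0) =
        (if i < j then if T i < T j then F (z i) (z j) else 0 else 0) +
        (if i < j then if T j < T i then F (z j) (z i) else 0 else 0) := by
      intro i j
      by_cases hij : i < j
      · rcases lt_trichotomy (T i) (T j) with h | h | h
        · simp [hatKernel, hij, h, h.not_gt]
        · simp [hatKernel, hij, h]
        · simp [hatKernel, hij, h, h.not_gt]
      · simp [hij]
    have e2 : ∀ i j, (if T i < T j then F (z i) (z j) else 0) =
        (if i < j then if T i < T j then F (z i) (z j) else 0 else 0) +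
        (if j < i then if T i < T j then F (z i) (z j) else 0 else 0) := by
      intro i j
      rcases lt_trichotomy i j with h | rfl | h
      · simp [h, h.not_gt]
      · simp
      · simp [h, h.not_gt]
    rw [pairSum]
    simp only [e1, Finset.sum_add_distrib]
    rw [Finset.sum_congr rfl fun j _ => Finset.sum_congr rfl fun i _ => e2 i j]
    simp only [Finset.sum_add_distrib]
    congr 1
    exact Finset.sum_comm
  have hmono : StrictMono (T ∘ Tuple.sort T) :=
    (Tuple.monotone_sort T).strictMono_of_injective (hT.comp (Tuple.sort T).injective)
  rw [h1, pairSum, ← Equiv.sum_comp (Tuple.sort T)]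
  refine Finset.sum_congr rfl fun j _ => ?_
  rw [← Equiv.sum_comp (Tuple.sort T)]
  refine Finset.sum_congr rfl fun i _ => ?_
  simp only [Function.comp_apply]
  congr 1
  exact propext hmono.lt_iff_lt

theorem measurable_hatKernel {𝒵 : Type*} [MeasurableSpace 𝒵] {F : 𝒵 → 𝒵 → ℝ}
    (hF : Measurable (Function.uncurry F)) : Measurable (Function.uncurry (hatKernel F)) := by
  have h1 : Measurable fun z : (𝒵 × I) × (𝒵 × I) => F z.1.1 z.2.1 :=
    hF.comp ((measurable_fst.comp measurable_fst).prodMk (measurable_fst.comp measurable_snd))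
  have h2 : Measurable fun z : (𝒵 × I) × (𝒵 × I) => F z.2.1 z.1.1 :=
    hF.comp ((measurable_fst.comp measurable_snd).prodMk (measurable_fst.comp measurable_fst))
  exact Measurable.ite measurableSet_lt_time h1
    (Measurable.ite measurableSet_gt_time h2 measurable_const)

theorem measurable_pairSum {𝒵 : Type*} [MeasurableSpace 𝒵] {F : 𝒵 → 𝒵 → ℝ}
    (hF : Measurable (Function.uncurry F)) (m : ℕ) :
    Measurable (pairSum F : (Fin m → 𝒵) → ℝ) := by
  refine Finset.measurable_sum _ fun j _ => Finset.measurable_sum _ fun i _ => ?_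
  split_ifs
  · exact hF.comp (f := fun z : Fin m → 𝒵 => (z i, z j)) ((measurable_pi_apply i).prodMk (measurable_pi_apply j))
  · exact measurable_const

variable {Ω Ω' 𝒵 : Type*} [MeasurableSpace Ω] [MeasurableSpace Ω'] [MeasurableSpace 𝒵]
  {Z : ℕ → Ω → 𝒵} {κ : Measure 𝒵} [IsProbabilityMeasure κ]
  {P : Measure Ω} [IsProbabilityMeasure P] {Q : Measure Ω'} [IsProbabilityMeasure Q]

theorem IsIID.measurePreserving_pi (h : IsIID Z κ P) (m : ℕ) :
    MeasurePreserving (fun ω (i : Fin m) => Z i ω) P (Measure.pi fun _ => κ) := by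
  refine ⟨measurable_pi_lambda _ fun i => h.meas i, ?_⟩
  have := (iIndepFun_iff_map_fun_eq_pi_map (f := fun (i : Fin m) ω => Z i ω)
    fun i => (h.meas i).aemeasurable).1 (iIndepFun.precomp Fin.val_injective h.indep)
  rw [this]
  simp only [h.law]

theorem IsIID.charFun_pairSum (h : IsIID Z κ P) {F : 𝒵 → 𝒵 → ℝ}
    (hF : Measurable (Function.uncurry F)) (m : ℕ) (a t : ℝ) :
    charFun (P.map fun ω => ∑ p ∈ pairs m, a * F (Z p.2 ω) (Z p.1 ω)) t =
      ∫ z : Fin m → 𝒵, Complex.exp (t * (a * pairSum F z : ℝ) * Complex.I)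
        ∂(Measure.pi fun _ => κ) := by
  have e : (fun ω => ∑ p ∈ pairs m, a * F (Z p.2 ω) (Z p.1 ω)) =
      fun ω => a * pairSum F fun i : Fin m => Z i ω := by
    funext ω
    rw [← Finset.mul_sum, sum_pairs_eq_pairSum F fun i => Z i ω]
  have hp := h.measurePreserving_pi m
  have hm := (measurable_pairSum hF m).const_mul a
  have hm' : AEMeasurable (fun ω => a * pairSum F fun i : Fin m => Z i ω) P :=
    (hm.comp hp.measurable).aemeasurable
  rw [e, charFun_map_eq_integral hm', ← hp.map_eq]
  exact (integral_map (φ := fun ω (i : Fin m) => Z i ω)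
    (f := fun z => Complex.exp (t * (a * pairSum F z : ℝ) * Complex.I)) hp.aemeasurable
    (Measurable.aestronglyMeasurable (Complex.measurable_exp.comp
      (((Complex.measurable_ofReal.comp hm).const_mul _).mul_const _)))).symm

theorem ae_injective_pi (m : ℕ) :
    ∀ᵐ T : Fin m → I ∂(Measure.pi fun _ => volume), Function.Injective T := by
  have h : ∀ i j : Fin m, i ≠ j →
      ∀ᵐ T : Fin m → I ∂(Measure.pi fun _ => volume), T i ≠ T j := by
    intro i j hij
    have hind : iIndepFun (fun (i : Fin m) (T : Fin m → I) => T i)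
        (Measure.pi fun _ => volume) := iIndepFun_pi (X := fun _ x => x) fun _ => by fun_prop
    have hmap := (indepFun_iff_map_prod_eq_prod_map_map
      (measurable_pi_apply i).aemeasurable (measurable_pi_apply j).aemeasurable).1
      (hind.indepFun hij)
    have h1 := (measurePreserving_eval (fun _ : Fin m => (volume : Measure I)) i).map_eq
    have h2 := (measurePreserving_eval (fun _ : Fin m => (volume : Measure I)) j).map_eq
    have hne : ∀ᵐ z : I × I ∂(volume.prod volume), z.1 ≠ z.2 := by
      have hs : MeasurableSet {z : I × I | z.1 ≠ z.2} :=
        (measurableSet_eq_fun measurable_fst measurable_snd).compl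
      refine (Measure.ae_prod_iff_ae_ae hs).2 (ae_of_all _ fun x => ?_)
      have : ({x}ᶜ : Set I) ∈ ae (volume : Measure I) := compl_mem_ae_iff.2 (measure_singleton x)
      filter_upwards [this] with y hy
      exact fun e => hy e.symm
    have hmp : MeasurePreserving (fun T : Fin m → I => (T i, T j)) (Measure.pi fun _ => volume)
        (volume.prod volume) := ⟨by fun_prop, by rw [hmap]; exact congrArg₂ _ h1 h2⟩
    exact hmp.quasiMeasurePreserving.ae hne
  have h' : ∀ᵐ T : Fin m → I ∂(Measure.pi fun _ => volume), ∀ i j : Fin m, i ≠ j → T i ≠ T j :=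
    ae_all_iff.2 fun i => ae_all_iff.2 fun j => by
      by_cases hij : i = j
      · exact ae_of_all _ fun _ h => absurd hij h
      · filter_upwards [h i j hij] with T hT _ using hT
  filter_upwards [h'] with T hT i j hij
  by_contra hne
  exact hT i j hne hij

/-- Attaching independent uniform times does not change the distribution of an asymmetric
U-statistic. -/
theorem charFun_hatKernel_eq {Y : ℕ → Ω' → 𝒵 × I} (hZ : IsIID Z κ P)
    (hY : IsIID Y (κ.prod volume) Q) {F : 𝒵 → 𝒵 → ℝ} (hF : Measurable (Function.uncurry F))
    (m : ℕ) (a t : ℝ) :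
    charFun (P.map fun ω => ∑ p ∈ pairs m, a * F (Z p.2 ω) (Z p.1 ω)) t =
      charFun (Q.map fun ω => ∑ p ∈ pairs m, a * hatKernel F (Y p.2 ω) (Y p.1 ω)) t := by
  rw [hZ.charFun_pairSum hF, hY.charFun_pairSum (measurable_hatKernel hF)]
  have hmF := measurable_pairSum hF m
  have hmh := measurable_pairSum (measurable_hatKernel hF) m
  have hmp := (measurePreserving_arrowProdEquivProdArrow 𝒵 I (Fin m) (fun _ => κ)
    (fun _ => volume)).symm
  rw [← hmp.integral_comp']
  set Ψ : (Fin m → 𝒵) → ℂ := fun z => Complex.exp (t * (a * pairSum F z : ℝ) * Complex.I)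
    with hΨ
  have hint : Integrable (fun x : (Fin m → 𝒵) × (Fin m → I) => Complex.exp (t *
      (a * pairSum (hatKernel F) ((MeasurableEquiv.arrowProdEquivProdArrow 𝒵 I (Fin m)).symm x) :
        ℝ) * Complex.I)) ((Measure.pi fun _ => κ).prod (Measure.pi fun _ => volume)) := by
    refine Integrable.of_bound (C := 1) ?_ (ae_of_all _ fun ω => ?_)
    · have := hmh.comp hmp.measurable
      exact Measurable.aestronglyMeasurable (Complex.measurable_exp.comp
        (((Complex.measurable_ofReal.comp (this.const_mul a)).const_mul _).mul_const _))
    · rw [← Complex.ofReal_mul, Complex.norm_exp_ofReal_mul_I]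
  rw [integral_prod_symm _ hint]
  -- With the times frozen and distinct, the statistic is the original one evaluated at permuted
  -- points, and a product of equal measures is invariant under permutations.
  have hT : ∀ᵐ T : Fin m → I ∂(Measure.pi fun _ => volume),
      ∫ z, Complex.exp (t * (a * pairSum (hatKernel F)
        ((MeasurableEquiv.arrowProdEquivProdArrow 𝒵 I (Fin m)).symm (z, T)) : ℝ) * Complex.I)
        ∂(Measure.pi fun _ => κ) = ∫ z, Ψ z ∂(Measure.pi fun _ => κ) := by
    filter_upwards [ae_injective_pi m] with T hT
    have e : ∀ z : Fin m → 𝒵, pairSum (hatKernel F)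
        ((MeasurableEquiv.arrowProdEquivProdArrow 𝒵 I (Fin m)).symm (z, T)) =
        pairSum F (z ∘ Tuple.sort T) := fun z => pairSum_hatKernel F z hT
    simp only [e]
    have hσ : MeasurePreserving (MeasurableEquiv.arrowCongr' (Tuple.sort T).symm
        (MeasurableEquiv.refl 𝒵)) (Measure.pi fun _ => κ) (Measure.pi fun _ => κ) :=
      measurePreserving_arrowCongr' _ _ _ _ fun _ => MeasurePreserving.id κ
    exact hσ.integral_comp' Ψ
  rw [integral_congr_ae hT]
  simp

/-- A canonical realization, for arguments in which only the law matters. -/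
theorem isIID_infinitePi {𝒴 : Type*} [MeasurableSpace 𝒴] (ρ : Measure 𝒴)
    [IsProbabilityMeasure ρ] :
    IsIID (fun k (ω : ℕ → 𝒴) => ω k) ρ (Measure.infinitePi fun _ => ρ) where
  meas := fun k => measurable_pi_apply k
  law := fun k => Measure.infinitePi_map_eval _ k
  indep := iIndepFun_infinitePi (X := fun _ x => x) fun _ => measurable_id

end RandomTimes

/-! ### Hilbert–Schmidt operators -/

section HilbertSchmidt

variable {𝒴 : Type*} [MeasurableSpace 𝒴] {𝕜 : Type*} [RCLike 𝕜] {ρ : Measure 𝒴}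
  [IsProbabilityMeasure ρ]

open scoped ComplexConjugate

theorem ae_eq_zero_of_integral_rectangle {K : 𝒴 × 𝒴 → 𝕜} (hK : Integrable K (ρ.prod ρ))
    (h : ∀ A B : Set 𝒴, MeasurableSet A → MeasurableSet B →
      ∫ z in A ×ˢ B, K z ∂(ρ.prod ρ) = 0) : K =ᵐ[ρ.prod ρ] 0 := by
  refine hK.ae_eq_zero_of_forall_setIntegral_eq_zero fun S hS _ => ?_
  induction S, hS using MeasurableSpace.induction_on_inter
    (s := Set.image2 (fun s t => s ×ˢ t) {s : Set 𝒴 | MeasurableSet s} {t | MeasurableSet t})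
    generateFrom_prod.symm isPiSystem_prod with
  | empty => simp
  | basic S hS =>
    obtain ⟨A, hA, B, hB, rfl⟩ := hS
    exact h A B hA hB
  | compl S hS ih =>
    have h1 := integral_add_compl hS hK
    have h2 := h Set.univ Set.univ MeasurableSet.univ MeasurableSet.univ
    rw [Set.univ_prod_univ, setIntegral_univ] at h2
    rw [ih (measure_lt_top _ _), h2, zero_add] at h1
    exact h1
  | iUnion S hd hS ih =>
    rw [integral_iUnion hS hd hK.integrableOn]
    simp [ih _ (measure_lt_top _ _)]

theorem memLp_mul_prod_rclike {φ ψ : 𝒴 → 𝕜} (hφ : MemLp φ 2 ρ) (hψ : MemLp ψ 2 ρ) :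
    MemLp (fun z : 𝒴 × 𝒴 => φ z.1 * ψ z.2) 2 (ρ.prod ρ) := by
  have hm : AEStronglyMeasurable (fun z : 𝒴 × 𝒴 => φ z.1 * ψ z.2) (ρ.prod ρ) :=
    hφ.1.comp_fst.mul hψ.1.comp_snd
  refine (memLp_two_iff_integrable_sq_norm hm).2 ?_
  simp only [norm_mul, mul_pow]
  exact (hφ.integrable_norm_pow two_ne_zero).mul_prod (hψ.integrable_norm_pow two_ne_zero)

theorem integralOp_congr {g g' : 𝒴 → 𝒴 → 𝕜} (hg : MemLp (Function.uncurry g) 2 (ρ.prod ρ))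
    (hg' : MemLp (Function.uncurry g') 2 (ρ.prod ρ))
    (h : Function.uncurry g =ᵐ[ρ.prod ρ] Function.uncurry g') :
    integralOp ρ g hg = integralOp ρ g' hg' := by
  ext φ : 1
  apply Lp.ext
  refine (integralOp_ae_eq ρ g hg φ).trans (EventuallyEq.trans ?_ (integralOp_ae_eq ρ g' hg' φ).symm)
  filter_upwards [Measure.ae_ae_of_ae_prod h] with x hx
  refine integral_congr_ae ?_
  filter_upwards [hx] with y hy
  simp only [Function.uncurry_apply_pair] at hy
  rw [hy]

/-- The function `(x, y) ↦ φ(x) conj ψ(y)` in `L²`. -/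
def tens (φ ψ : Lp 𝕜 2 ρ) : Lp 𝕜 2 (ρ.prod ρ) :=
  (memLp_mul_prod_rclike (Lp.memLp φ) (Lp.memLp ψ).star).toLp
    (fun z => φ z.1 * (star ψ : 𝒴 → 𝕜) z.2)

theorem coeFn_tens (φ ψ : Lp 𝕜 2 ρ) :
    tens φ ψ =ᵐ[ρ.prod ρ] fun z => φ z.1 * conj (ψ z.2) :=
  MemLp.coeFn_toLp _

/-- The integral operator of a kernel in `L²(ρ × ρ)`. -/
def kerOp (K : Lp 𝕜 2 (ρ.prod ρ)) : Lp 𝕜 2 ρ →L[𝕜] Lp 𝕜 2 ρ :=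
  integralOp ρ (fun x y => K (x, y)) (Lp.memLp K)

theorem integralOp_eq_kerOp {g : 𝒴 → 𝒴 → 𝕜} (hg : MemLp (Function.uncurry g) 2 (ρ.prod ρ)) :
    integralOp ρ g hg = kerOp (hg.toLp _) :=
  integralOp_congr _ _ hg.coeFn_toLp.symm

/-- By Fubini, matrix coefficients of the operator are inner products of its kernel with rank-one
kernels. Linearity, injectivity, adjoints and expansion coefficients are all read off from this
pairing. -/
theorem inner_kerOp (K : Lp 𝕜 2 (ρ.prod ρ)) (φ ψ : Lp 𝕜 2 ρ) :
    inner 𝕜 φ (kerOp K ψ) = inner 𝕜 (tens φ ψ) K := by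
  rw [L2.inner_def, L2.inner_def]
  have e1 : (fun z => inner 𝕜 (tens φ ψ z) (K z)) =ᵐ[ρ.prod ρ]
      fun z => K z * (conj (φ z.1) * ψ z.2) := by
    filter_upwards [coeFn_tens φ ψ] with z hz
    rw [hz, RCLike.inner_apply]
    simp
  have hint : Integrable (fun z => K z * (conj (φ z.1) * ψ z.2)) (ρ.prod ρ) :=
    (Lp.memLp K).integrable_mul (memLp_mul_prod_rclike (Lp.memLp φ).star (Lp.memLp ψ))
  rw [integral_congr_ae e1, integral_prod _ hint]
  refine integral_congr_ae ?_
  filter_upwards [integralOp_ae_eq ρ (fun x y => K (x, y)) (Lp.memLp K) ψ] with x hx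
  rw [kerOp, hx, RCLike.inner_apply, ← integral_mul_const]
  congr 1
  funext y
  ring

theorem kerOp_tens (φ ψ θ : Lp 𝕜 2 ρ) : kerOp (tens φ ψ) θ = inner 𝕜 ψ θ • φ := by
  apply Lp.ext
  refine (integralOp_ae_eq ρ _ _ θ).trans (EventuallyEq.trans ?_ (Lp.coeFn_smul _ _).symm)
  filter_upwards [Measure.ae_ae_of_ae_prod (coeFn_tens φ ψ)] with x hx
  rw [Pi.smul_apply, L2.inner_def, smul_eq_mul, ← integral_mul_const]
  refine integral_congr_ae ?_
  filter_upwards [hx] with y hy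
  rw [hy, RCLike.inner_apply]
  ring

theorem inner_tens (φ ψ φ' ψ' : Lp 𝕜 2 ρ) :
    inner 𝕜 (tens φ ψ) (tens φ' ψ') = inner 𝕜 ψ' ψ * inner 𝕜 φ φ' := by
  rw [← inner_kerOp, kerOp_tens, inner_smul_right]

/-- `kerOp` as a continuous linear map. -/
def kerOpL : Lp 𝕜 2 (ρ.prod ρ) →L[𝕜] Lp 𝕜 2 ρ →L[𝕜] Lp 𝕜 2 ρ :=
  LinearMap.mkContinuous
    { toFun := kerOp
      map_add' := fun K K' => by
        ext φ : 1
        refine ext_inner_left 𝕜 fun θ => ?_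
        simp only [add_apply, inner_add_right, inner_kerOp]
      map_smul' := fun c K => by
        ext φ : 1
        refine ext_inner_left 𝕜 fun θ => ?_
        simp only [smul_apply, inner_smul_right, inner_kerOp,
          RingHom.id_apply] } 1
    (fun K => by
      rw [one_mul]
      refine ContinuousLinearMap.opNorm_le_bound _ (norm_nonneg _) fun φ => ?_
      change ‖(memLp_integralFun (g := fun x y => K (x, y)) (Lp.memLp K) (Lp.memLp φ)).toLp _‖ ≤ _
      rw [Lp.norm_toLp, Lp.norm_def, Lp.norm_def, ← ENNReal.toReal_mul]
      exact ENNReal.toReal_mono (ENNReal.mul_lt_top (Lp.memLp K).2 (Lp.memLp φ).2).ne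
        (eLpNorm_integralFun_le (g := fun x y => K (x, y)) (Lp.memLp K) (Lp.memLp φ)))

theorem kerOpL_apply (K : Lp 𝕜 2 (ρ.prod ρ)) : kerOpL K = kerOp K := rfl

/-- Rank-one kernels built from indicators test the integrals over rectangles, and these determine
an integrable function. -/
theorem eq_zero_of_inner_tens {K : Lp 𝕜 2 (ρ.prod ρ)}
    (h : ∀ φ ψ : Lp 𝕜 2 ρ, inner 𝕜 (tens φ ψ) K = 0) : K = 0 := by
  rw [Lp.eq_zero_iff_ae_eq_zero]
  refine ae_eq_zero_of_integral_rectangle ((Lp.memLp K).integrable one_le_two) fun A B hA hB => ?_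
  have := h (indicatorConstLp 2 hA (measure_ne_top ρ A) 1)
    (indicatorConstLp 2 hB (measure_ne_top ρ B) 1)
  rw [L2.inner_def] at this
  rw [← integral_indicator (hA.prod hB), ← this]
  refine integral_congr_ae ?_
  have hA' := (Measure.quasiMeasurePreserving_fst (μ := ρ) (ν := ρ)).ae
    (indicatorConstLp_coeFn (p := 2) (hs := hA) (hμs := measure_ne_top ρ A) (c := (1 : 𝕜)))
  have hB' := (Measure.quasiMeasurePreserving_snd (μ := ρ) (ν := ρ)).ae
    (indicatorConstLp_coeFn (p := 2) (hs := hB) (hμs := measure_ne_top ρ B) (c := (1 : 𝕜)))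
  filter_upwards [coeFn_tens (indicatorConstLp 2 hA (measure_ne_top ρ A) (1 : 𝕜))
    (indicatorConstLp 2 hB (measure_ne_top ρ B) 1), hA', hB'] with z h1 h2 h3
  rw [h1, h2, h3, RCLike.inner_apply]
  by_cases hzA : z.1 ∈ A <;> by_cases hzB : z.2 ∈ B <;> simp [Set.indicator, hzA, hzB]

theorem eq_zero_of_kerOp_eq_zero {K : Lp 𝕜 2 (ρ.prod ρ)} (h : kerOp K = 0) : K = 0 :=
  eq_zero_of_inner_tens fun φ ψ => by rw [← inner_kerOp, h]; simp

/-- Kernels with compact operator form a closed subspace, as the operator norm is at most the L²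
norm of the kernel. It contains the rank-one kernels, so its orthogonal complement is zero. -/
theorem isCompactOperator_kerOp (K : Lp 𝕜 2 (ρ.prod ρ)) : IsCompactOperator (kerOp K) := by
  let S : Submodule 𝕜 (Lp 𝕜 2 (ρ.prod ρ)) :=
    (compactOperator (RingHom.id 𝕜) (Lp 𝕜 2 ρ) (Lp 𝕜 2 ρ)).comap
      (kerOpL : Lp 𝕜 2 (ρ.prod ρ) →L[𝕜] Lp 𝕜 2 ρ →L[𝕜] Lp 𝕜 2 ρ).toLinearMap
  have hcl : IsClosed {f : Lp 𝕜 2 ρ →L[𝕜] Lp 𝕜 2 ρ | IsCompactOperator f} :=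
    isClosed_setOfPred_isCompactOperator
  have hS : IsClosed (S : Set (Lp 𝕜 2 (ρ.prod ρ))) := hcl.preimage kerOpL.continuous
  have hmem : ∀ φ ψ : Lp 𝕜 2 ρ, tens φ ψ ∈ S := by
    intro φ ψ
    change IsCompactOperator (kerOp (tens φ ψ))
    have e : (kerOp (tens φ ψ) : Lp 𝕜 2 ρ → Lp 𝕜 2 ρ) =
        (ContinuousLinearMap.toSpanSingleton 𝕜 φ) ∘ (innerSL 𝕜 ψ) := by
      funext θ
      simp [kerOp_tens]
    rw [e]
    have hc : IsCompactOperator (ContinuousLinearMap.toSpanSingleton 𝕜 φ) :=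
      isCompactOperator_of_locallyCompactSpace_rng _
    exact hc.comp_clm (innerSL 𝕜 ψ)
  have hbot : Sᗮ = ⊥ := by
    rw [Submodule.eq_bot_iff]
    intro K' hK'
    exact eq_zero_of_inner_tens fun φ ψ => (Submodule.mem_orthogonal S K').1 hK' _ (hmem φ ψ)
  have hc : CompleteSpace S := hS.completeSpace_coe
  have htop : S = ⊤ := (Submodule.orthogonal_eq_bot_iff).1 hbot
  have : K ∈ S := htop ▸ Submodule.mem_top
  exact this

/-- A family of eigenvectors of the self-adjoint operator of the kernel `K` which is orthonormal
and spans the eigenspaces at nonzero eigenvalues yields the expansion of `K`. -/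
theorem hasSum_kernel {K : Lp 𝕜 2 (ρ.prod ρ)} (hsym : (kerOp K).IsSymmetric) {κ : Type*}
    {e : κ → Lp 𝕜 2 ρ} (he : Orthonormal 𝕜 e) {lam : κ → 𝕜}
    (hlam : ∀ α, kerOp K (e α) = lam α • e α)
    (hspan : ∀ z : 𝕜, z ≠ 0 → ∀ x, kerOp K x = z • x → x ∈ (Submodule.span 𝕜 (Set.range e))) :
    HasSum (fun α => lam α • tens (e α) (e α)) K ∧ Summable (fun α => ‖lam α‖ ^ 2) ∧
      ∑' α, ‖lam α‖ ^ 2 = ‖K‖ ^ 2 := by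
  classical
  have hv : Orthonormal 𝕜 fun α => tens (e α) (e α) := by
    rw [orthonormal_iff_ite]
    intro α β
    rw [inner_tens, orthonormal_iff_ite.1 he, orthonormal_iff_ite.1 he]
    by_cases h : α = β
    · simp [h]
    · simp [h]
  have hin : ∀ α, inner 𝕜 (tens (e α) (e α)) K = lam α := fun α => by
    rw [← inner_kerOp, hlam, inner_smul_right, orthonormal_iff_ite.1 he]
    simp
  have hs2 : Summable fun α => ‖lam α‖ ^ 2 := by
    have := hv.inner_products_summable K
    simpa only [hin] using this
  have hsum : Summable fun α => lam α • tens (e α) (e α) :=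
    (hv.orthogonalFamily.summable_iff_norm_sq_summable lam).2 hs2
  obtain ⟨K', hK'⟩ := hsum
  have hop : ∀ x, HasSum (fun α => lam α • inner 𝕜 (e α) x • e α) (kerOp K' x) := by
    intro x
    have h1 := (hK'.mapL (kerOpL : Lp 𝕜 2 (ρ.prod ρ) →L[𝕜] Lp 𝕜 2 ρ →L[𝕜] Lp 𝕜 2 ρ)).mapL
      (ContinuousLinearMap.apply 𝕜 (Lp 𝕜 2 ρ) x)
    simpa [kerOpL_apply, kerOp_tens] using h1
  have hbot := ContinuousLinearMap.orthogonalComplement_iSup_eigenspaces_eq_bot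
    (isCompactOperator_kerOp K) hsym
  -- K' denotes the sum of the expansion. The difference operator kills every basis vector and
  -- everything orthogonal to all of them; as its kernel is closed, it is the whole space.
  have hker : kerOp (K - K') = 0 := by
    have hsub : ∀ x, kerOp (K - K') x = kerOp K x - kerOp K' x := fun x => by
      rw [← kerOpL_apply, map_sub]; rfl
    have h1 : ∀ α, kerOp (K - K') (e α) = 0 := by
      intro α
      rw [hsub, hlam, sub_eq_zero]
      refine (HasSum.unique ?_ (hop (e α)))
      have : (fun β => lam β • inner 𝕜 (e β) (e α) • e β) =
          fun β => if β = α then lam α • e α else 0 := by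
        funext β
        rw [orthonormal_iff_ite.1 he]
        by_cases h : β = α
        · simp [h]
        · simp [h]
      rw [this]
      exact hasSum_ite_eq α _
    have h2 : ∀ x, (∀ α, inner 𝕜 (e α) x = 0) → kerOp (K - K') x = 0 := by
      intro x hx
      have hx' : ∀ w ∈ Submodule.span 𝕜 (Set.range e), inner 𝕜 w x = 0 := by
        intro w hw
        have : x ∈ (Submodule.span 𝕜 (Set.range e))ᗮ := by
          rw [Submodule.mem_orthogonal']
          intro u hu
          induction hu using Submodule.span_induction with
          | mem u hu =>
            obtain ⟨α, rfl⟩ := hu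
            exact inner_eq_zero_symm.1 (hx α)
          | zero => simp
          | add u v _ _ hu hv => rw [inner_add_right, hu, hv, add_zero]
          | smul a u _ hu => rw [inner_smul_right, hu, mul_zero]
        exact (Submodule.mem_orthogonal _ _).1 this w hw
      -- By symmetry the image of x is orthogonal to every eigenvector: at eigenvalue zero
      -- trivially, otherwise because the eigenvector lies in the span. By the spectral theorem for
      -- compact operators only zero is orthogonal to all eigenspaces.
      have hKx : kerOp K x = 0 := by
        have : kerOp K x ∈ (⨆ μ, Module.End.eigenspace (kerOp K : Module.End 𝕜 (Lp 𝕜 2 ρ)) μ)ᗮ := by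
          rw [← Submodule.iInf_orthogonal, Submodule.mem_iInf]
          intro z
          rw [Submodule.mem_orthogonal]
          intro w hw
          rw [Module.End.mem_eigenspace_iff] at hw
          have hw' : kerOp K w = z • w := hw
          have hsw : inner 𝕜 (kerOp K w) x = inner 𝕜 w (kerOp K x) := hsym w x
          rw [← hsw, hw', inner_smul_left]
          by_cases hz : z = 0
          · simp [hz]
          · rw [hx' w (hspan z hz w hw'), mul_zero]
        rw [hbot] at this
        exact (Submodule.mem_bot 𝕜).1 this
      rw [hsub, hKx, zero_sub, neg_eq_zero]
      refine HasSum.unique (hop x) ?_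
      simp only [hx, zero_smul, smul_zero]
      exact hasSum_zero
    ext1 x
    have hc : IsClosed ((LinearMap.ker (kerOp (K - K')).toLinearMap : Submodule 𝕜 (Lp 𝕜 2 ρ)) :
        Set (Lp 𝕜 2 ρ)) := (kerOp (K - K')).isClosed_ker
    have hcs : CompleteSpace (LinearMap.ker (kerOp (K - K')).toLinearMap) := hc.completeSpace_coe
    have htop : LinearMap.ker (kerOp (K - K')).toLinearMap = ⊤ := by
      rw [← Submodule.orthogonal_eq_bot_iff, Submodule.eq_bot_iff]
      intro x hx
      have hxe : x ∈ LinearMap.ker (kerOp (K - K')).toLinearMap :=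
        h2 x fun α => (Submodule.mem_orthogonal _ _).1 hx (e α) (h1 α)
      exact inner_self_eq_zero.1 ((Submodule.mem_orthogonal _ _).1 hx x hxe)
    have : x ∈ LinearMap.ker (kerOp (K - K')).toLinearMap := htop ▸ Submodule.mem_top
    exact this
  have hKK : K = K' := sub_eq_zero.1 (eq_zero_of_kerOp_eq_zero hker)
  subst hKK
  refine ⟨hK', hs2, ?_⟩
  have h1 : Tendsto (fun s : Finset κ => ‖∑ α ∈ s, lam α • tens (e α) (e α)‖ ^ 2) atTop
      (𝓝 (‖K‖ ^ 2)) := by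
    rw [HasSum, SummationFilter.unconditional_filter] at hK'
    exact hK'.norm.pow 2
  have h2 : ∀ s : Finset κ, ‖∑ α ∈ s, lam α • tens (e α) (e α)‖ ^ 2 = ∑ α ∈ s, ‖lam α‖ ^ 2 :=
    fun s => hv.orthogonalFamily.norm_sum lam s
  simp only [h2] at h1
  exact HasSum.tsum_eq (by simpa [HasSum] using h1)

end HilbertSchmidt

/-! ### Enumeration of eigenvalues -/

section Eigenvalues

theorem exists_idx_equiv (κ : Type*) [Countable κ] : ∃ R : ℕ∞, Nonempty (Idx R ≃ κ) := by
  rcases finite_or_infinite κ with h | h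
  · obtain ⟨n, ⟨e⟩⟩ := Finite.exists_equiv_fin κ
    refine ⟨n, ⟨Equiv.trans ?_ e.symm⟩⟩
    exact (Equiv.subtypeEquivRight fun r => by simp).trans Fin.equivSubtype.symm
  · obtain ⟨e⟩ := nonempty_equiv_of_countable (α := ℕ) (β := κ)
    refine ⟨⊤, ⟨Equiv.trans ?_ e⟩⟩
    exact Equiv.subtypeUnivEquiv fun r => by simp

theorem encard_preimage_equiv {α β : Type*} (e : α ≃ β) (S : Set β) :
    {a | e a ∈ S}.encard = S.encard := by
  have : {a | e a ∈ S} = e.symm '' S := (e.image_symm_eq_preimage S).symm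
  rw [this, e.symm.injective.encard_image]

variable {𝕜 H : Type*} [RCLike 𝕜] [NormedAddCommGroup H] [InnerProductSpace 𝕜 H]
  [CompleteSpace H]

/-- Index set of an eigenbasis for the eigenvalues in `Z`. -/
abbrev EigenIdx (T : H →L[𝕜] H) (Z : Set 𝕜) : Type _ :=
  Σ z : Z, Fin (Module.finrank 𝕜 (Module.End.eigenspace (T : H →ₗ[𝕜] H) (z : 𝕜)))

/-- Away from zero the eigenspaces of a compact operator are finite-dimensional and, by symmetry,
mutually orthogonal, so orthonormal bases of them can be put together. A general set Z allows both
all nonzero real eigenvalues and only the positive ones of a complex operator. -/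
theorem exists_eigenbasis {T : H →L[𝕜] H} (hc : IsCompactOperator T) (hs : T.IsSymmetric)
    {Z : Set 𝕜} (hZ : (0 : 𝕜) ∉ Z) :
    ∃ e : EigenIdx T Z → H, Orthonormal 𝕜 e ∧ (∀ α, T (e α) = (α.1 : 𝕜) • e α) ∧
      ∀ z ∈ Z, ∀ x, T x = z • x → x ∈ Submodule.span 𝕜 (Set.range e) := by
  have hfd : ∀ z : Z, FiniteDimensional 𝕜 (Module.End.eigenspace (T : H →ₗ[𝕜] H) (z : 𝕜)) :=
    fun z => ContinuousLinearMap.finite_dimensional_eigenspace hc _ fun h => hZ (h ▸ z.2)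
  let b : ∀ z : Z, OrthonormalBasis (Fin (Module.finrank 𝕜 (Module.End.eigenspace
      (T : H →ₗ[𝕜] H) (z : 𝕜)))) 𝕜 (Module.End.eigenspace (T : H →ₗ[𝕜] H) (z : 𝕜)) :=
    fun z => stdOrthonormalBasis 𝕜 _
  have hOF : OrthogonalFamily 𝕜 (fun z : Z => Module.End.eigenspace (T : H →ₗ[𝕜] H) (z : 𝕜))
      fun z => (Module.End.eigenspace (T : H →ₗ[𝕜] H) (z : 𝕜)).subtypeₗᵢ :=
    (LinearMap.IsSymmetric.orthogonalFamily_eigenspaces (T := (T : H →ₗ[𝕜] H)) hs).comp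
      Subtype.val_injective
  refine ⟨fun α => (b α.1 α.2 : H), hOF.orthonormal_sigma_orthonormal fun z => (b z).orthonormal,
    fun α => Module.End.mem_eigenspace_iff.1 (b α.1 α.2).2, fun z hz x hx => ?_⟩
  have hmem : x ∈ Module.End.eigenspace (T : H →ₗ[𝕜] H) z := Module.End.mem_eigenspace_iff.2 hx
  have h1 := (b ⟨z, hz⟩).sum_repr ⟨x, hmem⟩
  have h2 := congrArg (Submodule.subtype _) h1
  rw [map_sum] at h2
  simp only [map_smul, Submodule.subtype_apply] at h2
  rw [← h2]
  exact Submodule.sum_mem _ fun i _ => Submodule.smul_mem _ _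
    (Submodule.subset_span ⟨⟨⟨z, hz⟩, i⟩, rfl⟩)

theorem encard_eigenIdx {T : H →L[𝕜] H} (hc : IsCompactOperator T) {Z : Set 𝕜} {z : 𝕜}
    (hz : z ∈ Z) (hz0 : z ≠ 0) :
    {α : EigenIdx T Z | (α.1 : 𝕜) = z}.encard = eigenMult T z := by
  have hfd : FiniteDimensional 𝕜 (Module.End.eigenspace (T : H →ₗ[𝕜] H) z) :=
    ContinuousLinearMap.finite_dimensional_eigenspace hc _ hz0
  have hS : {α : EigenIdx T Z | (α.1 : 𝕜) = z} =
      Set.range fun i : Fin (Module.finrank 𝕜 (Module.End.eigenspace (T : H →ₗ[𝕜] H) z)) =>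
        (⟨⟨z, hz⟩, i⟩ : EigenIdx T Z) := by
    ext α
    constructor
    · rintro h
      obtain ⟨⟨w, hw⟩, i⟩ := α
      simp only [Set.mem_ofPred_eq] at h
      subst h
      exact ⟨i, rfl⟩
    · rintro ⟨i, rfl⟩
      rfl
  have hinj : Function.Injective fun i : Fin (Module.finrank 𝕜 (Module.End.eigenspace
      (T : H →ₗ[𝕜] H) z)) => (⟨⟨z, hz⟩, i⟩ : EigenIdx T Z) := fun i j hij => by simpa using hij
  rw [hS, ← Set.image_univ, hinj.encard_image, Set.encard_univ, eigenMult,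
    ← Module.finrank_eq_rank]
  simp

end Eigenvalues

/-! ### Expansion of symmetric degenerate kernels -/

section Expansion

variable {𝒴 : Type*} [MeasurableSpace 𝒴] {ρ : Measure 𝒴} [IsProbabilityMeasure ρ]

/-- `ψ` is an orthonormal family of centered functions in `L²(ρ)`. -/
structure IsCenteredOrthonormal {κ : Type*} (ρ : Measure 𝒴) (ψ : κ → 𝒴 → ℝ) : Prop where
  memLp : ∀ α, MemLp (ψ α) 2 ρ
  mean : ∀ α, ∫ x, ψ α x ∂ρ = 0
  norm : ∀ α, ∫ x, ψ α x ^ 2 ∂ρ = 1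
  orth : Pairwise fun α β => ∫ x, ψ α x * ψ β x ∂ρ = 0

/-- Exchanging the two integration variables gives the adjoint of an integral operator. The
statement with two kernels covers symmetric, transposed and Hermitian kernels at once. -/
theorem inner_integralOp_swap {𝕜 : Type*} [RCLike 𝕜] {g g' : 𝒴 → 𝒴 → 𝕜}
    (hg : MemLp (Function.uncurry g) 2 (ρ.prod ρ))
    (hg' : MemLp (Function.uncurry g') 2 (ρ.prod ρ))
    (h : ∀ᵐ z ∂(ρ.prod ρ), g' z.1 z.2 = star (g z.2 z.1)) (φ ψ : Lp 𝕜 2 ρ) :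
    inner 𝕜 (integralOp ρ g' hg' φ) ψ = inner 𝕜 φ (integralOp ρ g hg ψ) := by
  rw [← inner_conj_symm, integralOp_eq_kerOp, integralOp_eq_kerOp, inner_kerOp, inner_kerOp,
    L2.inner_def, L2.inner_def, ← integral_conj, ← integral_prod_swap]
  refine integral_congr_ae ?_
  have hsw := Measure.measurePreserving_swap (μ := ρ) (ν := ρ) |>.quasiMeasurePreserving
  filter_upwards [hsw.ae (coeFn_tens ψ φ), coeFn_tens φ ψ, hsw.ae hg'.coeFn_toLp, hg.coeFn_toLp,
    hsw.ae h] with z h1 h2 h3 h4 h5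
  have h3' : hg'.toLp (Function.uncurry g') z.swap = g' z.2 z.1 := h3
  have h4' : hg.toLp (Function.uncurry g) z = g z.1 z.2 := h4
  simp only [Prod.fst_swap, Prod.snd_swap] at h1 h2 h5
  rw [h1, h2, h3', h4', h5]
  simp only [RCLike.inner_apply, map_mul, RCLike.star_def, RCLike.conj_conj]
  ring

/-- By Fubini and degeneracy every function in the range of the operator has mean zero, and an
eigenvector at a nonzero eigenvalue lies in the range. The central limit theorem needs this
centring. -/
theorem integral_eq_zero_of_eigen {𝕜 : Type*} [RCLike 𝕜] {G : 𝒴 → 𝒴 → 𝕜}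
    (hG : MemLp (Function.uncurry G) 2 (ρ.prod ρ)) (hd : ∀ᵐ y ∂ρ, ∫ x, G x y ∂ρ = 0)
    {e : Lp 𝕜 2 ρ} {c : 𝕜} (hc : c ≠ 0) (he : integralOp ρ G hG e = c • e) : ∫ x, e x ∂ρ = 0 := by
  have h1 : ∫ x, integralOp ρ G hG e x ∂ρ = 0 := by
    rw [integral_congr_ae (integralOp_ae_eq ρ G hG e)]
    have hint : Integrable (fun z : 𝒴 × 𝒴 => G z.1 z.2 * e z.2) (ρ.prod ρ) :=
      hG.integrable_mul ((Lp.memLp e).comp_snd ρ)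
    rw [integral_integral_swap (f := fun x y => G x y * e y) hint]
    refine integral_eq_zero_of_ae ?_
    filter_upwards [hd] with y hy
    rw [integral_mul_const, hy, zero_mul, Pi.zero_apply]
  rw [he, integral_congr_ae (Lp.coeFn_smul c e)] at h1
  simp only [Pi.smul_apply, smul_eq_mul, integral_const_mul] at h1
  exact (mul_eq_zero.1 h1).resolve_left hc

theorem isCenteredOrthonormal_of_lp {κ : Type*} {e : κ → Lp ℝ 2 ρ} (he : Orthonormal ℝ e)
    (hm : ∀ α, ∫ x, e α x ∂ρ = 0) : IsCenteredOrthonormal ρ fun α => (e α : 𝒴 → ℝ) where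
  memLp := fun α => Lp.memLp _
  mean := hm
  norm := fun α => by
    have := he.1 α
    have h2 := norm_toLp_sq (Lp.memLp (e α))
    rw [Lp.toLp_coeFn, this] at h2
    rw [← h2]; norm_num
  orth := fun α β hαβ => by
    have h0 : inner ℝ (e α) (e β) = 0 := he.2 hαβ
    rw [L2.inner_def] at h0
    rw [← h0]
    refine integral_congr_ae (ae_of_all _ fun x => ?_)
    simp [mul_comm]

theorem tendsto_integral_sq_of_hasSum {κ : Type*} {F : κ → 𝒴 → ℝ} (hF : ∀ α, MemLp (F α) 2 ρ)
    {G : 𝒴 → ℝ} (hG : MemLp G 2 ρ) (h : HasSum (fun α => (hF α).toLp (F α)) (hG.toLp G)) :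
    Tendsto (fun s : Finset κ => ∫ x, (G x - ∑ α ∈ s, F α x) ^ 2 ∂ρ) atTop (𝓝 0) := by
  rw [HasSum, SummationFilter.unconditional_filter] at h
  have h1 := (((tendsto_const_nhds (x := hG.toLp G)).sub h).norm).pow 2
  simp only [sub_self, norm_zero, ne_eq, OfNat.ofNat_ne_zero, not_false_eq_true, zero_pow] at h1
  refine h1.congr fun s => ?_
  have hS : MemLp (fun x => ∑ α ∈ s, F α x) 2 ρ := memLp_finsetSum s fun α _ => hF α
  rw [← toLp_finset_sum hF s hS, ← MemLp.toLp_sub hG hS, norm_toLp_sq]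
  rfl

theorem hasSum_of_tendsto_integral_sq {κ : Type*} {F : κ → 𝒴 → ℝ} (hF : ∀ α, MemLp (F α) 2 ρ)
    {G : 𝒴 → ℝ} (hG : MemLp G 2 ρ)
    (h : Tendsto (fun s : Finset κ => ∫ x, (G x - ∑ α ∈ s, F α x) ^ 2 ∂ρ) atTop (𝓝 0)) :
    HasSum (fun α => (hF α).toLp (F α)) (hG.toLp G) := by
  rw [HasSum, SummationFilter.unconditional_filter, tendsto_iff_norm_sub_tendsto_zero]
  have h1 := h.sqrt
  rw [Real.sqrt_zero] at h1
  refine h1.congr fun s => ?_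
  have hS : MemLp (fun x => ∑ α ∈ s, F α x) 2 ρ := memLp_finsetSum s fun α _ => hF α
  have e : ∫ x, (G x - ∑ α ∈ s, F α x) ^ 2 ∂ρ = ‖hG.toLp G - ∑ α ∈ s, (hF α).toLp (F α)‖ ^ 2 := by
    rw [← toLp_finset_sum hF s hS, ← MemLp.toLp_sub hG hS, norm_toLp_sq]
    rfl
  rw [e, Real.sqrt_sq (norm_nonneg _), norm_sub_rev]

/-- Spectral expansion of a symmetric degenerate kernel, with the eigenvalues enumerated. -/
theorem exists_eigen_expansion {G : 𝒴 → 𝒴 → ℝ} (hG : MemLp (Function.uncurry G) 2 (ρ.prod ρ))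
    (hd : IsDegenerate ρ G) (hsym : ∀ᵐ z ∂(ρ.prod ρ), G z.1 z.2 = G z.2 z.1) :
    ∃ (R : ℕ∞) (c : Idx R → ℝ) (ψ : Idx R → 𝒴 → ℝ),
      ListsNonzeroEigenvalues (integralOp ρ G hG) c ∧ Summable (fun r => c r ^ 2) ∧
      ∑' r, c r ^ 2 = ∫ z, G z.1 z.2 ^ 2 ∂(ρ.prod ρ) ∧ IsCenteredOrthonormal ρ ψ ∧
      (∀ r, Measurable (ψ r)) ∧
      Tendsto (fun s : Finset (Idx R) => ∫ z, (G z.1 z.2 -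
        ∑ α ∈ s, c α * (ψ α z.1 * ψ α z.2)) ^ 2 ∂(ρ.prod ρ)) atTop (𝓝 0) := by
  set K : Lp ℝ 2 (ρ.prod ρ) := hG.toLp _ with hK
  have hT : integralOp ρ G hG = kerOp K := integralOp_eq_kerOp hG
  have hs : (kerOp K).IsSymmetric := fun φ ψ => by
    have := inner_integralOp_swap hG hG (by simpa using hsym) φ ψ
    rw [hT] at this
    exact this
  have hc := isCompactOperator_kerOp K
  obtain ⟨e, heo, hee, hes⟩ := exists_eigenbasis hc hs (Z := {z : ℝ | z ≠ 0}) (by simp)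
  have hexp := hasSum_kernel hs heo (lam := fun α => (α.1 : ℝ)) hee fun z hz => hes z hz
  -- The squared eigenvalues are summable and none of them is zero.
  have hcount : Countable (EigenIdx (kerOp K) {z : ℝ | z ≠ 0}) := by
    have := hexp.2.1.countable_support
    have hu : (Function.support fun α : EigenIdx (kerOp K) {z : ℝ | z ≠ 0} =>
        ‖(α.1 : ℝ)‖ ^ 2) = Set.univ := by
      refine Set.eq_univ_of_forall fun α => ?_
      have h0 : (α.1 : ℝ) ≠ 0 := α.1.2
      exact pow_ne_zero 2 (norm_ne_zero_iff.2 h0)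
    rw [hu] at this
    exact Set.countable_univ_iff.1 this
  obtain ⟨R, ⟨E⟩⟩ := exists_idx_equiv (EigenIdx (kerOp K) {z : ℝ | z ≠ 0})
  have hmean : ∀ α, ∫ x, e α x ∂ρ = 0 := fun α =>
    integral_eq_zero_of_eigen hG hd.left α.1.2 (by rw [hT]; exact hee α)
  refine ⟨R, fun r => ((E r).1 : ℝ), fun r => e (E r), ⟨fun r => (E r).1.2, fun z hz => ?_⟩,
    ?_, ?_, isCenteredOrthonormal_of_lp (heo.comp _ E.injective) fun r => hmean _,
    fun r => (Lp.stronglyMeasurable _).measurable, ?_⟩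
  · rw [hT, ← encard_eigenIdx hc (Z := {z : ℝ | z ≠ 0}) hz hz]
    exact encard_preimage_equiv E {α | (α.1 : ℝ) = z}
  · have := E.summable_iff.2 hexp.2.1
    simpa [Function.comp_def] using this
  · have h1 := hexp.2.2
    rw [← E.tsum_eq] at h1
    simp only [Real.norm_eq_abs, sq_abs] at h1
    rw [h1, hK, norm_toLp_sq]
    rfl
  · have hF : ∀ r, MemLp (fun z : 𝒴 × 𝒴 => ((E r).1 : ℝ) * (e (E r) z.1 * e (E r) z.2)) 2
        (ρ.prod ρ) := fun r =>
      (memLp_mul_prod (Lp.memLp (e (E r))) (Lp.memLp (e (E r)))).const_mul _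
    refine tendsto_integral_sq_of_hasSum hF hG ?_
    have h1 := E.hasSum_iff.2 hexp.1
    change HasSum _ K
    convert h1 using 2 with r
    rw [Function.comp_apply]
    apply Lp.ext
    symm
    refine (Lp.coeFn_smul _ _).trans (EventuallyEq.trans ?_ (hF r).coeFn_toLp.symm)
    filter_upwards [coeFn_tens (e (E r)) (e (E r))] with z hz
    rw [Pi.smul_apply, hz]
    simp

end Expansion

/-- The sequence is reindexed by ℕ × Fin 2; currying its infinite product law gives independence of
the blocks. -/
theorem IsIID.pair {Ω 𝒳 : Type*} [MeasurableSpace Ω] [MeasurableSpace 𝒳] {X : ℕ → Ω → 𝒳}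
    {ν : Measure 𝒳} [IsProbabilityMeasure ν] {P : Measure Ω} [IsProbabilityMeasure P]
    (h : IsIID X ν P) :
    IsIID (fun k ω => (X (2 * k) ω, X (2 * k + 1) ω)) (ν.prod ν) P where
  meas k := (h.meas _).prodMk (h.meas _)
  law k := (h.measurePreserving_pair (by omega)).map_eq
  indep := by
    have hinj : Function.Injective fun p : ℕ × Fin 2 => 2 * p.1 + (p.2 : ℕ) := by
      rintro ⟨a, b⟩ ⟨c, d⟩ hh
      simp only at hh
      ext <;> simp <;> omega
    have h1 := h.indep.precomp hinj
    have hX := h.meas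
    have h2 := (iIndepFun_iff_map_fun_eq_infinitePi_map fun p => h.meas _).1 h1
    have h3 : iIndepFun (fun k ω (b : Fin 2) => X (2 * k + (b : ℕ)) ω) P := by
      rw [iIndepFun_iff_map_fun_eq_infinitePi_map (fun k => by fun_prop)]
      have h4 : ∀ k, P.map (fun ω (b : Fin 2) => X (2 * k + (b : ℕ)) ω) =
          Measure.infinitePi fun _ => ν := fun k => by
        have hinj' : Function.Injective fun b : Fin 2 => 2 * k + (b : ℕ) := fun a b hab => by
          simp only at hab
          ext; omega
        have := (iIndepFun_iff_map_fun_eq_infinitePi_map fun p => h.meas _).1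
          (h.indep.precomp hinj')
        simp only [h.law] at this
        exact this
      simp only [h4]
      simp only [h.law] at h2
      rw [← Measure.infinitePi_map_curry (fun (_ : ℕ) (_ : Fin 2) => ν), ← h2, Measure.map_map
        (by fun_prop) (by fun_prop)]
      rfl
    exact h3.comp (fun _ v => (v 0, v 1)) fun _ => by fun_prop

/-! ### Degenerate kernels on product spaces -/

section Degenerate

variable {𝒴 𝒴' : Type*} [MeasurableSpace 𝒴] [MeasurableSpace 𝒴'] {ρ : Measure 𝒴}
  [IsProbabilityMeasure ρ] {ρ' : Measure 𝒴'} [IsProbabilityMeasure ρ']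

theorem memLp_kernel_comp {g : 𝒴 → 𝒴 → ℝ} (hg : MemLp (Function.uncurry g) 2 (ρ.prod ρ))
    {a b : 𝒴' → 𝒴} (ha : MeasurePreserving a ρ' ρ) (hb : MeasurePreserving b ρ' ρ) :
    MemLp (Function.uncurry fun z w => g (a z) (b w)) 2 (ρ'.prod ρ') :=
  hg.comp_measurePreserving (ha.prod hb)

theorem ae_integral_kernel_comp {g : 𝒴 → 𝒴 → ℝ} (hg : MemLp (Function.uncurry g) 2 (ρ.prod ρ))
    (hd : ∀ᵐ x ∂ρ, ∫ y, g x y ∂ρ = 0) {a b : 𝒴' → 𝒴} (ha : MeasurePreserving a ρ' ρ)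
    (hb : MeasurePreserving b ρ' ρ) : ∀ᵐ z ∂ρ', ∫ w, g (a z) (b w) ∂ρ' = 0 := by
  have h1 : ∀ᵐ x ∂ρ, AEStronglyMeasurable (g x) ρ := hg.1.prodMk_left
  filter_upwards [ha.quasiMeasurePreserving.ae hd, ha.quasiMeasurePreserving.ae h1] with z hz hz'
  rw [← hz]
  have := integral_map hb.aemeasurable (f := g (a z)) (by rw [hb.map_eq]; exact hz')
  rw [hb.map_eq] at this
  exact this.symm

theorem IsDegenerate.comp {g : 𝒴 → 𝒴 → ℝ} (hd : IsDegenerate ρ g)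
    (hg : MemLp (Function.uncurry g) 2 (ρ.prod ρ)) {a b : 𝒴' → 𝒴}
    (ha : MeasurePreserving a ρ' ρ) (hb : MeasurePreserving b ρ' ρ) :
    IsDegenerate ρ' fun z w => g (a z) (b w) :=
  ⟨ae_integral_kernel_comp (memLp_flip hg) hd.left hb ha,
    ae_integral_kernel_comp hg hd.right ha hb⟩

theorem IsDegenerate.const_mul {g : 𝒴 → 𝒴 → ℝ} (hd : IsDegenerate ρ g) (c : ℝ) :
    IsDegenerate ρ fun x y => c * g x y :=
  ⟨hd.left.mono fun y hy => by rw [integral_const_mul, hy, mul_zero],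
    hd.right.mono fun y hy => by rw [integral_const_mul, hy, mul_zero]⟩

theorem IsDegenerate.add {g g' : 𝒴 → 𝒴 → ℝ} (hg : IsDegenerate ρ g) (hg' : IsDegenerate ρ g')
    (h2 : MemLp (Function.uncurry g) 2 (ρ.prod ρ))
    (h2' : MemLp (Function.uncurry g') 2 (ρ.prod ρ)) :
    IsDegenerate ρ fun x y => g x y + g' x y := by
  have := hg.sub (hg'.const_mul (-1)) h2 (h2'.const_mul (-1))
  simpa using this

end Degenerate

/-! ### Degenerate kernels on pairs and on points with times -/

section PairKernel

variable {𝒳 : Type*} [MeasurableSpace 𝒳] {ν : Measure 𝒳} [IsProbabilityMeasure ν]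
  {g : 𝒳 → 𝒳 → ℝ}

/-- The kernel on pairs that collects the four terms with signs `+, +, -, -`. -/
def pairKernel (g : 𝒳 → 𝒳 → ℝ) (z w : 𝒳 × 𝒳) : ℝ :=
  g z.1 w.1 + g z.1 w.2 - (g z.2 w.1 + g z.2 w.2)

theorem measurable_pairKernel (hg : Measurable (Function.uncurry g)) :
    Measurable (Function.uncurry (pairKernel g)) := by
  have h : ∀ a b : 𝒳 × 𝒳 → 𝒳, Measurable a → Measurable b →
      Measurable fun z : (𝒳 × 𝒳) × (𝒳 × 𝒳) => g (a z.1) (b z.2) := fun a b ha hb =>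
    hg.comp ((ha.comp measurable_fst).prodMk (hb.comp measurable_snd))
  exact ((h _ _ measurable_fst measurable_fst).add (h _ _ measurable_fst measurable_snd)).sub
    ((h _ _ measurable_snd measurable_fst).add (h _ _ measurable_snd measurable_snd))

theorem memLp_pairKernel (hg : MemLp (Function.uncurry g) 2 (ν.prod ν)) :
    MemLp (Function.uncurry (pairKernel g)) 2 ((ν.prod ν).prod (ν.prod ν)) :=
  ((memLp_kernel_comp hg measurePreserving_fst measurePreserving_fst).add
    (memLp_kernel_comp hg measurePreserving_fst measurePreserving_snd)).sub
    ((memLp_kernel_comp hg measurePreserving_snd measurePreserving_fst).add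
    (memLp_kernel_comp hg measurePreserving_snd measurePreserving_snd))

theorem isDegenerate_pairKernel (hg : MemLp (Function.uncurry g) 2 (ν.prod ν))
    (hd : IsDegenerate ν g) : IsDegenerate (ν.prod ν) (pairKernel g) := by
  have hf := measurePreserving_fst (μ := ν) (ν := ν)
  have hs := measurePreserving_snd (μ := ν) (ν := ν)
  have m := fun a b (ha : MeasurePreserving a (ν.prod ν) ν) (hb : MeasurePreserving b (ν.prod ν) ν)
    => memLp_kernel_comp hg ha hb
  have d := fun a b (ha : MeasurePreserving a (ν.prod ν) ν) (hb : MeasurePreserving b (ν.prod ν) ν)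
    => hd.comp hg ha hb
  exact ((d _ _ hf hf).add (d _ _ hf hs) (m _ _ hf hf) (m _ _ hf hs)).sub
    ((d _ _ hs hf).add (d _ _ hs hs) (m _ _ hs hf) (m _ _ hs hs))
    ((m _ _ hf hf).add (m _ _ hf hs)) ((m _ _ hs hf).add (m _ _ hs hs))

/-- Written with indicators, the kernel is visibly linear in g, and the formula is also correct at
ties. -/
theorem hatKernel_eq (g : 𝒳 → 𝒳 → ℝ) (p q : 𝒳 × I) :
    hatKernel g p q = g p.1 q.1 * (if p.2 < q.2 then 1 else 0) +
      g q.1 p.1 * (if q.2 < p.2 then 1 else 0) := by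
  rcases lt_trichotomy p.2 q.2 with h | h | h <;> simp [hatKernel, h, h.not_gt]

theorem checkKernel_eq (g : 𝒳 → 𝒳 → ℝ) (p q : 𝒳 × I) :
    checkKernel g p q = g p.1 q.1 * (if p.2 < q.2 then 1 else 0) -
      g q.1 p.1 * (if q.2 < p.2 then 1 else 0) := by
  rcases lt_trichotomy p.2 q.2 with h | h | h <;> simp [checkKernel, h, h.not_gt]

theorem hatKernel_symm (g : 𝒳 → 𝒳 → ℝ) (p q : 𝒳 × I) : hatKernel g p q = hatKernel g q p := by
  rw [hatKernel_eq, hatKernel_eq]; ring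

theorem checkKernel_antisymm (g : 𝒳 → 𝒳 → ℝ) (p q : 𝒳 × I) :
    checkKernel g p q = -checkKernel g q p := by
  rw [checkKernel_eq, checkKernel_eq]; ring

/-- At frozen times the kernel is g, its transpose or zero, so integrating the space variable alone
already gives zero. This is stronger than degeneracy on the product space and is needed in
`eigenMult_altOp`, where two coordinates share one time. -/
theorem ae_integral_hatKernel (hg : MemLp (Function.uncurry g) 2 (ν.prod ν))
    (hd : IsDegenerate ν g) :
    ∀ᵐ p ∂(ν.prod (volume : Measure I)), ∀ u, ∫ y, hatKernel g p (y, u) ∂ν = 0 := by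
  have hq := (measurePreserving_fst (μ := ν) (ν := (volume : Measure I))).quasiMeasurePreserving
  filter_upwards [hq.ae hd.right, hq.ae hd.left, hq.ae (ae_memLp_section hg),
    hq.ae (ae_memLp_section (memLp_flip hg))] with p h1 h2 h3 h4 u
  have e : (fun y => hatKernel g p (y, u)) = fun y => g p.1 y * (if p.2 < u then 1 else 0) +
      g y p.1 * (if u < p.2 then 1 else 0) := funext fun y => hatKernel_eq g p (y, u)
  rw [e]
  refine (integral_add ((h3.integrable one_le_two).mul_const _)
    ((h4.integrable one_le_two).mul_const _)).trans ?_
  rw [integral_mul_const, integral_mul_const, h1, h2]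
  simp

theorem ae_integral_checkKernel (hg : MemLp (Function.uncurry g) 2 (ν.prod ν))
    (hd : IsDegenerate ν g) :
    ∀ᵐ p ∂(ν.prod (volume : Measure I)), ∀ u, ∫ y, checkKernel g p (y, u) ∂ν = 0 := by
  have hq := (measurePreserving_fst (μ := ν) (ν := (volume : Measure I))).quasiMeasurePreserving
  filter_upwards [hq.ae hd.right, hq.ae hd.left, hq.ae (ae_memLp_section hg),
    hq.ae (ae_memLp_section (memLp_flip hg))] with p h1 h2 h3 h4 u
  have e : (fun y => checkKernel g p (y, u)) = fun y => g p.1 y * (if p.2 < u then 1 else 0) -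
      g y p.1 * (if u < p.2 then 1 else 0) := funext fun y => checkKernel_eq g p (y, u)
  rw [e]
  refine (integral_sub ((h3.integrable one_le_two).mul_const _)
    ((h4.integrable one_le_two).mul_const _)).trans ?_
  rw [integral_mul_const, integral_mul_const, h1, h2]
  simp

theorem isDegenerate_hatKernel (hg : MemLp (Function.uncurry g) 2 (ν.prod ν))
    (hd : IsDegenerate ν g) : IsDegenerate (ν.prod (volume : Measure I)) (hatKernel g) := by
  have h : ∀ᵐ p ∂(ν.prod (volume : Measure I)),
      ∫ q, hatKernel g p q ∂(ν.prod (volume : Measure I)) = 0 := by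
    filter_upwards [ae_integral_hatKernel hg hd, ae_memLp_section (memLp_hatKernel hg)] with p h1 h2
    rw [integral_prod_symm _ (h2.integrable one_le_two)]
    simp [h1]
  refine ⟨?_, h⟩
  filter_upwards [h] with p hp
  simpa only [hatKernel_symm g p] using hp

end PairKernel

/-! ### The block operator and the kernel on pairs with times -/

/-- With S = AB and T = BA, the map B carries eigenvectors of S to eigenvectors of T, and it is
injective there because z x = A(B x) with z ≠ 0. The lifts only reconcile universes. -/
theorem eigenMult_le_of_comp {𝕜 : Type*} [RCLike 𝕜] {H H' : Type*} [NormedAddCommGroup H]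
    [InnerProductSpace 𝕜 H] [NormedAddCommGroup H'] [InnerProductSpace 𝕜 H']
    {A : H →ₗ[𝕜] H'} {B : H' →ₗ[𝕜] H} {S : H' →L[𝕜] H'} {T : H →L[𝕜] H}
    (hS : ∀ x, S x = A (B x)) (hT : ∀ x, T x = B (A x)) {z : 𝕜} (hz : z ≠ 0) :
    Cardinal.lift.{u_2} (Module.rank 𝕜 (Module.End.eigenspace (S : H' →ₗ[𝕜] H') z)) ≤
      Cardinal.lift.{u_3} (Module.rank 𝕜 (Module.End.eigenspace (T : H →ₗ[𝕜] H) z)) := by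
  have hmem : ∀ x ∈ Module.End.eigenspace (S : H' →ₗ[𝕜] H') z,
      B x ∈ Module.End.eigenspace (T : H →ₗ[𝕜] H) z := fun x hx => by
    rw [Module.End.mem_eigenspace_iff] at hx ⊢
    change T (B x) = z • B x
    rw [hT, ← hS]
    change B ((S : H' →ₗ[𝕜] H') x) = _
    rw [hx, map_smul]
  refine LinearMap.lift_rank_le_of_injective (B.restrict hmem) ?_
  rw [← LinearMap.ker_eq_bot, LinearMap.ker_eq_bot']
  rintro ⟨x, hx⟩ h0
  have h1 : B x = 0 := congrArg Subtype.val h0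
  have h2 : z • x = 0 := by
    rw [Module.End.mem_eigenspace_iff] at hx
    rw [← hx]
    change S x = 0
    rw [hS, h1, map_zero]
  exact Subtype.ext ((smul_eq_zero.1 h2).resolve_left hz)

theorem eigenMult_eq_of_comp {𝕜 : Type*} [RCLike 𝕜] {H H' : Type*} [NormedAddCommGroup H]
    [InnerProductSpace 𝕜 H] [NormedAddCommGroup H'] [InnerProductSpace 𝕜 H']
    {A : H →ₗ[𝕜] H'} {B : H' →ₗ[𝕜] H} {S : H' →L[𝕜] H'} {T : H →L[𝕜] H}
    (hS : ∀ x, S x = A (B x)) (hT : ∀ x, T x = B (A x)) {z : 𝕜} (hz : z ≠ 0) :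
    eigenMult S z = eigenMult T z := by
  have h := (eigenMult_le_of_comp hS hT hz).antisymm (eigenMult_le_of_comp hT hS hz)
  have h' := congrArg Cardinal.toENat h
  rwa [Cardinal.toENat_lift, Cardinal.toENat_lift] at h'

theorem inner_lp_eq_integral {𝒴 : Type*} [MeasurableSpace 𝒴] {ρ : Measure 𝒴}
    (φ ψ : Lp ℝ 2 ρ) : inner ℝ φ ψ = ∫ x, φ x * ψ x ∂ρ := by
  rw [L2.inner_def]
  refine integral_congr_ae (ae_of_all _ fun x => ?_)
  simp [mul_comm]

/-! ### Pullback along measure preserving maps -/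

section CompOp

variable {𝒴 𝒴' : Type*} [MeasurableSpace 𝒴] [MeasurableSpace 𝒴'] {ρ : Measure 𝒴}
  [IsProbabilityMeasure ρ] {ρ' : Measure 𝒴'} [IsProbabilityMeasure ρ']

/-- Composition with a measure preserving map, as an operator on `L²`. -/
def compOp {a : 𝒴' → 𝒴} (ha : MeasurePreserving a ρ' ρ) : Lp ℝ 2 ρ →L[ℝ] Lp ℝ 2 ρ' :=
  (Lp.compMeasurePreservingₗᵢ ℝ a ha).toContinuousLinearMap

theorem coeFn_compOp {a : 𝒴' → 𝒴} (ha : MeasurePreserving a ρ' ρ) (φ : Lp ℝ 2 ρ) :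
    compOp ha φ =ᵐ[ρ'] fun z => φ (a z) :=
  Lp.coeFn_compMeasurePreserving φ ha

theorem adjoint_compOp_compOp {a : 𝒴' → 𝒴} (ha : MeasurePreserving a ρ' ρ) (φ : Lp ℝ 2 ρ) :
    (compOp ha).adjoint (compOp ha φ) = φ := by
  refine ext_inner_left ℝ fun v => ?_
  rw [ContinuousLinearMap.adjoint_inner_right]
  exact (Lp.compMeasurePreservingₗᵢ ℝ a ha).inner_map_map v φ

/-- At a fixed z the integral is an inner product of ψ with a section of g pulled back along b; the
adjoint of the pullback moves this to the base space. -/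
theorem integralOp_kernel_comp {g : 𝒴 → 𝒴 → ℝ} (hg : MemLp (Function.uncurry g) 2 (ρ.prod ρ))
    {a b : 𝒴' → 𝒴} (ha : MeasurePreserving a ρ' ρ) (hb : MeasurePreserving b ρ' ρ)
    (h : MemLp (Function.uncurry fun z w => g (a z) (b w)) 2 (ρ'.prod ρ')) (ψ : Lp ℝ 2 ρ') :
    integralOp ρ' (fun z w => g (a z) (b w)) h ψ =
      compOp ha (integralOp ρ g hg ((compOp hb).adjoint ψ)) := by
  apply Lp.ext
  refine (integralOp_ae_eq _ _ _ _).trans (EventuallyEq.trans ?_ (coeFn_compOp ha _).symm)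
  filter_upwards [ha.quasiMeasurePreserving.ae (integralOp_ae_eq ρ g hg ((compOp hb).adjoint ψ)),
    ha.quasiMeasurePreserving.ae (ae_memLp_section hg)] with z h1 h2
  rw [h1]
  have h3 : ∫ y, g (a z) y * ((compOp hb).adjoint ψ) y ∂ρ =
      inner ℝ (h2.toLp _) ((compOp hb).adjoint ψ) := by
    rw [inner_lp_eq_integral]
    refine integral_congr_ae ?_
    filter_upwards [h2.coeFn_toLp] with y hy
    rw [hy]
  rw [h3, ContinuousLinearMap.adjoint_inner_right, inner_lp_eq_integral]
  refine integral_congr_ae ?_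
  filter_upwards [coeFn_compOp hb (h2.toLp _), hb.quasiMeasurePreserving.ae h2.coeFn_toLp]
    with w h4 h5
  rw [h4, h5]

end CompOp

/-! ### The block operator and its nonzero eigenvalues -/

section AltOp

variable {𝒳 : Type*} [MeasurableSpace 𝒳] {ν : Measure 𝒳} [IsProbabilityMeasure ν]
  {g : 𝒳 → 𝒳 → ℝ}

theorem measurePreserving_lift {a : 𝒳 × 𝒳 → 𝒳} (ha : MeasurePreserving a (ν.prod ν) ν) :
    MeasurePreserving (Prod.map a id) ((ν.prod ν).prod (volume : Measure I))
      (ν.prod (volume : Measure I)) :=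
  ha.prod (MeasurePreserving.id _)

/-- By Fubini, at a fixed q and a fixed common time the two coordinates of the pair are independent,
and the factor with the kernel has integral zero. The maps a and b stand for the two projections in
either order; the product formula `hab` can be asked of all functions because for Bochner integrals
it needs no integrability. -/
theorem inner_compOp_compOp_eq_zero {k : 𝒳 × I → 𝒳 × I → ℝ}
    (hk : MemLp (Function.uncurry k) 2
      ((ν.prod (volume : Measure I)).prod (ν.prod (volume : Measure I))))
    (h0 : ∀ᵐ q ∂(ν.prod (volume : Measure I)), ∀ t, ∫ x, k (x, t) q ∂ν = 0)
    {a b : 𝒳 × 𝒳 → 𝒳} (ha : MeasurePreserving a (ν.prod ν) ν)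
    (hb : MeasurePreserving b (ν.prod ν) ν)
    (hab : ∀ f h : 𝒳 → ℝ, ∫ z, f (a z) * h (b z) ∂(ν.prod ν) = (∫ x, f x ∂ν) * ∫ x, h x ∂ν)
    (φ χ : Lp ℝ 2 (ν.prod (volume : Measure I))) :
    inner ℝ (compOp (measurePreserving_lift ha) (integralOp _ k hk φ))
      (compOp (measurePreserving_lift hb) χ) = 0 := by
  have hA := measurePreserving_lift ha
  have hB := measurePreserving_lift hb
  rw [inner_lp_eq_integral]
  have h1 : ∀ᵐ p ∂((ν.prod ν).prod (volume : Measure I)), (compOp hA (integralOp _ k hk φ)) p * (compOp hB χ) p =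
      ∫ q, k (Prod.map a id p) q * φ q * χ (Prod.map b id p) ∂(ν.prod (volume : Measure I)) := by
    filter_upwards [coeFn_compOp hA (integralOp _ k hk φ), coeFn_compOp hB χ,
      hA.quasiMeasurePreserving.ae (integralOp_ae_eq _ k hk φ)] with p h1 h2 h3
    rw [h1, h2, h3, integral_mul_const]
  rw [integral_congr_ae h1]
  have hint : Integrable (fun z : ((𝒳 × 𝒳) × I) × (𝒳 × I) =>
      k (Prod.map a id z.1) z.2 * φ z.2 * χ (Prod.map b id z.1)) (((ν.prod ν).prod (volume : Measure I)).prod (ν.prod (volume : Measure I))) := by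
    have h2 : MemLp (fun z : ((𝒳 × 𝒳) × I) × (𝒳 × I) => k (Prod.map a id z.1) z.2) 2
        (((ν.prod ν).prod (volume : Measure I)).prod (ν.prod (volume : Measure I))) := hk.comp_measurePreserving (hA.prod (MeasurePreserving.id _))
    have h3 : MemLp (fun z : (𝒳 × I) × (𝒳 × I) => χ z.1 * φ z.2) 2 ((ν.prod (volume : Measure I)).prod (ν.prod (volume : Measure I))) :=
      memLp_mul_prod (Lp.memLp χ) (Lp.memLp φ)
    have h4 : MemLp (fun z : ((𝒳 × 𝒳) × I) × (𝒳 × I) => χ (Prod.map b id z.1) * φ z.2) 2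
        (((ν.prod ν).prod (volume : Measure I)).prod (ν.prod (volume : Measure I))) := h3.comp_measurePreserving (hB.prod (MeasurePreserving.id _))
    refine (h2.integrable_mul h4).congr (ae_of_all _ fun z => ?_)
    simp only [Pi.mul_apply]
    ring
  rw [integral_integral_swap (f := fun p q =>
    k (Prod.map a id p) q * φ q * χ (Prod.map b id p)) hint]
  refine integral_eq_zero_of_ae ?_
  filter_upwards [h0, hint.prod_left_ae] with q hq hq'
  rw [integral_prod_symm _ hq']
  refine integral_eq_zero_of_ae (ae_of_all _ fun t => ?_)
  have h5 := hab (fun x => k (x, t) q * φ q) (fun x => χ (x, t))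
  rw [integral_mul_const, hq t, zero_mul, zero_mul] at h5
  exact h5

/-- Pulling back along one coordinate and averaging over it along the other leaves a function of the
time only, and the kernel annihilates those. The proof dualizes and uses the preceding orthogonality
for the transposed kernel. -/
theorem integralOp_adjoint_compOp_compOp {k : 𝒳 × I → 𝒳 × I → ℝ}
    (hk : MemLp (Function.uncurry k) 2
      ((ν.prod (volume : Measure I)).prod (ν.prod (volume : Measure I))))
    (h0 : ∀ᵐ q ∂(ν.prod (volume : Measure I)), ∀ t, ∫ x, k q (x, t) ∂ν = 0)
    {a b : 𝒳 × 𝒳 → 𝒳} (ha : MeasurePreserving a (ν.prod ν) ν)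
    (hb : MeasurePreserving b (ν.prod ν) ν)
    (hab : ∀ f h : 𝒳 → ℝ, ∫ z, f (a z) * h (b z) ∂(ν.prod ν) = (∫ x, f x ∂ν) * ∫ x, h x ∂ν)
    (χ : Lp ℝ 2 (ν.prod (volume : Measure I))) :
    integralOp _ k hk ((compOp (measurePreserving_lift ha)).adjoint
      (compOp (measurePreserving_lift hb) χ)) = 0 := by
  refine ext_inner_left ℝ fun φ => ?_
  rw [inner_zero_right, ← inner_integralOp_swap hk (memLp_flip hk) (ae_of_all _ fun z => by simp),
    ContinuousLinearMap.adjoint_inner_right]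
  exact inner_compOp_compOp_eq_zero _ h0 ha hb hab φ χ

theorem altOp_apply (hg : MemLp (Function.uncurry g) 2 (ν.prod ν))
    (p : WithLp 2 (Lp ℝ 2 (ν.prod (volume : Measure I)) × Lp ℝ 2 (ν.prod (volume : Measure I)))) :
    altOp ν g hg p = WithLp.toLp 2
      ((1 / 2 : ℝ) • (-integralOp _ (hatKernel g) (memLp_hatKernel hg) p.fst +
        integralOp _ (checkKernel g) (memLp_checkKernel hg) p.snd),
      (1 / 2 : ℝ) • (-integralOp _ (checkKernel g) (memLp_checkKernel hg) p.fst +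
        integralOp _ (hatKernel g) (memLp_hatKernel hg) p.snd)) :=
  rfl

/-- The diagonal blocks have symmetric kernels. The off-diagonal kernel is antisymmetric, so the two
off-diagonal blocks, of opposite sign, are adjoint to each other. -/
theorem isSelfAdjoint_altOp (hg : MemLp (Function.uncurry g) 2 (ν.prod ν)) :
    IsSelfAdjoint (altOp ν g hg) := by
  rw [ContinuousLinearMap.isSelfAdjoint_iff_isSymmetric]
  intro p q
  have hH := inner_integralOp_swap (memLp_hatKernel hg) (memLp_hatKernel hg)
    (ae_of_all _ fun z => by simpa using hatKernel_symm g z.1 z.2)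
  have hK : ∀ φ ψ, inner ℝ (integralOp _ (checkKernel g) (memLp_checkKernel hg) φ) ψ =
      -inner ℝ φ (integralOp _ (checkKernel g) (memLp_checkKernel hg) ψ) := fun φ ψ => by
    have h1 := inner_integralOp_swap (memLp_checkKernel hg) (memLp_flip (memLp_checkKernel hg))
      (ae_of_all _ fun z => by simp) φ ψ
    rw [← h1, ← inner_neg_left]
    congr 1
    apply Lp.ext
    refine (integralOp_ae_eq _ _ _ _).trans (EventuallyEq.trans ?_ (Lp.coeFn_neg _).symm)
    filter_upwards [integralOp_ae_eq _ _ (memLp_flip (memLp_checkKernel hg)) φ] with x hx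
    rw [Pi.neg_apply, hx, ← integral_neg]
    refine integral_congr_ae (ae_of_all _ fun y => ?_)
    simp only
    rw [checkKernel_antisymm g x y]
    ring
  change inner ℝ (altOp ν g hg p) q = inner ℝ p (altOp ν g hg q)
  rw [altOp_apply, altOp_apply, WithLp.prod_inner_apply, WithLp.prod_inner_apply]
  simp only [inner_smul_left, inner_smul_right, inner_add_left, inner_add_right, inner_neg_left,
    inner_neg_right, hH, hK, WithLp.ofLp_fst, WithLp.ofLp_snd]
  simp
  ring

/-- The four terms of `pairKernel` are sorted by the coordinates they involve. Equal coordinates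
carry the same sign in both time orders and give ±`hatKernel`; for different coordinates the sign
changes with the time order, which gives ±`checkKernel`. -/
theorem integralOp_hat_pairKernel (hg : MemLp (Function.uncurry g) 2 (ν.prod ν))
    (hG : MemLp (Function.uncurry fun p q => 1 / 2 * hatKernel (pairKernel g) p q) 2
      (((ν.prod ν).prod (volume : Measure I)).prod ((ν.prod ν).prod (volume : Measure I))))
    (ψ : Lp ℝ 2 ((ν.prod ν).prod (volume : Measure I))) :
    let C₁ := compOp (measurePreserving_lift (ν := ν) measurePreserving_fst)
    let C₂ := compOp (measurePreserving_lift (ν := ν) measurePreserving_snd)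
    let H := integralOp _ (hatKernel g) (memLp_hatKernel hg)
    let K := integralOp _ (checkKernel g) (memLp_checkKernel hg)
    integralOp _ (fun p q => 1 / 2 * hatKernel (pairKernel g) p q) hG ψ =
      (1 / 2 : ℝ) • (C₁ (H (C₁.adjoint ψ)) + C₁ (K (C₂.adjoint ψ)) -
        (C₂ (K (C₁.adjoint ψ)) + C₂ (H (C₂.adjoint ψ)))) := by
  intro C₁ C₂ H K
  have hf := measurePreserving_lift (ν := ν) measurePreserving_fst
  have hs := measurePreserving_lift (ν := ν) measurePreserving_snd
  have m11 := memLp_kernel_comp (memLp_hatKernel hg) hf hf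
  have m12 := memLp_kernel_comp (memLp_checkKernel hg) hf hs
  have m21 := memLp_kernel_comp (memLp_checkKernel hg) hs hf
  have m22 := memLp_kernel_comp (memLp_hatKernel hg) hs hs
  have e11 := integralOp_kernel_comp (memLp_hatKernel hg) hf hf m11 ψ
  have e12 := integralOp_kernel_comp (memLp_checkKernel hg) hf hs m12 ψ
  have e21 := integralOp_kernel_comp (memLp_checkKernel hg) hs hf m21 ψ
  have e22 := integralOp_kernel_comp (memLp_hatKernel hg) hs hs m22 ψ
  change _ = (1 / 2 : ℝ) • (compOp hf _ + compOp hf _ - (compOp hs _ + compOp hs _))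
  rw [← e11, ← e12, ← e21, ← e22]
  have e : hG.toLp _ = (1 / 2 : ℝ) • (m11.toLp _ + m12.toLp _ - (m21.toLp _ + m22.toLp _)) := by
    rw [← MemLp.toLp_add, ← MemLp.toLp_add, ← MemLp.toLp_sub, ← MemLp.toLp_const_smul]
    refine MemLp.toLp_congr _ _ (ae_of_all _ fun z => ?_)
    simp only [Function.uncurry_def, Pi.add_apply, Pi.sub_apply, Pi.smul_apply, smul_eq_mul,
      hatKernel_eq, checkKernel_eq, pairKernel, Prod.map_fst, Prod.map_snd, id]
    ring
  simp only [integralOp_eq_kerOp]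
  rw [e, ← kerOpL_apply, map_smul, map_sub, map_add, map_add]
  rfl

/-- Let C₁, C₂ be the pullbacks along the two coordinates, A(φ₁, φ₂) = C₂ φ₁ - C₁ φ₂ and D ψ = (C₂*
ψ, -C₁* ψ). The operator on pairs is A ∘ altOp ∘ D, while altOp ∘ D ∘ A = altOp, since C_i* C_i is
the identity and the mixed products are killed by both kernels. The exchange of coordinates and the
sign match the arrangement of the blocks. -/
theorem eigenMult_altOp (hg : MemLp (Function.uncurry g) 2 (ν.prod ν)) (hd : IsDegenerate ν g)
    (hG : MemLp (Function.uncurry fun p q => 1 / 2 * hatKernel (pairKernel g) p q) 2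
      (((ν.prod ν).prod (volume : Measure I)).prod ((ν.prod ν).prod (volume : Measure I))))
    {z : ℝ} (hz : z ≠ 0) :
    eigenMult (integralOp _ (fun p q => 1 / 2 * hatKernel (pairKernel g) p q) hG) z =
      eigenMult (altOp ν g hg) z := by
  set C₁ := compOp (measurePreserving_lift (ν := ν) measurePreserving_fst) with hC₁
  set C₂ := compOp (measurePreserving_lift (ν := ν) measurePreserving_snd) with hC₂
  set H := integralOp _ (hatKernel g) (memLp_hatKernel hg) with hH
  set K := integralOp _ (checkKernel g) (memLp_checkKernel hg) with hK
  let A := C₂.toLinearMap ∘ₗ WithLp.fstₗ 2 ℝ _ _ -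
    C₁.toLinearMap ∘ₗ WithLp.sndₗ 2 ℝ _ _
  let D := (WithLp.linearEquiv 2 ℝ _).symm.toLinearMap ∘ₗ
    (C₂.adjoint.toLinearMap.prod (-C₁.adjoint.toLinearMap))
  have hA : ∀ p, A p = C₂ p.fst - C₁ p.snd := fun p => rfl
  have hD : ∀ ψ, D ψ = WithLp.toLp 2 (C₂.adjoint ψ, -C₁.adjoint ψ) := fun ψ => rfl
  have h12 : ∀ f h : 𝒳 → ℝ, ∫ z, f (Prod.fst z) * h (Prod.snd z) ∂(ν.prod ν) =
      (∫ x, f x ∂ν) * ∫ x, h x ∂ν := fun f h => integral_prod_mul f h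
  have h21 : ∀ f h : 𝒳 → ℝ, ∫ z, f (Prod.snd z) * h (Prod.fst z) ∂(ν.prod ν) =
      (∫ x, f x ∂ν) * ∫ x, h x ∂ν := fun f h => by
    rw [mul_comm, ← integral_prod_mul]
    simp only [mul_comm]
  have ch := ae_integral_hatKernel hg hd
  have cc := ae_integral_checkKernel hg hd
  have H12 : ∀ χ, H (C₁.adjoint (C₂ χ)) = 0 :=
    integralOp_adjoint_compOp_compOp _ ch measurePreserving_fst measurePreserving_snd h12
  have H21 : ∀ χ, H (C₂.adjoint (C₁ χ)) = 0 :=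
    integralOp_adjoint_compOp_compOp _ ch measurePreserving_snd measurePreserving_fst h21
  have K12 : ∀ χ, K (C₁.adjoint (C₂ χ)) = 0 :=
    integralOp_adjoint_compOp_compOp _ cc measurePreserving_fst measurePreserving_snd h12
  have K21 : ∀ χ, K (C₂.adjoint (C₁ χ)) = 0 :=
    integralOp_adjoint_compOp_compOp _ cc measurePreserving_snd measurePreserving_fst h21
  have I1 : ∀ χ, C₁.adjoint (C₁ χ) = χ := adjoint_compOp_compOp _
  have I2 : ∀ χ, C₂.adjoint (C₂ χ) = χ := adjoint_compOp_compOp _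
  refine eigenMult_eq_of_comp (A := A) (B := (altOp ν g hg).toLinearMap ∘ₗ D) (fun ψ => ?_)
    (fun p => ?_) hz
  · rw [integralOp_hat_pairKernel hg hG ψ, hA]
    change _ = C₂ (altOp ν g hg (D ψ)).fst - C₁ (altOp ν g hg (D ψ)).snd
    rw [hD, altOp_apply]
    simp only [WithLp.toLp_fst, WithLp.toLp_snd, ← hC₁, ← hC₂, ← hH, ← hK, map_smul, map_add,
      map_neg]
    module
  · change _ = altOp ν g hg (D (A p))
    rw [hD, hA, altOp_apply, altOp_apply]
    simp only [WithLp.toLp_fst, WithLp.toLp_snd, ← hH, ← hK, map_sub, map_neg, I1, I2, H12, H21,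
      K12, K21, sub_zero, zero_sub, neg_neg]

end AltOp

/-! ### From the alternating statistic to a `U`-statistic of pairs -/

theorem sum_pairs_two {M : Type*} [AddCommMonoid M] (F : ℕ → ℕ → M) :
    ∑ p ∈ pairs 2, F p.2 p.1 = F 0 1 := by
  rw [sum_pairs]
  simp [Finset.sum_range_succ]

section PairStat

variable {Ω 𝒳 : Type*} [MeasurableSpace Ω] [MeasurableSpace 𝒳] {P : Measure Ω}
  [IsProbabilityMeasure P] {ν : Measure 𝒳} [IsProbabilityMeasure ν] {X : ℕ → Ω → 𝒳}
  {g : 𝒳 → 𝒳 → ℝ}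

/-- The kernel is a signed sum over the four index pairs of {0, 1} × {2, 3} in an i.i.d. sequence,
and these four terms are orthogonal. -/
theorem integral_pairKernel_sq (hg : MemLp (Function.uncurry g) 2 (ν.prod ν))
    (hd : IsDegenerate ν g) :
    ∫ z, pairKernel g z.1 z.2 ^ 2 ∂((ν.prod ν).prod (ν.prod ν)) =
      4 * ∫ z, g z.1 z.2 ^ 2 ∂(ν.prod ν) := by
  have hX := isIID_infinitePi ν
  have h1 := hX.pair.integral_pair (i := 0) (j := 1)
    (φ := fun z => pairKernel g z.1 z.2 ^ 2) ((memLp_pairKernel hg).1.pow 2) zero_ne_one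
  rw [← h1]
  let S : Finset (Σ _ : ℕ, ℕ) := {⟨2, 0⟩, ⟨3, 0⟩, ⟨2, 1⟩, ⟨3, 1⟩}
  have hS : ∀ p ∈ S, p.2 < p.1 := by decide
  have h2 := hX.integral_sum_pairs_sq hg hd hS fun p => (-1) ^ p.2
  have h3 : ∑ p ∈ S, (((-1 : ℝ)) ^ p.2) ^ 2 = 4 := by
    simp [S, ← pow_mul, mul_comm _ 2]
  rw [h3] at h2
  rw [← h2]
  refine integral_congr_ae (ae_of_all _ fun ω => ?_)
  simp [S, pairKernel]
  ring

/-- For a sample of size two, `charFun_hatKernel_eq` says that attaching times preserves the law of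
the kernel, hence its second moment. The factor ¼ cancels the 4 of `integral_pairKernel_sq`, so
passing from g to this kernel is an isometry on degenerate kernels. -/
theorem integral_hat_pairKernel_sq (hm : Measurable (Function.uncurry g))
    (hg : MemLp (Function.uncurry g) 2 (ν.prod ν)) (hd : IsDegenerate ν g) :
    ∫ z, (1 / 2 * hatKernel (pairKernel g) z.1 z.2) ^ 2
      ∂(((ν.prod ν).prod (volume : Measure I)).prod ((ν.prod ν).prod (volume : Measure I))) =
      ∫ z, g z.1 z.2 ^ 2 ∂(ν.prod ν) := by
  have hZ := isIID_infinitePi (ν.prod ν)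
  have hY := isIID_infinitePi ((ν.prod ν).prod (volume : Measure I))
  have hFm := measurable_pairKernel hm
  have hHm := measurable_hatKernel hFm
  have mZ : Measurable fun ω : ℕ → 𝒳 × 𝒳 => pairKernel g (ω 0) (ω 1) :=
    hFm.comp ((hZ.meas 0).prodMk (hZ.meas 1))
  have mY : Measurable fun ω : ℕ → (𝒳 × 𝒳) × I => hatKernel (pairKernel g) (ω 0) (ω 1) :=
    hHm.comp ((hY.meas 0).prodMk (hY.meas 1))
  have hl : (Measure.infinitePi fun _ => ν.prod ν).map
        (fun ω : ℕ → 𝒳 × 𝒳 => pairKernel g (ω 0) (ω 1)) =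
      (Measure.infinitePi fun _ => (ν.prod ν).prod (volume : Measure I)).map
        (fun ω : ℕ → (𝒳 × 𝒳) × I => hatKernel (pairKernel g) (ω 0) (ω 1)) := by
    have := Measure.isProbabilityMeasure_map (μ := Measure.infinitePi fun _ : ℕ => ν.prod ν)
      mZ.aemeasurable
    have := Measure.isProbabilityMeasure_map
      (μ := Measure.infinitePi fun _ : ℕ => (ν.prod ν).prod (volume : Measure I)) mY.aemeasurable
    refine Measure.ext_of_charFun (funext fun t => ?_)
    have h := charFun_hatKernel_eq hZ hY hFm 2 1 t
    have e1 : (fun ω : ℕ → 𝒳 × 𝒳 => ∑ p ∈ pairs 2, 1 * pairKernel g (ω p.2) (ω p.1)) =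
        fun ω => pairKernel g (ω 0) (ω 1) := funext fun ω => by
      rw [sum_pairs_two fun i j => 1 * pairKernel g (ω i) (ω j), one_mul]
    have e2 : (fun ω : ℕ → (𝒳 × 𝒳) × I =>
        ∑ p ∈ pairs 2, 1 * hatKernel (pairKernel g) (ω p.2) (ω p.1)) =
        fun ω => hatKernel (pairKernel g) (ω 0) (ω 1) := funext fun ω => by
      rw [sum_pairs_two fun i j => 1 * hatKernel (pairKernel g) (ω i) (ω j), one_mul]
    rw [e1, e2] at h
    exact h
  have hsq : ∀ {Q : Measure ℝ}, AEStronglyMeasurable (fun x : ℝ => x ^ 2) Q :=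
    (by fun_prop : Continuous fun x : ℝ => x ^ 2).aestronglyMeasurable
  have h1 := congrArg (fun Q : Measure ℝ => ∫ x, x ^ 2 ∂Q) hl
  rw [integral_map mZ.aemeasurable hsq, integral_map mY.aemeasurable hsq] at h1
  have h2 := hZ.integral_pair (i := 0) (j := 1) (φ := fun z => pairKernel g z.1 z.2 ^ 2)
    ((memLp_pairKernel hg).1.pow 2) zero_ne_one
  have h3 := hY.integral_pair (i := 0) (j := 1)
    (φ := fun z => hatKernel (pairKernel g) z.1 z.2 ^ 2)
    ((memLp_hatKernel (memLp_pairKernel hg)).1.pow 2) zero_ne_one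
  simp only [mul_pow, integral_const_mul]
  rw [← h3, ← h1, h2, integral_pairKernel_sq hg hd]
  ring

/-- The pairs of indices in different blocks `{2k, 2k+1}`, `k < m`. -/
def blockPairs (m : ℕ) : Finset (Σ _ : ℕ, ℕ) :=
  (pairs (2 * m)).filter fun p => p.2 / 2 < p.1 / 2

theorem sum_blockPairs {M : Type*} [AddCommMonoid M] (m : ℕ) (φ : ℕ → ℕ → M) :
    ∑ p ∈ blockPairs m, φ p.2 p.1 = ∑ p ∈ pairs m, ∑ q : Fin 2 × Fin 2,
      φ (2 * p.2 + q.1) (2 * p.1 + q.2) := by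
  rw [← Finset.sum_product' (pairs m) Finset.univ fun p (q : Fin 2 × Fin 2) =>
    φ (2 * p.2 + q.1) (2 * p.1 + q.2)]
  symm
  refine Finset.sum_nbij' (fun x => ⟨2 * x.1.1 + x.2.2, 2 * x.1.2 + x.2.1⟩)
    (fun p => (⟨p.1 / 2, p.2 / 2⟩, ⟨p.2 % 2, Nat.mod_lt _ two_pos⟩, ⟨p.1 % 2, Nat.mod_lt _ two_pos⟩))
    ?_ ?_ ?_ ?_ ?_
  · rintro ⟨⟨j, i⟩, a, b⟩ h
    simp only [Finset.mem_product, mem_pairs, Finset.mem_univ, and_true] at h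
    simp only [blockPairs, Finset.mem_filter, mem_pairs]
    omega
  · rintro ⟨j, i⟩ h
    simp only [blockPairs, Finset.mem_filter, mem_pairs] at h
    simp only [Finset.mem_product, mem_pairs, Finset.mem_univ, and_true]
    omega
  · rintro ⟨⟨j, i⟩, a, b⟩ h
    simp only [Prod.mk.injEq, Sigma.mk.injEq, heq_eq_eq, Fin.ext_iff]
    omega
  · rintro ⟨j, i⟩ h
    simp only [Sigma.mk.injEq, heq_eq_eq]
    omega
  · rintro ⟨⟨j, i⟩, a, b⟩ h
    rfl

theorem card_blockPairs (m : ℕ) : ((blockPairs m).card : ℝ) = 2 * m * (m - 1) := by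
  have h := sum_blockPairs m fun _ _ => (1 : ℝ)
  simp only [Finset.sum_const, nsmul_eq_mul, mul_one] at h
  rw [h, card_pairs]
  simp
  ring

/-- The sign depends only on the position of the earlier index within its block, so it can be built
into the kernel; from here on no sign alternates. -/
theorem sum_pairKernel (x : ℕ → 𝒳) (m : ℕ) :
    ∑ p ∈ pairs m, pairKernel g (x (2 * p.2), x (2 * p.2 + 1)) (x (2 * p.1), x (2 * p.1 + 1)) =
      ∑ p ∈ blockPairs m, (-1 : ℝ) ^ p.2 * g (x p.2) (x p.1) := by
  rw [sum_blockPairs m fun i j => (-1 : ℝ) ^ i * g (x i) (x j)]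
  refine Finset.sum_congr rfl fun p _ => ?_
  rw [Fintype.sum_prod_type]
  simp [Fin.sum_univ_two, pow_add, pow_mul, pairKernel]
  ring

/-- This is the squared distance between the weights of the normalized alternating sum and those of
the block sum with m = n/2. For n = 2m the weights agree on the blocks and only the m pairs inside a
block are lost. For n = 2m+1 another 2m pairs contain the last variable, and the weights 1/n and
1/(2m) differ by O(n⁻²). -/
theorem tendsto_sum_sq_blockPairs :
    Tendsto (fun n : ℕ => ∑ p ∈ pairs n, ((n : ℝ)⁻¹ * (-1 : ℝ) ^ p.2 -
      if p ∈ blockPairs (n / 2) then ((n / 2 : ℕ) : ℝ)⁻¹ * (1 / 2) * (-1 : ℝ) ^ p.2 else 0) ^ 2)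
      atTop (𝓝 0) := by
  have hsub : ∀ n, blockPairs (n / 2) ⊆ pairs n := fun n p hp => by
    simp only [blockPairs, Finset.mem_filter, mem_pairs] at hp
    rw [mem_pairs]
    omega
  have h1 : ∀ n : ℕ, ∑ p ∈ pairs n, ((n : ℝ)⁻¹ * (-1 : ℝ) ^ p.2 -
      if p ∈ blockPairs (n / 2) then ((n / 2 : ℕ) : ℝ)⁻¹ * (1 / 2) * (-1 : ℝ) ^ p.2 else 0) ^ 2 =
      (n * (n - 1) / 2 - 2 * ((n / 2 : ℕ) : ℝ) * (((n / 2 : ℕ) : ℝ) - 1)) * ((n : ℝ)⁻¹) ^ 2 +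
      2 * ((n / 2 : ℕ) : ℝ) * (((n / 2 : ℕ) : ℝ) - 1) *
        ((n : ℝ)⁻¹ - ((n / 2 : ℕ) : ℝ)⁻¹ * (1 / 2)) ^ 2 := fun n => by
    have hpm : ∀ k : ℕ, ((-1 : ℝ) ^ k) ^ 2 = 1 := fun k => by
      rw [← pow_mul, mul_comm, pow_mul]; norm_num
    rw [← Finset.sum_sdiff (hsub n), ← card_blockPairs, ← card_pairs,
      ← Finset.cast_card_sdiff (hsub n), ← nsmul_eq_mul, ← nsmul_eq_mul, ← Finset.sum_const,
      ← Finset.sum_const]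
    congr 1
    · refine Finset.sum_congr rfl fun p hp => ?_
      rw [if_neg (Finset.mem_sdiff.1 hp).2, sub_zero, mul_pow, hpm, mul_one]
    · refine Finset.sum_congr rfl fun p hp => ?_
      rw [if_pos hp, ← sub_mul, mul_pow, hpm, mul_one]
  simp only [h1]
  refine squeeze_zero' (g := fun n : ℕ => 2 * ((n : ℝ))⁻¹ + 2 * ((n : ℝ)⁻¹) ^ 2)
    (Eventually.of_forall fun n => ?_) ?_ ?_
  · rw [← h1]
    exact Finset.sum_nonneg fun _ _ => sq_nonneg _
  · filter_upwards [eventually_ge_atTop 2] with n hn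
    obtain ⟨m, hm⟩ : ∃ m, n / 2 = m := ⟨_, rfl⟩
    rw [hm]
    have hm1 : 1 ≤ m := by omega
    have hm1' : (1 : ℝ) ≤ m := by exact_mod_cast hm1
    have hm0 : (0 : ℝ) < m := by linarith
    rcases (by omega : n = 2 * m ∨ n = 2 * m + 1) with h | h
    · rw [h]
      push_cast
      have e : (2 * (m : ℝ))⁻¹ - (m : ℝ)⁻¹ * (1 / 2) = 0 := by field_simp; ring
      rw [e]
      have : (2 * (m : ℝ) * (2 * m - 1) / 2 - 2 * m * (m - 1)) * (2 * (m : ℝ))⁻¹ ^ 2 =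
        1 / 2 * (2 * (m : ℝ))⁻¹ := by field_simp; ring
      rw [this]
      have h3 : 0 < (2 * (m : ℝ))⁻¹ := by positivity
      nlinarith [sq_nonneg ((2 * (m : ℝ))⁻¹)]
    · rw [h]
      push_cast
      have e : (2 * (m : ℝ) + 1)⁻¹ - (m : ℝ)⁻¹ * (1 / 2) =
        -((2 * (m : ℝ) + 1)⁻¹ * (m : ℝ)⁻¹ * (1 / 2)) := by field_simp; ring
      rw [e]
      have e1 : ((2 * (m : ℝ) + 1) * (2 * m + 1 - 1) / 2 - 2 * m * (m - 1)) *
        (2 * (m : ℝ) + 1)⁻¹ ^ 2 = 3 * m * (2 * (m : ℝ) + 1)⁻¹ * (2 * (m : ℝ) + 1)⁻¹ := by ring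
      have e2 : 2 * (m : ℝ) * (m - 1) * (-((2 * (m : ℝ) + 1)⁻¹ * (m : ℝ)⁻¹ * (1 / 2))) ^ 2 =
        (1 / 2 - 1 / 2 * (m : ℝ)⁻¹) * ((2 * (m : ℝ) + 1)⁻¹) ^ 2 := by field_simp
      rw [e1, e2]
      have h3 : 0 < (2 * (m : ℝ) + 1)⁻¹ := by positivity
      have h4 : 0 < (m : ℝ)⁻¹ := by positivity
      have h5 : 3 * m * (2 * (m : ℝ) + 1)⁻¹ ≤ 2 := by
        rw [← div_eq_mul_inv, div_le_iff₀ (by positivity)]; linarith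
      have h6 := mul_le_mul_of_nonneg_right h5 h3.le
      have h7 : (1 / 2 - 1 / 2 * (m : ℝ)⁻¹) * ((2 * (m : ℝ) + 1)⁻¹) ^ 2 ≤
        2 * ((2 * (m : ℝ) + 1)⁻¹) ^ 2 := mul_le_mul_of_nonneg_right (by linarith) (sq_nonneg _)
      linarith
  · have := tendsto_inv_atTop_nhds_zero_nat (𝕜 := ℝ)
    simpa using (this.const_mul 2).add ((this.pow 2).const_mul 2)

/-- Limit law of the degenerate part of the alternating statistic, from a diagonal expansion of
the symmetrized kernel on pairs with times. -/
theorem tendsto_charFun_alternating (h : IsIID X ν P) (hm : Measurable (Function.uncurry g))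
    (hg : MemLp (Function.uncurry g) 2 (ν.prod ν)) (hd : IsDegenerate ν g) {κ : Type*}
    {ψ : κ → (𝒳 × 𝒳) × I → ℝ}
    (hψ : IsCenteredOrthonormal ((ν.prod ν).prod (volume : Measure I)) ψ) (c : κ → ℝ)
    (hlim : Tendsto (fun s : Finset κ => ∫ z, (1 / 2 * hatKernel (pairKernel g) z.1 z.2 -
      ∑ α ∈ s, c α * (ψ α z.1 * ψ α z.2)) ^ 2 ∂(((ν.prod ν).prod (volume : Measure I)).prod
        ((ν.prod ν).prod (volume : Measure I)))) atTop (𝓝 0)) {t : ℝ} {z : ℂ}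
    (hz : HasProd (fun α => quadChar (c α * t)) z) :
    Tendsto (fun n : ℕ => charFun (P.map fun ω => ∑ p ∈ pairs n,
      ((n : ℝ)⁻¹ * (-1 : ℝ) ^ p.2) * g (X p.2 ω) (X p.1 ω)) t) atTop (𝓝 z) := by
  have hY := isIID_infinitePi ((ν.prod ν).prod (volume : Measure I))
  have hFm := measurable_pairKernel hm
  have hF2 := memLp_pairKernel hg
  have h1 := tendsto_charFun_ustat hY hψ.memLp hψ.mean hψ.norm hψ.orth c
    (G := fun p q => 1 / 2 * hatKernel (pairKernel g) p q)
    ((memLp_hatKernel hF2).const_mul (1 / 2))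
    ((isDegenerate_hatKernel hF2 (isDegenerate_pairKernel hg hd)).const_mul (1 / 2)) hlim hz
  -- The law identity removes the times, and the factor ½ passes from the kernel to the weight:
  -- 1/(2m) replaces 1/n.
  have h2 : Tendsto (fun m : ℕ => charFun (P.map fun ω => ∑ p ∈ blockPairs m,
      ((m : ℝ)⁻¹ * (1 / 2) * (-1 : ℝ) ^ p.2) * g (X p.2 ω) (X p.1 ω)) t) atTop (𝓝 z) := by
    refine h1.congr fun m => ?_
    simp only [← mul_assoc]
    rw [← charFun_hatKernel_eq h.pair hY hFm m ((m : ℝ)⁻¹ * (1 / 2)) t]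
    congr 2
    funext ω
    rw [← Finset.mul_sum, sum_pairKernel (fun k => X k ω), Finset.mul_sum]
    simp only [mul_assoc]
  have hdiv : Tendsto (fun n : ℕ => n / 2) atTop atTop :=
    Nat.tendsto_div_const_atTop two_ne_zero
  have h3 := h2.comp hdiv
  have hsub : ∀ n, blockPairs (n / 2) ⊆ pairs n := fun n p hp => by
    simp only [blockPairs, Finset.mem_filter, mem_pairs] at hp
    rw [mem_pairs]
    omega
  have hlt : ∀ n, ∀ p ∈ pairs n, p.2 < p.1 := fun n p hp => (mem_pairs.1 hp).2
  have e : ∀ (n : ℕ) (ω : Ω), ∑ p ∈ blockPairs (n / 2),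
      (((n / 2 : ℕ) : ℝ)⁻¹ * (1 / 2) * (-1 : ℝ) ^ p.2) * g (X p.2 ω) (X p.1 ω) =
      ∑ p ∈ pairs n, (if p ∈ blockPairs (n / 2) then
        ((n / 2 : ℕ) : ℝ)⁻¹ * (1 / 2) * (-1 : ℝ) ^ p.2 else 0) * g (X p.2 ω) (X p.1 ω) :=
    fun n ω => by
      rw [← Finset.sum_subset (hsub n) fun p _ hp => by rw [if_neg hp, zero_mul]]
      exact Finset.sum_congr rfl fun p hp => by rw [if_pos hp]
  have eD : ∀ (n : ℕ) (ω : Ω), (∑ p ∈ pairs n,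
      ((n : ℝ)⁻¹ * (-1 : ℝ) ^ p.2) * g (X p.2 ω) (X p.1 ω)) -
      (∑ p ∈ blockPairs (n / 2),
      (((n / 2 : ℕ) : ℝ)⁻¹ * (1 / 2) * (-1 : ℝ) ^ p.2) * g (X p.2 ω) (X p.1 ω)) =
      ∑ p ∈ pairs n, ((n : ℝ)⁻¹ * (-1 : ℝ) ^ p.2 - if p ∈ blockPairs (n / 2) then
        ((n / 2 : ℕ) : ℝ)⁻¹ * (1 / 2) * (-1 : ℝ) ^ p.2 else 0) * g (X p.2 ω) (X p.1 ω) :=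
    fun n ω => by
      rw [e, ← Finset.sum_sub_distrib]
      simp only [sub_mul]
  refine tendsto_charFun_of_sub (fun n => (h.memLp_sum_pairs hg (hlt n) _).1.aemeasurable)
    (fun n => ?_) (fun n => ?_) ?_ h3
  · simp only [e]
    exact (h.memLp_sum_pairs hg (hlt n) _).1.aemeasurable
  · simp only [eD]
    exact h.memLp_sum_pairs hg (hlt n) _
  · simp only [eD]
    have := tendsto_sum_sq_blockPairs.mul_const (∫ z, g z.1 z.2 ^ 2 ∂(ν.prod ν))
    rw [zero_mul] at this
    refine this.congr fun n => ?_
    exact (h.integral_sum_pairs_sq hg hd (hlt n) _).symm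

end PairStat

/-! ### Quadratic functionals of normal variables -/

theorem integral_pow_four_gaussianReal : ∫ x, x ^ 4 ∂(gaussianReal 0 1) = 3 := by
  rw [integral_gaussianReal_eq_integral_smul one_ne_zero]
  have h1 : ∀ x : ℝ, gaussianPDFReal 0 1 x • x ^ 4 =
      (√(2 * Real.pi))⁻¹ * (|x| ^ (4 : ℝ) * Real.exp (-(1 / 2) * |x| ^ (2 : ℝ))) := fun x => by
    rw [gaussianPDFReal_def]
    have e4 : |x| ^ (4 : ℝ) = x ^ 4 := by
      rw [show (4 : ℝ) = ((4 : ℕ) : ℝ) by norm_num, Real.rpow_natCast]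
      exact Even.pow_abs (by decide) x
    have e2 : |x| ^ (2 : ℝ) = x ^ 2 := by
      rw [show (2 : ℝ) = ((2 : ℕ) : ℝ) by norm_num, Real.rpow_natCast]
      exact Even.pow_abs (by decide) x
    rw [e4, e2]
    simp
    ring_nf
  simp only [h1]
  rw [integral_const_mul, integral_comp_abs
    (f := fun x => x ^ (4 : ℝ) * Real.exp (-(1 / 2) * x ^ (2 : ℝ))),
    integral_rpow_mul_exp_neg_mul_rpow two_pos (by norm_num) (by norm_num)]
  have hG : Real.Gamma ((4 + 1) / 2) = 3 / 4 * √Real.pi := by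
    rw [show (4 + 1 : ℝ) / 2 = (1 / 2 + 1) + 1 by norm_num, Real.Gamma_add_one (by norm_num),
      Real.Gamma_add_one (by norm_num), Real.Gamma_one_half_eq]
    ring
  have hp : (1 / 2 : ℝ) ^ (-(4 + 1) / 2 : ℝ) = 4 * √2 := by
    rw [show (-(4 + 1) / 2 : ℝ) = -(2 + 1 / 2) by norm_num, one_div, Real.inv_rpow two_pos.le,
      Real.rpow_neg two_pos.le, inv_inv, Real.rpow_add two_pos, Real.sqrt_eq_rpow]
    norm_num
  rw [hG, hp, Real.sqrt_mul two_pos.le]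
  have h2 : √(2 : ℝ) ≠ 0 := by positivity
  have h3 : √Real.pi ≠ 0 := by positivity
  field_simp

theorem memLp_sq_sub_one_gaussianReal : MemLp (fun x : ℝ => x ^ 2 - 1) 2 (gaussianReal 0 1) := by
  refine MemLp.sub ?_ (memLp_const 1)
  rw [memLp_two_iff_integrable_sq (by fun_prop)]
  have h := (memLp_id_gaussianReal' (μ := 0) (v := 1) 4 (by simp)).integrable_norm_pow
    (by norm_num : (4 : ℕ) ≠ 0)
  refine h.congr (ae_of_all _ fun x => ?_)
  simp only [id, Real.norm_eq_abs]
  rw [Even.pow_abs (by decide), ← pow_mul]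

theorem integral_sq_gaussianReal : ∫ x, x ^ 2 ∂(gaussianReal 0 1) = 1 := by
  have h := variance_eq_sub (memLp_id_gaussianReal' (μ := 0) (v := 1) 2 (by simp))
  rw [variance_id_gaussianReal] at h
  simp at h
  exact h.symm

theorem integrable_sq_gaussianReal : Integrable (fun x : ℝ => x ^ 2) (gaussianReal 0 1) :=
  (memLp_id_gaussianReal' (μ := 0) (v := 1) 2 (by simp)).integrable_sq

theorem integral_sq_sub_one_gaussianReal : ∫ x, (x ^ 2 - 1) ∂(gaussianReal 0 1) = 0 := by
  rw [integral_sub integrable_sq_gaussianReal (integrable_const _), integral_sq_gaussianReal]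
  simp

theorem integral_sq_sub_one_sq_gaussianReal :
    ∫ x, (x ^ 2 - 1) ^ 2 ∂(gaussianReal 0 1) = 2 := by
  have h4 : Integrable (fun x : ℝ => x ^ 4) (gaussianReal 0 1) := by
    have h := (memLp_id_gaussianReal' (μ := 0) (v := 1) 4 (by simp)).integrable_norm_pow
      (by norm_num : (4 : ℕ) ≠ 0)
    refine h.congr (ae_of_all _ fun x => ?_)
    simp only [id, Real.norm_eq_abs]
    rw [Even.pow_abs (by decide)]
  have e : ∀ x : ℝ, (x ^ 2 - 1) ^ 2 = x ^ 4 - (2 * x ^ 2 - 1) := fun x => by ring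
  simp only [e]
  have h2 := integrable_sq_gaussianReal.const_mul 2
  have h3 : Integrable (fun x : ℝ => 2 * x ^ 2 - 1) (gaussianReal 0 1) :=
    h2.sub (integrable_const _)
  rw [integral_sub h4 h3, integral_sub h2 (integrable_const _),
    integral_const_mul, integral_sq_gaussianReal, integral_pow_four_gaussianReal]
  simp
  norm_num

/-- The two factors are complex conjugates, so the product is a squared modulus. The phase coming
from the centring drops out and the Gaussian integral with parameter (1 - it)/2 remains. -/
theorem quadChar_mul_neg (t : ℝ) :
    quadChar t * quadChar (-t) = (((1 + t ^ 2) ^ (-(1 / 2) : ℝ) : ℝ) : ℂ) := by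
  have hm : Measurable fun x : ℝ => 1 / 2 * (x ^ 2 - 1) := by fun_prop
  have hconj : quadChar (-t) = (starRingEnd ℂ) (quadChar t) := charFun_neg t
  rw [hconj, Complex.mul_conj, Complex.normSq_eq_norm_sq]
  congr 1
  have hb : (0 : ℝ) < (1 / 2 - t / 2 * Complex.I : ℂ).re := by simp
  have hq : quadChar t = Complex.exp (((-t / 2 : ℝ) : ℂ) * Complex.I) *
      ((((√(2 * Real.pi))⁻¹ : ℝ) : ℂ) *
        (Real.pi / (1 / 2 - t / 2 * Complex.I : ℂ)) ^ (1 / 2 : ℂ)) := by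
    rw [quadChar, charFun_map_eq_integral hm.aemeasurable,
      integral_gaussianReal_eq_integral_smul one_ne_zero, ← integral_gaussian_complex hb,
      ← integral_const_mul, ← integral_const_mul]
    refine integral_congr_ae (ae_of_all _ fun x => ?_)
    simp only [gaussianPDFReal_def, Complex.real_smul]
    simp only [NNReal.coe_one, mul_one, sub_zero, Complex.ofReal_mul, Complex.ofReal_exp]
    rw [mul_assoc, mul_left_comm (Complex.exp (((-t / 2 : ℝ) : ℂ) * Complex.I)),
      ← Complex.exp_add, ← Complex.exp_add]
    congr 2
    push_cast
    ring
  have hnorm : ‖(1 / 2 - t / 2 * Complex.I : ℂ)‖ = √(1 + t ^ 2) / 2 := by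
    rw [Complex.norm_eq_sqrt_sq_add_sq]
    have : ((1 / 2 - t / 2 * Complex.I : ℂ).re) ^ 2 + ((1 / 2 - t / 2 * Complex.I : ℂ).im) ^ 2 =
        (1 + t ^ 2) / 2 ^ 2 := by
      simp
      ring
    rw [this, Real.sqrt_div' _ (by norm_num), Real.sqrt_sq two_pos.le]
  generalize (1 / 2 - t / 2 * Complex.I : ℂ) = b at hq hnorm
  rw [hq, norm_mul, Complex.norm_exp_ofReal_mul_I, one_mul, norm_mul, Complex.norm_real,
    show (1 / 2 : ℂ) = ((1 / 2 : ℝ) : ℂ) by norm_num, Complex.norm_cpow_real, norm_div, hnorm,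
    Complex.norm_real, Real.norm_of_nonneg Real.pi_pos.le,
    Real.norm_of_nonneg (by positivity : (0 : ℝ) ≤ (√(2 * Real.pi))⁻¹),
    mul_pow, inv_pow, Real.sq_sqrt (by positivity), ← Real.rpow_natCast, ← Real.rpow_mul
    (by positivity)]
  have hs : √(1 + t ^ 2) ≠ 0 := by positivity
  rw [Real.rpow_neg (by positivity), ← Real.sqrt_eq_rpow]
  norm_num
  field_simp

/-- Weighted sums of independent centered squares of standard normal variables. -/
theorem exists_quadratic_sum {ι : Type} {c : ι → ℝ} (hc : Summable fun r => c r ^ 2) :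
    ∃ (P' : Measure (ι → ℝ)) (_ : IsProbabilityMeasure P') (ζ : ι → (ι → ℝ) → ℝ)
      (W : (ι → ℝ) → ℝ), iIndepFun ζ P' ∧ (∀ r, HasLaw (ζ r) (gaussianReal 0 1) P') ∧
      IsL2Sum (fun r ω => 1 / 2 * c r * (ζ r ω ^ 2 - 1)) W P' ∧ ∫ ω, W ω ∂P' = 0 ∧
      Var[W; P'] = 1 / 2 * ∑' r, c r ^ 2 ∧
      ∀ t, HasProd (fun r => quadChar (c r * t)) (charFun (P'.map W) t) := by
  set P' : Measure (ι → ℝ) := Measure.infinitePi fun _ => gaussianReal 0 1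
  have hind : iIndepFun (fun (r : ι) (ω : ι → ℝ) => ω r) P' :=
    iIndepFun_infinitePi (X := fun _ x => x) fun _ => measurable_id
  have hmp : ∀ r, MeasurePreserving (fun ω : ι → ℝ => ω r) P' (gaussianReal 0 1) := fun r =>
    measurePreserving_eval_infinitePi _ r
  have hY : iIndepFun (fun r (ω : ι → ℝ) => 1 / 2 * c r * (ω r ^ 2 - 1)) P' :=
    iIndepFun_infinitePi (X := fun r x => 1 / 2 * c r * (x ^ 2 - 1)) fun _ => by fun_prop
  have hY2 : ∀ r, MemLp (fun ω : ι → ℝ => 1 / 2 * c r * (ω r ^ 2 - 1)) 2 P' := fun r =>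
    (memLp_sq_sub_one_gaussianReal.comp_measurePreserving (hmp r)).const_mul _
  have hint : ∀ (r : ι) (φ : ℝ → ℝ), AEStronglyMeasurable φ (gaussianReal 0 1) →
      ∫ ω, φ (ω r) ∂P' = ∫ x, φ x ∂(gaussianReal 0 1) := fun r φ hφ => by
    rw [← (hmp r).map_eq] at hφ ⊢
    exact (integral_map (hmp r).aemeasurable hφ).symm
  have hsq : ∀ r, ∫ ω, (1 / 2 * c r * (ω r ^ 2 - 1)) ^ 2 ∂P' = 1 / 2 * c r ^ 2 := fun r => by
    simp only [mul_pow (1 / 2 * c r)]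
    rw [integral_const_mul, hint r (fun x => (x ^ 2 - 1) ^ 2) (by fun_prop),
      integral_sq_sub_one_sq_gaussianReal]
    ring
  obtain ⟨W, h1, h2, h3, h4⟩ := exists_isL2Sum hY hY2 (fun r => by
    rw [integral_const_mul, hint r (fun x => x ^ 2 - 1) (by fun_prop),
      integral_sq_sub_one_gaussianReal, mul_zero])
    (by simp only [hsq]; exact hc.mul_left _)
  refine ⟨P', inferInstance, fun r ω => ω r, W, hind, fun r => ⟨(hmp r).aemeasurable,
    (hmp r).map_eq⟩, h1, h2, ?_, fun t => ?_⟩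
  · rw [h3]
    simp only [hsq]
    exact tsum_mul_left
  · refine (h4 t).congr_fun fun r => ?_
    rw [quadChar, ← charFun_map_mul, ← (hmp r).map_eq, Measure.map_map (by fun_prop) (by fun_prop),
      Measure.map_map (by fun_prop) (hmp r).measurable]
    congr 2
    funext ω
    simp only [Function.comp_apply]
    ring

/-! ### The infinite product of the hyperbolic cosine -/

/-- The frequencies `(k + 1/2) π`. -/
def freq (k : ℕ) : ℝ := (k + 1 / 2) * Real.pi

theorem freq_pos (k : ℕ) : 0 < freq k := by
  rw [freq]; positivity

/-- The Basel sum without its even terms gives π²/8 for the odd reciprocals squared. -/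
theorem hasSum_inv_freq_sq : HasSum (fun k => (1 / freq k) ^ 2) (1 / 2) := by
  have h := hasSum_zeta_two
  have h0 : HasSum (fun k : ℕ => 1 / ((2 * k : ℕ) : ℝ) ^ 2) (1 / 4 * (Real.pi ^ 2 / 6)) := by
    refine (h.mul_left (1 / 4)).congr_fun fun k => ?_
    rcases eq_or_ne k 0 with rfl | hk
    · simp
    · have : (k : ℝ) ≠ 0 := by exact_mod_cast hk
      push_cast
      field_simp
      norm_num
  have hs : Summable fun k : ℕ => 1 / ((2 * k + 1 : ℕ) : ℝ) ^ 2 :=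
    h.summable.comp_injective (i := fun k => 2 * k + 1) fun a b hab => by simpa using hab
  have h1 : 1 / 4 * (Real.pi ^ 2 / 6) + ∑' k : ℕ, 1 / ((2 * k + 1 : ℕ) : ℝ) ^ 2 =
      Real.pi ^ 2 / 6 :=
    (HasSum.even_add_odd (f := fun n : ℕ => 1 / (n : ℝ) ^ 2) h0 hs.hasSum).unique h
  have heq : ∑' k : ℕ, 1 / ((2 * k + 1 : ℕ) : ℝ) ^ 2 = Real.pi ^ 2 / 8 := by linarith
  have h2 : HasSum (fun k : ℕ => 1 / ((2 * k + 1 : ℕ) : ℝ) ^ 2) (Real.pi ^ 2 / 8) := by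
    have := hs.hasSum
    rwa [heq] at this
  have h3 := h2.mul_left (4 / Real.pi ^ 2)
  rw [show 4 / Real.pi ^ 2 * (Real.pi ^ 2 / 8) = 1 / 2 by field_simp; norm_num] at h3
  refine h3.congr_fun fun k => ?_
  rw [freq]
  push_cast
  have : (2 * (k : ℝ) + 1) ≠ 0 := by positivity
  field_simp
  ring

theorem prod_range_two_mul {M : Type*} [CommMonoid M] (f : ℕ → M) (n : ℕ) :
    ∏ j ∈ Finset.range (2 * n), f j =
      (∏ k ∈ Finset.range n, f (2 * k)) * ∏ k ∈ Finset.range n, f (2 * k + 1) := by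
  induction n with
  | zero => simp
  | succ n ih =>
    rw [show 2 * (n + 1) = 2 * n + 1 + 1 by ring, Finset.prod_range_succ, Finset.prod_range_succ,
      ih, Finset.prod_range_succ, Finset.prod_range_succ]
    simp only [mul_assoc, mul_left_comm, mul_comm]

/-- With πz = it one has sin(2πz) / sin(πz) = 2 cosh t. In Euler's product for the numerator, taken
with twice as many factors, those with even denominators are exactly the product for the
denominator; the odd ones remain. -/
theorem tendsto_prod_cosh (t : ℝ) :
    Tendsto (fun n => ∏ k ∈ Finset.range n, (1 + (t / freq k) ^ 2)) atTop (𝓝 (Real.cosh t)) := by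
  rcases eq_or_ne t 0 with rfl | ht
  · simp
  set z : ℂ := t * Complex.I / Real.pi with hz
  have hpi : (Real.pi : ℂ) ≠ 0 := by exact_mod_cast Real.pi_ne_zero
  have hpz : Real.pi * z = t * Complex.I := by rw [hz]; field_simp
  have hzz : z ^ 2 = -(t / Real.pi) ^ 2 := by
    rw [hz, div_pow, mul_pow, Complex.I_sq, div_pow]; ring
  have h1 := Complex.tendsto_euler_sin_prod z
  have h2 := (Complex.tendsto_euler_sin_prod (2 * z)).comp
    (tendsto_id.const_mul_atTop' (r := 2) two_pos)
  have hz0 : z ≠ 0 := by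
    rw [hz]
    have : (t : ℂ) ≠ 0 := by exact_mod_cast ht
    simp [this, hpi]
  have hsin : Complex.sin (Real.pi * z) ≠ 0 := by
    rw [hpz, Complex.sin_mul_I]
    have : Complex.sinh t ≠ 0 := by
      rw [← Complex.ofReal_sinh]
      exact_mod_cast Real.sinh_ne_zero.2 ht
    simp [this]
  have h3 : Tendsto (fun n : ℕ => ∏ k ∈ Finset.range n,
      (1 - (2 * z) ^ 2 / (((2 * k : ℕ) : ℂ) + 1) ^ 2)) atTop (𝓝 (Complex.cosh t)) := by
    have h4 := h2.div h1 hsin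
    have e : Complex.sin (Real.pi * (2 * z)) / Complex.sin (Real.pi * z) = 2 * Complex.cosh t := by
      rw [mul_left_comm, Complex.sin_two_mul, hpz, Complex.cos_mul_I]
      rw [hpz] at hsin
      field_simp
    rw [e] at h4
    have h5 := h4.const_mul (1 / 2)
    rw [show (1 / 2 : ℂ) * (2 * Complex.cosh t) = Complex.cosh t by ring] at h5
    have hne : ∀ᶠ n : ℕ in atTop, Real.pi * z * ∏ j ∈ Finset.range n,
      ((1 : ℂ) - z ^ 2 / ((j : ℂ) + 1) ^ 2) ≠ 0 := h1.eventually_ne hsin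
    refine h5.congr' ?_
    filter_upwards [hne] with n hn
    simp only [Function.comp_apply, Pi.div_apply, id]
    rw [prod_range_two_mul]
    have e2 : ∏ k ∈ Finset.range n, ((1 : ℂ) - (2 * z) ^ 2 / (((2 * k + 1 : ℕ) : ℂ) + 1) ^ 2) =
        ∏ j ∈ Finset.range n, ((1 : ℂ) - z ^ 2 / ((j : ℂ) + 1) ^ 2) := by
      refine Finset.prod_congr rfl fun k _ => ?_
      have : ((k : ℂ) + 1) ≠ 0 := by exact_mod_cast Nat.succ_ne_zero k
      push_cast
      rw [show (2 * (k : ℂ) + 1 + 1) = 2 * (k + 1) by ring]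
      field_simp
    rw [e2]
    generalize ∏ j ∈ Finset.range n, ((1 : ℂ) - z ^ 2 / ((j : ℂ) + 1) ^ 2) = b at hn ⊢
    have hb : b ≠ 0 := right_ne_zero_of_mul hn
    push_cast
    field_simp
  have h6 := (Complex.continuous_re.tendsto _).comp h3
  rw [← Complex.ofReal_cosh, Complex.ofReal_re] at h6
  refine h6.congr fun n => ?_
  rw [Function.comp_apply, ← Complex.ofReal_re (∏ k ∈ Finset.range n, (1 + (t / freq k) ^ 2))]
  congr 1
  rw [Complex.ofReal_prod]
  refine Finset.prod_congr rfl fun k _ => ?_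
  rw [mul_pow, hzz, freq]
  have : (2 * (k : ℂ) + 1) ≠ 0 := by
    have : ((2 * k + 1 : ℕ) : ℂ) ≠ 0 := Nat.cast_ne_zero.2 (Nat.succ_ne_zero _)
    push_cast at this
    exact this
  have h7 : ((k : ℂ) + 1 / 2) ≠ 0 := fun h => this (by linear_combination 2 * h)
  push_cast
  field_simp
  ring

/-- The weights `±1 / ((k + 1/2) π)`. -/
def areaWeight (r : ℕ × Bool) : ℝ := (if r.2 then 1 else -1) * (1 / freq r.1)

theorem areaWeight_sq (r : ℕ × Bool) : areaWeight r ^ 2 = (1 / freq r.1) ^ 2 := by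
  rw [areaWeight, mul_pow]
  split_ifs <;> simp

theorem hasSum_areaWeight_sq : HasSum (fun r => areaWeight r ^ 2) 1 := by
  have h : Summable fun r : ℕ × Bool => (1 / freq r.1) ^ 2 :=
    (summable_prod_of_nonneg fun r => sq_nonneg _).2 ⟨fun k => (hasSum_fintype _).summable, by
      simpa using hasSum_inv_freq_sq.summable.mul_left 2⟩
  simp only [areaWeight_sq]
  have h1 := h.hasSum.prod_fiberwise fun k => hasSum_fintype _
  have h2 : HasSum (fun k => ∑ b : Bool, (1 / freq ((k, b) : ℕ × Bool).1) ^ 2) (2 * (1 / 2)) := by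
    refine (hasSum_inv_freq_sq.mul_left 2).congr_fun fun k => ?_
    simp
  have h3 := h.hasSum
  rw [h1.unique h2] at h3
  norm_num at h3 ⊢
  exact h3

/-- Weights of opposite sign are grouped and multiplied by `quadChar_mul_neg`. -/
theorem hasProd_of_hasProd_bool {κ : Type*} {c : κ → ℝ} {t : ℝ} {z : ℂ}
    (h : HasProd (fun r : κ × Bool => quadChar ((if r.2 then 1 else -1) * c r.1 * t)) z) :
    HasProd (fun k => (((1 + (c k * t) ^ 2) ^ (-(1 / 2) : ℝ) : ℝ) : ℂ)) z := by
  refine h.prod_fiberwise fun k => ?_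
  have h1 := hasProd_fintype fun b : Bool => quadChar ((if b then 1 else -1) * c k * t)
  rw [Fintype.prod_bool] at h1
  simp only [if_true, one_mul, Bool.false_eq_true, if_false, neg_mul] at h1
  rw [quadChar_mul_neg] at h1
  simpa only [neg_mul] using h1

/-- Unconditional convergence comes from the existence of a random series with this characteristic
function, so the value only has to be found along initial segments, where it is the power -½ of the
product for cosh. -/
theorem hasProd_half_area (t : ℝ) :
    HasProd (fun k => (((1 + (1 / freq k * t) ^ 2) ^ (-(1 / 2) : ℝ) : ℝ) : ℂ))
      ((1 / √(Real.cosh t) : ℝ) : ℂ) := by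
  obtain ⟨P', _, ζ, W, -, -, -, -, -, h⟩ := exists_quadratic_sum hasSum_areaWeight_sq.summable
  have h1 := hasProd_of_hasProd_bool (c := fun k => 1 / freq k) (h t)
  have h2 := h1.tendsto_prod_nat
  have h3 : Tendsto (fun n => ∏ k ∈ Finset.range n,
      (((1 + (1 / freq k * t) ^ 2) ^ (-(1 / 2) : ℝ) : ℝ) : ℂ)) atTop
      (𝓝 ((1 / √(Real.cosh t) : ℝ) : ℂ)) := by
    have h4 := (tendsto_prod_cosh t).rpow_const (p := -(1 / 2)) (Or.inl (Real.cosh_pos t).ne')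
    rw [Real.rpow_neg (Real.cosh_pos t).le, ← Real.sqrt_eq_rpow, ← one_div] at h4
    refine ((Complex.continuous_ofReal.tendsto _).comp h4).congr fun n => ?_
    rw [Function.comp_apply, ← Complex.ofReal_prod, Real.finsetProd_rpow _ _ fun k _ => by
      positivity]
    simp only [one_div_mul_eq_div]
  rwa [tendsto_nhds_unique h2 h3] at h1

theorem hasProd_areaWeight (t : ℝ) :
    HasProd (fun r => quadChar (areaWeight r * t)) ((1 / √(Real.cosh t) : ℝ) : ℂ) := by
  obtain ⟨P', _, ζ, W, -, -, -, -, -, h⟩ := exists_quadratic_sum hasSum_areaWeight_sq.summable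
  have h1 := hasProd_of_hasProd_bool (c := fun k => 1 / freq k) (h t)
  have h2 := h t
  rwa [h1.unique (hasProd_half_area t)] at h2

/-- The law of `∫ B₁ dB₂`: existence, with mean `0` and variance `1/2`. -/
theorem exists_halfAreaLaw : ∃ κ : Measure ℝ, IsProbabilityMeasure κ ∧ MemLp id 2 κ ∧
    ∫ x, x ∂κ = 0 ∧ ∫ x, x ^ 2 ∂κ = 1 / 2 ∧
    ∀ t, charFun κ t = ((1 / √(Real.cosh t) : ℝ) : ℂ) := by
  obtain ⟨P', _, ζ, W, -, -, hW, h0, hv, h⟩ := exists_quadratic_sum hasSum_areaWeight_sq.summable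
  have hWm := hW.2.1.1.aemeasurable
  refine ⟨P'.map W, Measure.isProbabilityMeasure_map hWm, ?_, ?_, ?_, fun t =>
    (h t).unique (hasProd_areaWeight t)⟩
  · rw [memLp_map_measure_iff (by fun_prop) hWm]
    exact hW.2.1
  · rw [integral_map hWm (by fun_prop), h0]
  · rw [integral_map hWm (by fun_prop)]
    rw [variance_of_integral_eq_zero hWm h0] at hv
    rw [hv, hasSum_areaWeight_sq.tsum_eq]
    norm_num

/-- The law of the stochastic area: existence, with mean `0` and variance `1`. -/
theorem exists_areaLaw : ∃ κ : Measure ℝ, IsProbabilityMeasure κ ∧ MemLp id 2 κ ∧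
    ∫ x, x ∂κ = 0 ∧ ∫ x, x ^ 2 ∂κ = 1 ∧
    ∀ t, charFun κ t = ((1 / Real.cosh t : ℝ) : ℂ) := by
  -- Two independent copies of the series for the half area are used, so that the exponent -½
  -- becomes -1.
  have hs : HasSum (fun r : Bool × (ℕ × Bool) => areaWeight r.2 ^ 2) 2 := by
    have h1 : Summable fun r : Bool × (ℕ × Bool) => areaWeight r.2 ^ 2 :=
      (summable_prod_of_nonneg fun r => sq_nonneg _).2
        ⟨fun _ => hasSum_areaWeight_sq.summable, (hasSum_fintype _).summable⟩
    have h2 := h1.hasSum.prod_fiberwise fun _ => hasSum_areaWeight_sq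
    have h3 := h1.hasSum
    rw [h2.unique (hasSum_fintype _)] at h3
    simp at h3
    exact h3
  obtain ⟨P', _, ζ, W, -, -, hW, h0, hv, h⟩ := exists_quadratic_sum hs.summable
  have hWm := hW.2.1.1.aemeasurable
  refine ⟨P'.map W, Measure.isProbabilityMeasure_map hWm, ?_, ?_, ?_, fun t => ?_⟩
  · rw [memLp_map_measure_iff (by fun_prop) hWm]
    exact hW.2.1
  · rw [integral_map hWm (by fun_prop), h0]
  · rw [integral_map hWm (by fun_prop)]
    rw [variance_of_integral_eq_zero hWm h0] at hv
    rw [hv, hs.tsum_eq]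
    norm_num
  · have h1 := (h t).prod_fiberwise fun _ => hasProd_areaWeight t
    rw [h1.unique (hasProd_fintype _), Fintype.prod_bool, ← Complex.ofReal_mul, div_mul_div_comm,
      Real.mul_self_sqrt (Real.cosh_pos t).le, one_mul]

/-! ### The trigonometric expansion of the indicator of `t < u` -/

theorem integral_unitInterval (f : ℝ → ℝ) : ∫ t : I, f t = ∫ t in (0 : ℝ)..1, f t := by
  rw [intervalIntegral.integral_of_le zero_le_one, ← integral_Icc_eq_integral_Ioc]
  exact integral_subtype_comap measurableSet_Icc f

theorem integral_lt_mul (f : ℝ → ℝ) (u : I) :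
    ∫ t : I, (if t < u then 1 else 0) * f t = ∫ t in (0 : ℝ)..u, f t := by
  have e : ∀ t : I, (if t < u then (1 : ℝ) else 0) * f t =
      (Set.Iio (u : ℝ)).indicator f (t : ℝ) := fun t => by
    by_cases h : t < u
    · rw [if_pos h, one_mul, Set.indicator_of_mem]
      exact h
    · rw [if_neg h, zero_mul, Set.indicator_of_notMem]
      exact h
  simp only [e]
  rw [integral_unitInterval, intervalIntegral.integral_of_le zero_le_one,
    intervalIntegral.integral_of_le u.2.1, setIntegral_indicator measurableSet_Iio,
    integral_Ioc_eq_integral_Ioo]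
  congr 2
  ext x
  simp only [Set.mem_inter_iff, Set.mem_Ioc, Set.mem_Iio, Set.mem_Ioo]
  have := u.2.2
  constructor
  · rintro ⟨h1, h2⟩; exact ⟨h1.1, h2⟩
  · rintro ⟨h1, h2⟩; exact ⟨⟨h1, h2.le.trans this⟩, h2⟩

theorem integral_cos_mul {a : ℝ} (ha : a ≠ 0) (u : ℝ) :
    ∫ t in (0 : ℝ)..u, Real.cos (a * t) = Real.sin (a * u) / a := by
  rw [intervalIntegral.integral_comp_mul_left (fun x => Real.cos x) ha, integral_cos]
  simp [div_eq_inv_mul]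

/-- The functions `√2 cos((k + 1/2) π t)`. -/
def cosBasis (k : ℕ) (t : I) : ℝ := √2 * Real.cos (freq k * t)

/-- The functions `√2 sin((k + 1/2) π t)`. -/
def sinBasis (k : ℕ) (t : I) : ℝ := √2 * Real.sin (freq k * t)

theorem continuous_cosBasis (k : ℕ) : Continuous (cosBasis k) := by
  unfold cosBasis; fun_prop

theorem continuous_sinBasis (k : ℕ) : Continuous (sinBasis k) := by
  unfold sinBasis; fun_prop

theorem memLp_cosBasis (k : ℕ) : MemLp (cosBasis k) 2 (volume : Measure I) :=
  (continuous_cosBasis k).memLp_of_hasCompactSupport (HasCompactSupport.of_compactSpace _)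

theorem memLp_sinBasis (k : ℕ) : MemLp (sinBasis k) 2 (volume : Measure I) :=
  (continuous_sinBasis k).memLp_of_hasCompactSupport (HasCompactSupport.of_compactSpace _)

theorem integral_lt_mul_cosBasis (k : ℕ) (u : I) :
    ∫ t : I, (if t < u then 1 else 0) * cosBasis k t = 1 / freq k * sinBasis k u := by
  unfold cosBasis sinBasis
  rw [integral_lt_mul (fun t => √2 * Real.cos (freq k * t)), intervalIntegral.integral_const_mul,
    integral_cos_mul (freq_pos k).ne']
  ring

theorem sin_freq_sub (j k : ℕ) : Real.sin (freq j - freq k) = 0 := by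
  rw [show freq j - freq k = ((j - k : ℤ) : ℝ) * Real.pi by rw [freq, freq]; push_cast; ring]
  exact Real.sin_int_mul_pi _

theorem sin_freq_add (j k : ℕ) : Real.sin (freq j + freq k) = 0 := by
  rw [show freq j + freq k = ((j + k + 1 : ℕ) : ℝ) * Real.pi by rw [freq, freq]; push_cast; ring]
  exact Real.sin_nat_mul_pi _

theorem intervalIntegrable_cos_mul (a u : ℝ) :
    IntervalIntegrable (fun t => Real.cos (a * t)) volume 0 u :=
  (by fun_prop : Continuous fun t => Real.cos (a * t)).intervalIntegrable _ _

theorem integral_cos_sub_freq (j k : ℕ) :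
    ∫ t in (0 : ℝ)..1, Real.cos ((freq j - freq k) * t) = if j = k then 1 else 0 := by
  split_ifs with h
  · subst h; simp
  · have : freq j - freq k ≠ 0 := by
      rw [show freq j - freq k = ((j : ℝ) - k) * Real.pi by rw [freq, freq]; ring]
      refine mul_ne_zero (sub_ne_zero.2 ?_) Real.pi_ne_zero
      exact_mod_cast h
    rw [integral_cos_mul this, mul_one, sin_freq_sub, zero_div]

theorem integral_cos_add_freq (j k : ℕ) :
    ∫ t in (0 : ℝ)..1, Real.cos ((freq j + freq k) * t) = 0 := by
  rw [integral_cos_mul (add_pos (freq_pos j) (freq_pos k)).ne', mul_one, sin_freq_add, zero_div]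

theorem integral_cosBasis_mul (j k : ℕ) :
    ∫ t : I, cosBasis j t * cosBasis k t = if j = k then 1 else 0 := by
  have e : ∀ t : ℝ, (√2 * Real.cos (freq j * t)) * (√2 * Real.cos (freq k * t)) =
      Real.cos ((freq j - freq k) * t) + Real.cos ((freq j + freq k) * t) := fun t => by
    have := Real.mul_self_sqrt (two_pos (α := ℝ)).le
    rw [sub_mul, add_mul, Real.cos_sub, Real.cos_add]
    linear_combination (Real.cos (freq j * t) * Real.cos (freq k * t)) * this
  unfold cosBasis
  rw [integral_unitInterval fun t => (√2 * Real.cos (freq j * t)) * (√2 * Real.cos (freq k * t))]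
  simp only [e]
  rw [intervalIntegral.integral_add (intervalIntegrable_cos_mul _ _)
    (intervalIntegrable_cos_mul _ _), integral_cos_sub_freq, integral_cos_add_freq, add_zero]

theorem integral_sinBasis_mul (j k : ℕ) :
    ∫ t : I, sinBasis j t * sinBasis k t = if j = k then 1 else 0 := by
  have e : ∀ t : ℝ, (√2 * Real.sin (freq j * t)) * (√2 * Real.sin (freq k * t)) =
      Real.cos ((freq j - freq k) * t) - Real.cos ((freq j + freq k) * t) := fun t => by
    have := Real.mul_self_sqrt (two_pos (α := ℝ)).le
    rw [sub_mul, add_mul, Real.cos_sub, Real.cos_add]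
    linear_combination (Real.sin (freq j * t) * Real.sin (freq k * t)) * this
  unfold sinBasis
  rw [integral_unitInterval fun t => (√2 * Real.sin (freq j * t)) * (√2 * Real.sin (freq k * t))]
  simp only [e]
  rw [intervalIntegral.integral_sub (intervalIntegrable_cos_mul _ _)
    (intervalIntegrable_cos_mul _ _), integral_cos_sub_freq, integral_cos_add_freq, sub_zero]

theorem integral_prod_mul_mul {𝒴 : Type*} [MeasurableSpace 𝒴] {ρ : Measure 𝒴} [SFinite ρ]
    (φ φ' ψ ψ' : 𝒴 → ℝ) :
    ∫ z, (φ z.1 * ψ z.2) * (φ' z.1 * ψ' z.2) ∂(ρ.prod ρ) =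
      (∫ x, φ x * φ' x ∂ρ) * ∫ x, ψ x * ψ' x ∂ρ := by
  rw [← integral_prod_mul]
  refine integral_congr_ae (ae_of_all _ fun z => ?_)
  simp only
  ring

theorem integral_sub_sum_orthonormal_sq {𝒴 : Type*} [MeasurableSpace 𝒴] {ρ : Measure 𝒴}
    [IsProbabilityMeasure ρ] {κ : Type*} (s : Finset κ) {ψ : κ → 𝒴 → ℝ} {G : 𝒴 → ℝ}
    (hG : MemLp G 2 ρ) (hψ : ∀ α, MemLp (ψ α) 2 ρ)
    (hn : ∀ α, ∫ x, ψ α x ^ 2 ∂ρ = 1)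
    (ho : Pairwise fun α β => ∫ x, ψ α x * ψ β x ∂ρ = 0) {c : κ → ℝ}
    (hc : ∀ α, ∫ x, G x * ψ α x ∂ρ = c α) :
    ∫ x, (G x - ∑ α ∈ s, c α * ψ α x) ^ 2 ∂ρ = ∫ x, G x ^ 2 ∂ρ - ∑ α ∈ s, c α ^ 2 := by
  have hS : MemLp (fun x => ∑ α ∈ s, c α * ψ α x) 2 ρ :=
    memLp_finsetSum s fun α _ => (hψ α).const_mul _
  have h1 : ∫ x, G x * ∑ α ∈ s, c α * ψ α x ∂ρ = ∑ α ∈ s, c α ^ 2 := by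
    simp only [Finset.mul_sum]
    have hi : ∀ α ∈ s, Integrable (fun x => G x * (c α * ψ α x)) ρ := fun α _ =>
      hG.integrable_mul ((hψ α).const_mul (c α))
    rw [integral_finsetSum s hi]
    refine Finset.sum_congr rfl fun α _ => ?_
    rw [sq]
    nth_rw 3 [← hc α]
    rw [← integral_const_mul]
    refine integral_congr_ae (ae_of_all _ fun x => ?_)
    simp only
    ring
  have e : ∀ x, (G x - ∑ α ∈ s, c α * ψ α x) ^ 2 =
      (G x ^ 2 + (∑ α ∈ s, c α * ψ α x) ^ 2) - 2 * (G x * ∑ α ∈ s, c α * ψ α x) := fun x => by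
    ring
  simp only [e]
  have i1 : Integrable (fun x => G x ^ 2 + (∑ α ∈ s, c α * ψ α x) ^ 2) ρ :=
    hG.integrable_sq.add hS.integrable_sq
  have i2 : Integrable (fun x => 2 * (G x * ∑ α ∈ s, c α * ψ α x)) ρ :=
    (hG.integrable_mul hS).const_mul 2
  rw [integral_sub i1 i2, integral_add hG.integrable_sq hS.integrable_sq, integral_const_mul, h1,
    integral_sum_orthonormal_sq s hψ hn ho c]
  ring

theorem measurable_lt_indicator : Measurable fun z : I × I => if z.1 < z.2 then (1 : ℝ) else 0 :=
  Measurable.ite (measurableSet_lt measurable_fst measurable_snd) measurable_const measurable_const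

theorem memLp_lt_indicator :
    MemLp (fun z : I × I => if z.1 < z.2 then (1 : ℝ) else 0) 2 (volume.prod volume) :=
  MemLp.of_bound measurable_lt_indicator.aestronglyMeasurable 1
    (ae_of_all _ fun z => by split_ifs <;> simp)

/-- The expansion `1_{t < u} = ∑_k (1/ω_k) (√2 cos ω_k t) (√2 sin ω_k u)` in `L²`. -/
theorem tendsto_integral_lt_sub_sq :
    Tendsto (fun s : Finset ℕ => ∫ z : I × I, ((if z.1 < z.2 then 1 else 0) -
      ∑ k ∈ s, 1 / freq k * (cosBasis k z.1 * sinBasis k z.2)) ^ 2 ∂(volume.prod volume))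
      atTop (𝓝 0) := by
  have hsq : ∫ z : I × I, (if z.1 < z.2 then (1 : ℝ) else 0) ^ 2 ∂(volume.prod volume) = 1 / 2 := by
    have e : ∀ z : I × I, (if z.1 < z.2 then (1 : ℝ) else 0) ^ 2 =
        (if z.1 < z.2 then (1 : ℝ) else 0) * 1 := fun z => by split_ifs <;> simp
    have hint : Integrable (fun z : I × I => (if z.1 < z.2 then (1 : ℝ) else 0) * 1)
        (volume.prod volume) := (memLp_lt_indicator.integrable one_le_two).mul_const _
    simp only [e]
    rw [integral_prod_symm _ hint]
    have h1 : ∀ u : I, ∫ t : I, (if t < u then (1 : ℝ) else 0) * 1 = (u : ℝ) := fun u => by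
      rw [integral_lt_mul (fun _ => 1)]
      simp
    simp only [h1]
    rw [integral_unitInterval fun u => u]
    simp
  have hc : ∀ k, ∫ z : I × I, (if z.1 < z.2 then (1 : ℝ) else 0) *
      (cosBasis k z.1 * sinBasis k z.2) ∂(volume.prod volume) = 1 / freq k := fun k => by
    have hint : Integrable (fun z : I × I => (if z.1 < z.2 then (1 : ℝ) else 0) *
        (cosBasis k z.1 * sinBasis k z.2)) (volume.prod volume) :=
      memLp_lt_indicator.integrable_mul (memLp_mul_prod (memLp_cosBasis k) (memLp_sinBasis k))
    rw [integral_prod_symm _ hint]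
    have h1 : ∀ u : I, ∫ t : I, (if t < u then (1 : ℝ) else 0) * (cosBasis k t * sinBasis k u) =
        1 / freq k * (sinBasis k u * sinBasis k u) := fun u => by
      rw [← mul_assoc, ← integral_lt_mul_cosBasis, ← integral_mul_const]
      simp only [mul_assoc]
    refine (integral_congr_ae (ae_of_all _ h1)).trans ?_
    rw [integral_const_mul, integral_sinBasis_mul, if_pos rfl, mul_one]
  -- By Bessel's identity the squared error is ½ minus a partial sum of 1/ω_k², and the full sum is
  -- ½. No completeness of the trigonometric system is needed.
  have h := fun s => integral_sub_sum_orthonormal_sq s memLp_lt_indicator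
    (fun k => memLp_mul_prod (memLp_cosBasis k) (memLp_sinBasis k))
    (fun k => by
      simp only [sq]
      rw [integral_prod_mul_mul, integral_cosBasis_mul, integral_sinBasis_mul]
      simp)
    (fun j k hjk => by
      simp only
      rw [integral_prod_mul_mul, integral_cosBasis_mul, if_neg hjk, zero_mul]) hc
  simp only [h, hsq]
  have h1 := hasSum_inv_freq_sq
  rw [HasSum, SummationFilter.unconditional_filter] at h1
  have h2 := h1.const_sub (1 / 2)
  rwa [sub_self] at h2

/-! ### Kernels with a bilinear expansion -/

section Rearrange

variable {α β : Type*} [MeasurableSpace α] [MeasurableSpace β] {μ : Measure α} {τ : Measure β}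
  [SFinite μ] [SFinite τ]

theorem measurePreserving_prodAssoc' {α β γ : Type*} [MeasurableSpace α] [MeasurableSpace β]
    [MeasurableSpace γ] (μ : Measure α) (τ : Measure β) (η : Measure γ) [SFinite μ] [SFinite τ]
    [SFinite η] : MeasurePreserving (MeasurableEquiv.prodAssoc : (α × β) × γ ≃ᵐ α × β × γ)
      ((μ.prod τ).prod η) (μ.prod (τ.prod η)) :=
  ⟨MeasurableEquiv.prodAssoc.measurable, Measure.prodAssoc_prod⟩

theorem measurePreserving_prod_comm_inner :
    MeasurePreserving (fun x : (α × α) × (β × β) => ((x.1.1, x.2.1), (x.1.2, x.2.2)))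
      ((μ.prod μ).prod (τ.prod τ)) ((μ.prod τ).prod (μ.prod τ)) := by
  have h1 := measurePreserving_prodAssoc' μ μ (τ.prod τ)
  have h2 := (MeasurePreserving.id μ).prod ((measurePreserving_prodAssoc' μ τ τ).symm)
  have h3 := (MeasurePreserving.id μ).prod
    ((Measure.measurePreserving_swap (μ := μ) (ν := τ)).prod (MeasurePreserving.id τ))
  have h4 := (MeasurePreserving.id μ).prod (measurePreserving_prodAssoc' τ μ τ)
  have h5 := (measurePreserving_prodAssoc' μ τ (μ.prod τ)).symm
  exact h5.comp (h4.comp (h3.comp (h2.comp h1)))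

theorem integral_mul_prod_prod {Φ : α × α → ℝ} {r : β × β → ℝ}
    (h : AEStronglyMeasurable (fun z : (α × β) × (α × β) => Φ (z.1.1, z.2.1) * r (z.1.2, z.2.2))
      ((μ.prod τ).prod (μ.prod τ))) :
    ∫ z, Φ (z.1.1, z.2.1) * r (z.1.2, z.2.2) ∂((μ.prod τ).prod (μ.prod τ)) =
      (∫ x, Φ x ∂(μ.prod μ)) * ∫ y, r y ∂(τ.prod τ) := by
  have hm := measurePreserving_prod_comm_inner (μ := μ) (τ := τ)
  rw [← integral_prod_mul, ← hm.map_eq, integral_map hm.aemeasurable (by rw [hm.map_eq]; exact h)]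

end Rearrange

/-! ### Explicit eigenfunctions on pairs with times -/

section Lift

variable {𝒳 : Type*} [MeasurableSpace 𝒳] {ν : Measure 𝒳} [IsProbabilityMeasure ν]

theorem integral_add_add {α : Type*} [MeasurableSpace α] {μ : Measure α} {a b c d : α → ℝ}
    (ha : Integrable a μ) (hb : Integrable b μ) (hc : Integrable c μ) (hd : Integrable d μ) :
    ∫ x, ((a x + b x) + (c x + d x)) ∂μ =
      ((∫ x, a x ∂μ) + ∫ x, b x ∂μ) + ((∫ x, c x ∂μ) + ∫ x, d x ∂μ) := by
  rw [← integral_add ha hb, ← integral_add hc hd]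
  exact integral_add (ha.add hb) (hc.add hd)

theorem IsCenteredOrthonormal.integral_mul {κ : Type*} {ψ : κ → 𝒳 → ℝ}
    (h : IsCenteredOrthonormal ν ψ) [DecidableEq κ] (α β : κ) :
    ∫ x, ψ α x * ψ β x ∂ν = if α = β then 1 else 0 := by
  split_ifs with hαβ
  · subst hαβ
    simpa only [sq] using h.norm α
  · exact h.orth hαβ

/-- The function `(a(x) + v a(x')) / √2` on pairs. -/
def pairLift (v : ℝ) (a : 𝒳 → ℝ) (z : 𝒳 × 𝒳) : ℝ := (√2)⁻¹ * (a z.1 + v * a z.2)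

theorem memLp_pairLift (v : ℝ) {a : 𝒳 → ℝ} (ha : MemLp a 2 ν) :
    MemLp (pairLift v a) 2 (ν.prod ν) :=
  ((ha.comp_fst ν).add ((ha.comp_snd ν).const_mul v)).const_mul _

theorem integral_pairLift (v : ℝ) {a : 𝒳 → ℝ} (ha : MemLp a 2 ν) (h0 : ∫ x, a x ∂ν = 0) :
    ∫ z, pairLift v a z ∂(ν.prod ν) = 0 := by
  unfold pairLift
  have i1 : Integrable (fun z : 𝒳 × 𝒳 => a z.1) (ν.prod ν) :=
    (ha.comp_fst ν).integrable one_le_two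
  have i2 : Integrable (fun z : 𝒳 × 𝒳 => v * a z.2) (ν.prod ν) :=
    ((ha.comp_snd ν).const_mul v).integrable one_le_two
  rw [integral_const_mul, integral_add i1 i2, integral_const_mul, integral_fun_fst,
    integral_fun_snd, h0]
  simp

/-- Centring removes the products of different coordinates. For v, w = ±1 the constant is 1 or 0, so
differences are orthogonal to sums, even those of the same function. -/
theorem integral_pairLift_mul (v w : ℝ) {a b : 𝒳 → ℝ} (ha : MemLp a 2 ν) (hb : MemLp b 2 ν)
    (ha0 : ∫ x, a x ∂ν = 0) (hb0 : ∫ x, b x ∂ν = 0) :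
    ∫ z, pairLift v a z * pairLift w b z ∂(ν.prod ν) =
      (1 + v * w) / 2 * ∫ x, a x * b x ∂ν := by
  have e : ∀ z : 𝒳 × 𝒳, pairLift v a z * pairLift w b z =
      1 / 2 * ((a z.1 * b z.1 + v * w * (a z.2 * b z.2)) +
        (w * (a z.1 * b z.2) + v * (b z.1 * a z.2))) := fun z => by
    have h2 : (√2 : ℝ)⁻¹ * (√2)⁻¹ = 1 / 2 := by
      rw [← mul_inv, Real.mul_self_sqrt two_pos.le, one_div]
    simp only [pairLift]
    linear_combination ((a z.1 + v * a z.2) * (b z.1 + w * b z.2)) * h2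
  have i1 : Integrable (fun z : 𝒳 × 𝒳 => a z.1 * b z.1) (ν.prod ν) :=
    (ha.comp_fst ν).integrable_mul (hb.comp_fst ν)
  have i2 : Integrable (fun z : 𝒳 × 𝒳 => v * w * (a z.2 * b z.2)) (ν.prod ν) :=
    ((ha.comp_snd ν).integrable_mul (hb.comp_snd ν)).const_mul _
  have i3 : Integrable (fun z : 𝒳 × 𝒳 => w * (a z.1 * b z.2)) (ν.prod ν) :=
    ((ha.comp_fst ν).integrable_mul (hb.comp_snd ν)).const_mul _
  have i4 : Integrable (fun z : 𝒳 × 𝒳 => v * (b z.1 * a z.2)) (ν.prod ν) :=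
    ((hb.comp_fst ν).integrable_mul (ha.comp_snd ν)).const_mul _
  simp only [e]
  rw [integral_const_mul, integral_add_add i1 i2 i3 i4, integral_const_mul, integral_const_mul, integral_const_mul,
    integral_prod_mul, integral_prod_mul, ha0, hb0, integral_fun_fst (fun x => a x * b x),
    integral_fun_snd (fun x => a x * b x)]
  simp
  ring

/-- The eigenfunctions on pairs with times that diagonalize the kernel of `p ⊗ q`. -/
def areaBasis {β : Type*} (p q : β → 𝒳 → ℝ) (α : (β × ℕ) × Bool) (z : (𝒳 × 𝒳) × I) : ℝ :=
  (√2)⁻¹ * (pairLift (-1) (p α.1.1) z.1 * cosBasis α.1.2 z.2 +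
    (if α.2 then 1 else -1) * (pairLift 1 (q α.1.1) z.1 * sinBasis α.1.2 z.2))

variable {β : Type*} {p q : β → 𝒳 → ℝ}

theorem memLp_pairLift_cosBasis (v : ℝ) {a : 𝒳 → ℝ} (ha : MemLp a 2 ν) (k : ℕ) :
    MemLp (fun z : (𝒳 × 𝒳) × I => pairLift v a z.1 * cosBasis k z.2) 2
      ((ν.prod ν).prod (volume : Measure I)) :=
  memLp_mul_prod (memLp_pairLift v ha) (memLp_cosBasis k)

theorem memLp_pairLift_sinBasis (v : ℝ) {a : 𝒳 → ℝ} (ha : MemLp a 2 ν) (k : ℕ) :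
    MemLp (fun z : (𝒳 × 𝒳) × I => pairLift v a z.1 * sinBasis k z.2) 2
      ((ν.prod ν).prod (volume : Measure I)) :=
  memLp_mul_prod (memLp_pairLift v ha) (memLp_sinBasis k)

/-- Neither are the cosines orthogonal to the sines, nor is p assumed orthogonal to q. The mixed
terms vanish because p is lifted to a difference and q to a sum on pairs. -/
theorem isCenteredOrthonormal_areaBasis (hp : IsCenteredOrthonormal ν p)
    (hq : IsCenteredOrthonormal ν q) :
    IsCenteredOrthonormal ((ν.prod ν).prod (volume : Measure I)) (areaBasis p q) := by
  classical
  have mA := fun α : (β × ℕ) × Bool => memLp_pairLift_cosBasis (-1) (hp.memLp α.1.1) α.1.2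
  have mB := fun α : (β × ℕ) × Bool => memLp_pairLift_sinBasis 1 (hq.memLp α.1.1) α.1.2
  have iA : ∀ α : (β × ℕ) × Bool, ∫ z, pairLift (-1) (p α.1.1) z.1 * cosBasis α.1.2 z.2
      ∂((ν.prod ν).prod (volume : Measure I)) = 0 := fun α => by
    rw [integral_prod_mul, integral_pairLift _ (hp.memLp _) (hp.mean _), zero_mul]
  have iB : ∀ α : (β × ℕ) × Bool, ∫ z, pairLift 1 (q α.1.1) z.1 * sinBasis α.1.2 z.2
      ∂((ν.prod ν).prod (volume : Measure I)) = 0 := fun α => by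
    rw [integral_prod_mul, integral_pairLift _ (hq.memLp _) (hq.mean _), zero_mul]
  have key : ∀ α α' : (β × ℕ) × Bool, ∫ z, areaBasis p q α z * areaBasis p q α' z
      ∂((ν.prod ν).prod (volume : Measure I)) = if α = α' then 1 else 0 := fun α α' => by
    set ε : ℝ := if α.2 then 1 else -1 with hε
    set ε' : ℝ := if α'.2 then 1 else -1 with hε'
    have e : ∀ z : (𝒳 × 𝒳) × I, areaBasis p q α z * areaBasis p q α' z =
        1 / 2 * (((pairLift (-1) (p α.1.1) z.1 * pairLift (-1) (p α'.1.1) z.1) *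
            (cosBasis α.1.2 z.2 * cosBasis α'.1.2 z.2) +
          ε * ε' * ((pairLift 1 (q α.1.1) z.1 * pairLift 1 (q α'.1.1) z.1) *
            (sinBasis α.1.2 z.2 * sinBasis α'.1.2 z.2))) +
          (ε' * ((pairLift (-1) (p α.1.1) z.1 * pairLift 1 (q α'.1.1) z.1) *
            (cosBasis α.1.2 z.2 * sinBasis α'.1.2 z.2)) +
          ε * ((pairLift 1 (q α.1.1) z.1 * pairLift (-1) (p α'.1.1) z.1) *
            (sinBasis α.1.2 z.2 * cosBasis α'.1.2 z.2)))) := fun z => by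
      have h2 : (√2 : ℝ)⁻¹ * (√2)⁻¹ = 1 / 2 := by
        rw [← mul_inv, Real.mul_self_sqrt two_pos.le, one_div]
      simp only [areaBasis, ← hε, ← hε']
      rw [mul_mul_mul_comm, h2]
      ring
    have m : ∀ {φ χ : 𝒳 × 𝒳 → ℝ} {θ θ' : I → ℝ},
        MemLp (fun z : (𝒳 × 𝒳) × I => φ z.1 * θ z.2) 2 ((ν.prod ν).prod (volume : Measure I)) →
        MemLp (fun z : (𝒳 × 𝒳) × I => χ z.1 * θ' z.2) 2 ((ν.prod ν).prod (volume : Measure I)) →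
        Integrable (fun z : (𝒳 × 𝒳) × I => (φ z.1 * χ z.1) * (θ z.2 * θ' z.2))
          ((ν.prod ν).prod (volume : Measure I)) := fun {φ χ θ θ'} h h' => by
      refine (h.integrable_mul h').congr (ae_of_all _ fun z => ?_)
      simp only [Pi.mul_apply]
      ring
    have j1 := m (mA α) (mA α')
    have j2 := (m (mB α) (mB α')).const_mul (ε * ε')
    have j3 := (m (mA α) (mB α')).const_mul ε'
    have j4 := (m (mB α) (mA α')).const_mul ε
    have pm : ∀ (φ : 𝒳 × 𝒳 → ℝ) (θ : I → ℝ), ∫ z : (𝒳 × 𝒳) × I, φ z.1 * θ z.2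
        ∂((ν.prod ν).prod (volume : Measure I)) = (∫ z, φ z ∂(ν.prod ν)) * ∫ t, θ t :=
      fun φ θ => integral_prod_mul φ θ
    have z1 := integral_pairLift_mul (-1) (-1) (hp.memLp α.1.1) (hp.memLp α'.1.1) (hp.mean _)
      (hp.mean _)
    have z2 := integral_pairLift_mul 1 1 (hq.memLp α.1.1) (hq.memLp α'.1.1) (hq.mean _)
      (hq.mean _)
    have z3 := integral_pairLift_mul (-1) 1 (hp.memLp α.1.1) (hq.memLp α'.1.1) (hp.mean _)
      (hq.mean _)
    have z4 := integral_pairLift_mul 1 (-1) (hq.memLp α.1.1) (hp.memLp α'.1.1) (hq.mean _)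
      (hp.mean _)
    simp only [e]
    rw [integral_const_mul, integral_add_add j1 j2 j3 j4, integral_const_mul, integral_const_mul, integral_const_mul,
      pm (fun z => pairLift (-1) (p α.1.1) z * pairLift (-1) (p α'.1.1) z)
        fun t => cosBasis α.1.2 t * cosBasis α'.1.2 t,
      pm (fun z => pairLift 1 (q α.1.1) z * pairLift 1 (q α'.1.1) z)
        fun t => sinBasis α.1.2 t * sinBasis α'.1.2 t,
      pm (fun z => pairLift (-1) (p α.1.1) z * pairLift 1 (q α'.1.1) z)
        fun t => cosBasis α.1.2 t * sinBasis α'.1.2 t,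
      pm (fun z => pairLift 1 (q α.1.1) z * pairLift (-1) (p α'.1.1) z)
        fun t => sinBasis α.1.2 t * cosBasis α'.1.2 t, z1, z2, z3, z4,
      integral_cosBasis_mul, integral_sinBasis_mul, hp.integral_mul, hq.integral_mul]
    obtain ⟨⟨b, k⟩, s⟩ := α
    obtain ⟨⟨b', k'⟩, s'⟩ := α'
    simp only [hε, hε']
    by_cases h1 : b = b' <;> by_cases h2 : k = k' <;> cases s <;> cases s' <;>
      simp [h1, h2] <;> norm_num
  refine ⟨fun α => ((mA α).add ((mB α).const_mul _)).const_mul _, fun α => ?_, fun α => ?_,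
    fun α α' h => ?_⟩
  · unfold areaBasis
    rw [integral_const_mul, integral_add ((mA α).integrable one_le_two)
      (((mB α).const_mul _).integrable one_le_two), integral_const_mul, iA, iB]
    simp
  · simp only [sq]
    rw [key, if_pos rfl]
  · simp only
    rw [key, if_neg h]

end Lift

/-! ### Alternating statistics of kernels with a bilinear expansion -/

section Bilinear

variable {𝒳 : Type*} [MeasurableSpace 𝒳] {ν : Measure 𝒳} [IsProbabilityMeasure ν]

/-- The products p_α ⊗ q_α are orthonormal in L² of the square. Unconditional convergence is secured
in this way first; the limit is then identified by grouping terms. -/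
theorem IsCenteredOrthonormal.summable_toLp {𝒴 κ : Type*} [MeasurableSpace 𝒴] {ρ : Measure 𝒴}
    [IsProbabilityMeasure ρ] {p q : κ → 𝒴 → ℝ} (hp : IsCenteredOrthonormal ρ p)
    (hq : IsCenteredOrthonormal ρ q) {c : κ → ℝ} (hc : Summable fun α => c α ^ 2)
    (hF : ∀ α, MemLp (fun z : 𝒴 × 𝒴 => c α * (p α z.1 * q α z.2)) 2 (ρ.prod ρ)) :
    Summable fun α => (hF α).toLp _ := by
  classical
  let e : ∀ {ψ : κ → 𝒴 → ℝ}, IsCenteredOrthonormal ρ ψ → κ → Lp ℝ 2 ρ :=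
    fun {ψ} h α => (h.memLp α).toLp (ψ α)
  have hee : ∀ {ψ : κ → 𝒴 → ℝ} (h : IsCenteredOrthonormal ρ ψ), ∀ α β,
      inner ℝ (e h α) (e h β) = if α = β then (1 : ℝ) else 0 := fun {ψ} h α β => by
    rw [inner_lp_eq_integral, ← h.integral_mul α β]
    refine integral_congr_ae ?_
    filter_upwards [(h.memLp α).coeFn_toLp, (h.memLp β).coeFn_toLp] with x h1 h2
    rw [h1, h2]
  have hv : Orthonormal ℝ fun α => tens (e hp α) (e hq α) := by
    rw [orthonormal_iff_ite]
    intro α β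
    rw [inner_tens, hee hq, hee hp]
    by_cases hαβ : α = β
    · simp [hαβ]
    · simp [hαβ]
  have hs : Summable fun α => c α • tens (e hp α) (e hq α) :=
    (hv.orthogonalFamily.summable_iff_norm_sq_summable c).2 (by simpa using hc)
  convert hs using 2 with α
  apply Lp.ext
  refine (hF α).coeFn_toLp.trans (EventuallyEq.trans ?_ (Lp.coeFn_smul _ _).symm)
  have h1 := (Measure.quasiMeasurePreserving_fst (μ := ρ) (ν := ρ)).ae_eq_comp
    (hp.memLp α).coeFn_toLp
  have h2 := (Measure.quasiMeasurePreserving_snd (μ := ρ) (ν := ρ)).ae_eq_comp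
    (hq.memLp α).coeFn_toLp
  filter_upwards [coeFn_tens (e hp α) (e hq α), h1, h2] with z hz h3 h4
  simp only [Function.comp_apply] at h3 h4
  rw [Pi.smul_apply, hz]
  simp only [e]
  rw [h3, h4]
  simp

/-- For a product kernel, `pairKernel` factors as (a(x) - a(x'))(b(y) + b(y')), which is twice a
product of lifts. -/
theorem half_hatKernel_pairKernel_mul (a b : 𝒳 → ℝ) (z w : (𝒳 × 𝒳) × I) :
    1 / 2 * hatKernel (pairKernel fun x y => a x * b y) z w =
      pairLift (-1) a z.1 * pairLift 1 b w.1 * (if z.2 < w.2 then 1 else 0) +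
        pairLift (-1) a w.1 * pairLift 1 b z.1 * (if w.2 < z.2 then 1 else 0) := by
  have h2 : (√2 : ℝ)⁻¹ * (√2)⁻¹ = 1 / 2 := by
    rw [← mul_inv, Real.mul_self_sqrt two_pos.le, one_div]
  rw [hatKernel_eq]
  simp only [pairKernel, pairLift]
  linear_combination (-((a z.1.1 - a z.1.2) * (b w.1.1 + b w.1.2) * if z.2 < w.2 then 1 else 0) -
    (a w.1.1 - a w.1.2) * (b z.1.1 + b z.1.2) * if w.2 < z.2 then 1 else 0) * h2

theorem memLp_tensor_time {A C : 𝒳 × 𝒳 → ℝ} (hA : MemLp A 2 (ν.prod ν))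
    (hC : MemLp C 2 (ν.prod ν)) {r : I × I → ℝ} (hr : MemLp r 2 (volume.prod volume)) :
    MemLp (fun z : ((𝒳 × 𝒳) × I) × ((𝒳 × 𝒳) × I) => A z.1.1 * C z.2.1 * r (z.1.2, z.2.2)) 2
      (((ν.prod ν).prod (volume : Measure I)).prod ((ν.prod ν).prod (volume : Measure I))) := by
  have h := (memLp_mul_prod (memLp_mul_prod hA hC) hr)
  have hm := measurePreserving_prod_comm_inner (μ := ν.prod ν) (τ := (volume : Measure I))
  rw [← hm.map_eq, memLp_map_measure_iff _ hm.aemeasurable]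
  · exact h
  · rw [hm.map_eq]
    have h1 : AEStronglyMeasurable (fun z : ((𝒳 × 𝒳) × I) × ((𝒳 × 𝒳) × I) => A z.1.1 * C z.2.1)
        (((ν.prod ν).prod (volume : Measure I)).prod ((ν.prod ν).prod (volume : Measure I))) :=
      (hA.1.comp_fst.comp_fst).mul (hC.1.comp_fst.comp_snd)
    refine h1.mul ?_
    have h2 : MeasurePreserving (Prod.map Prod.snd Prod.snd)
      (((ν.prod ν).prod (volume : Measure I)).prod ((ν.prod ν).prod (volume : Measure I)))
      ((volume : Measure I).prod (volume : Measure I)) :=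
      measurePreserving_snd.prod measurePreserving_snd
    exact hr.1.comp_measurePreserving h2

/-- The squared error factors into an integral over pairs, which is fixed, and the error of the
expansion of the indicator. -/
theorem tendsto_integral_tensor_lt_sub_sq {A C : 𝒳 × 𝒳 → ℝ} (hA : MemLp A 2 (ν.prod ν))
    (hC : MemLp C 2 (ν.prod ν)) :
    Tendsto (fun s : Finset ℕ => ∫ z : ((𝒳 × 𝒳) × I) × ((𝒳 × 𝒳) × I),
      (A z.1.1 * C z.2.1 * (if z.1.2 < z.2.2 then 1 else 0) -
        ∑ k ∈ s, 1 / freq k * ((A z.1.1 * cosBasis k z.1.2) * (C z.2.1 * sinBasis k z.2.2))) ^ 2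
      ∂(((ν.prod ν).prod (volume : Measure I)).prod ((ν.prod ν).prod (volume : Measure I))))
      atTop (𝓝 0) := by
  have h := tendsto_integral_lt_sub_sq.const_mul
    (∫ x : (𝒳 × 𝒳) × (𝒳 × 𝒳), (A x.1 * C x.2) ^ 2 ∂((ν.prod ν).prod (ν.prod ν)))
  rw [mul_zero] at h
  refine h.congr fun s => ?_
  have hr : MemLp (fun z : I × I => (if z.1 < z.2 then (1 : ℝ) else 0) -
      ∑ k ∈ s, 1 / freq k * (cosBasis k z.1 * sinBasis k z.2)) 2 (volume.prod volume) :=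
    memLp_lt_indicator.sub (memLp_finsetSum s fun k _ =>
      (memLp_mul_prod (memLp_cosBasis k) (memLp_sinBasis k)).const_mul _)
  have hm := (memLp_tensor_time hA hC hr).1.pow 2
  have e := integral_mul_prod_prod (μ := ν.prod ν) (τ := (volume : Measure I))
    (Φ := fun x => (A x.1 * C x.2) ^ 2) (r := fun z => ((if z.1 < z.2 then (1 : ℝ) else 0) -
      ∑ k ∈ s, 1 / freq k * (cosBasis k z.1 * sinBasis k z.2)) ^ 2)
    (hm.congr (ae_of_all _ fun z => by simp only [Pi.pow_apply, mul_pow]))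
  rw [← e]
  refine integral_congr_ae (ae_of_all _ fun z => ?_)
  simp only
  rw [← mul_pow, mul_sub, Finset.mul_sum]
  congr 3
  funext k
  ring

/-- The law of `ν` on pairs with times. -/
abbrev pairTime (ν : Measure 𝒳) : Measure ((𝒳 × 𝒳) × I) := (ν.prod ν).prod volume

/-- The part of the kernel where t < u is expanded directly, and the part where u < t is its image
under exchanging the two points. -/
theorem hasSum_half_hatKernel_mul {a b : 𝒳 → ℝ} (ha : MemLp a 2 ν) (hb : MemLp b 2 ν)
    (d : ℝ) {H : ℕ → ((𝒳 × 𝒳) × I) × ((𝒳 × 𝒳) × I) → ℝ} {K : ((𝒳 × 𝒳) × I) × ((𝒳 × 𝒳) × I) → ℝ}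
    (hHe : ∀ k z, H k z = d * (1 / freq k) *
      ((pairLift (-1) a z.1.1 * cosBasis k z.1.2) * (pairLift 1 b z.2.1 * sinBasis k z.2.2) +
        (pairLift (-1) a z.2.1 * cosBasis k z.2.2) * (pairLift 1 b z.1.1 * sinBasis k z.1.2)))
    (hKe : ∀ z, K z = 1 / 2 * hatKernel (pairKernel fun x y => d * (a x * b y)) z.1 z.2)
    (hH : ∀ k, MemLp (H k) 2 ((pairTime ν).prod (pairTime ν)))
    (hK : MemLp K 2 ((pairTime ν).prod (pairTime ν))) :
    HasSum (fun k => (hH k).toLp (H k)) (hK.toLp K) := by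
  have hA := memLp_pairLift (-1) ha
  have hC := memLp_pairLift 1 hb
  have hA' := (hA.const_mul d)
  have hF1 := fun k => (memLp_mul_prod (memLp_mul_prod hA' (memLp_cosBasis k))
    (memLp_mul_prod hC (memLp_sinBasis k))).const_mul (1 / freq k)
  have hG1 := memLp_tensor_time hA' hC memLp_lt_indicator
  have hT := tendsto_integral_tensor_lt_sub_sq hA' hC
  have h1 := hasSum_of_tendsto_integral_sq hF1 hG1 hT
  have hsw := Measure.measurePreserving_swap (μ := pairTime ν) (ν := pairTime ν)
  have hF2 := fun k => (hF1 k).comp_measurePreserving hsw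
  have hG2 := hG1.comp_measurePreserving hsw
  have h2 := hasSum_of_tendsto_integral_sq hF2 hG2 (hT.congr fun s =>
    (integral_prod_swap (μ := pairTime ν) (ν := pairTime ν) _).symm)
  have h3 := h1.add h2
  convert h3 using 1
  · funext k
    rw [← MemLp.toLp_add]
    refine MemLp.toLp_congr _ _ (ae_of_all _ fun z => ?_)
    simp only [hHe, Pi.add_apply, Function.comp_apply, Prod.fst_swap, Prod.snd_swap]
    ring
  · rw [← MemLp.toLp_add]
    refine MemLp.toLp_congr _ _ (ae_of_all _ fun z => ?_)
    have e : (fun x y => d * (a x * b y)) = fun x y => (d * a x) * b y := by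
      funext x y
      ring
    rw [hKe, e, half_hatKernel_pairKernel_mul (fun x => d * a x) b]
    simp only [Pi.add_apply, Function.comp_apply, Prod.fst_swap, Prod.snd_swap, pairLift]
    ring

theorem hatKernel_pairKernel_sub_sum {κ : Type*} (g : 𝒳 → 𝒳 → ℝ) (h : κ → 𝒳 → 𝒳 → ℝ)
    (s : Finset κ) (z w : (𝒳 × 𝒳) × I) :
    hatKernel (pairKernel fun x y => g x y - ∑ α ∈ s, h α x y) z w =
      hatKernel (pairKernel g) z w - ∑ α ∈ s, hatKernel (pairKernel (h α)) z w := by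
  simp only [hatKernel_eq, pairKernel, Finset.sum_add_distrib, ← Finset.sum_mul,
    Finset.sum_sub_distrib]
  ring

/-- Passing to the kernel on pairs with times is linear and, by `integral_hat_pairKernel_sq`,
isometric on degenerate kernels, so the truncation errors are equal. -/
theorem hasSum_half_hatKernel {g : 𝒳 → 𝒳 → ℝ} (hm : Measurable (Function.uncurry g))
    (hg : MemLp (Function.uncurry g) 2 (ν.prod ν)) (hd : IsDegenerate ν g) {β : Type*}
    {p q : β → 𝒳 → ℝ} (hp : IsCenteredOrthonormal ν p) (hq : IsCenteredOrthonormal ν q)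
    (hpm : ∀ b, Measurable (p b)) (hqm : ∀ b, Measurable (q b)) (d : β → ℝ)
    (hlim : Tendsto (fun s : Finset β => ∫ z, (g z.1 z.2 -
      ∑ b ∈ s, d b * (p b z.1 * q b z.2)) ^ 2 ∂(ν.prod ν)) atTop (𝓝 0))
    (hF : ∀ b, MemLp (fun z : ((𝒳 × 𝒳) × I) × ((𝒳 × 𝒳) × I) =>
      1 / 2 * hatKernel (pairKernel fun x y => d b * (p b x * q b y)) z.1 z.2) 2
        ((pairTime ν).prod (pairTime ν)))
    (hG : MemLp (fun z : ((𝒳 × 𝒳) × I) × ((𝒳 × 𝒳) × I) =>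
      1 / 2 * hatKernel (pairKernel g) z.1 z.2) 2 ((pairTime ν).prod (pairTime ν))) :
    HasSum (fun b => (hF b).toLp _) (hG.toLp _) := by
  refine hasSum_of_tendsto_integral_sq hF hG (hlim.congr fun s => ?_)
  have hS := memLp_sum_mul s hp.memLp hq.memLp d
  have hSd := isDegenerate_sum s hp.memLp hp.mean hq.memLp hq.mean d
  have hSm : Measurable (Function.uncurry fun x y => ∑ b ∈ s, d b * (p b x * q b y)) :=
    Finset.measurable_fun_sum s fun b _ =>
      (((hpm b).comp measurable_fst).mul ((hqm b).comp measurable_snd)).const_mul _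
  have h := integral_hat_pairKernel_sq (ν := ν)
    (g := fun x y => g x y - ∑ b ∈ s, d b * (p b x * q b y)) (hm.sub hSm) (hg.sub hS)
    (hd.sub hSd hg hS)
  rw [← h]
  refine integral_congr_ae (ae_of_all _ fun z => ?_)
  simp only
  rw [hatKernel_pairKernel_sub_sum g (fun b x y => d b * (p b x * q b y)), mul_sub,
    Finset.mul_sum]

end Bilinear

/-! ### Eigenvalues and limit law for kernels with a bilinear expansion -/

section Bilinear

variable {𝒳 : Type*} [MeasurableSpace 𝒳] {ν : Measure 𝒳} [IsProbabilityMeasure ν]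
  {β : Type} {p q : β → 𝒳 → ℝ} {d : β → ℝ}

/-- The eigenvalues that go with `areaBasis`. -/
def areaCoeff (d : β → ℝ) (α : (β × ℕ) × Bool) : ℝ :=
  (if α.2 then 1 else -1) * (d α.1.1 * (1 / freq α.1.2))

theorem summable_areaCoeff_sq (hd : Summable fun b => d b ^ 2) :
    Summable fun α => areaCoeff d α ^ 2 := by
  have h1 : Summable fun x : β × ℕ => d x.1 ^ 2 * (1 / freq x.2) ^ 2 :=
    hd.mul_of_nonneg hasSum_inv_freq_sq.summable (fun _ => sq_nonneg _) fun _ => sq_nonneg _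
  have h2 : Summable fun x : (β × ℕ) × Bool => (d x.1.1 ^ 2 * (1 / freq x.1.2) ^ 2) * 1 :=
    h1.mul_of_nonneg (g := fun _ : Bool => (1 : ℝ)) (hasSum_fintype _).summable
      (fun _ => by positivity) fun _ => zero_le_one
  refine h2.congr fun α => ?_
  rw [areaCoeff]
  split_ifs <;> ring

/-- Convergence follows from the existence of the random series. The value is found by multiplying
over the sign, then over the frequency by `hasProd_half_area` at the argument d_b t, then over b. -/
theorem hasProd_areaCoeff (hd : Summable fun b => d b ^ 2) {t : ℝ} {z : ℂ}
    (hz : HasProd (fun b => ((1 / √(Real.cosh (d b * t)) : ℝ) : ℂ)) z) :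
    HasProd (fun α => quadChar (areaCoeff d α * t)) z := by
  obtain ⟨P', _, ζ, W, -, -, -, -, -, h⟩ := exists_quadratic_sum (summable_areaCoeff_sq hd)
  have h1 := hasProd_of_hasProd_bool (c := fun x : β × ℕ => d x.1 * (1 / freq x.2)) (h t)
  have h2 := h1.prod_fiberwise fun b => ((hasProd_half_area (d b * t)).congr_fun fun k => by
    simp only
    rw [show 1 / freq k * (d b * t) = d b * (1 / freq k) * t by ring])
  rw [← h2.unique hz]
  exact h t

/-- The full series converges because the basis is orthonormal. Summing it over the sign leaves the
mixed cosine–sine products, the sum over frequencies rebuilds the kernel of a single d_b p_b ⊗ q_b,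
and the sum over b is the kernel of g; uniqueness of fibrewise sums identifies the limit. -/
theorem tendsto_integral_areaBasis {g : 𝒳 → 𝒳 → ℝ} (hm : Measurable (Function.uncurry g))
    (hg : MemLp (Function.uncurry g) 2 (ν.prod ν)) (hgd : IsDegenerate ν g)
    (hp : IsCenteredOrthonormal ν p) (hq : IsCenteredOrthonormal ν q)
    (hpm : ∀ b, Measurable (p b)) (hqm : ∀ b, Measurable (q b)) (hd : Summable fun b => d b ^ 2)
    (hlim : Tendsto (fun s : Finset β => ∫ z, (g z.1 z.2 -
      ∑ b ∈ s, d b * (p b z.1 * q b z.2)) ^ 2 ∂(ν.prod ν)) atTop (𝓝 0)) :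
    Tendsto (fun s : Finset ((β × ℕ) × Bool) => ∫ z, (1 / 2 * hatKernel (pairKernel g) z.1 z.2 -
      ∑ α ∈ s, areaCoeff d α * (areaBasis p q α z.1 * areaBasis p q α z.2)) ^ 2
        ∂((pairTime ν).prod (pairTime ν))) atTop (𝓝 0) := by
  have hψ := isCenteredOrthonormal_areaBasis hp hq
  have hF := fun α => (memLp_mul_prod (hψ.memLp α) (hψ.memLp α)).const_mul (areaCoeff d α)
  have hK : ∀ {f : 𝒳 → 𝒳 → ℝ}, MemLp (Function.uncurry f) 2 (ν.prod ν) →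
      MemLp (fun z : ((𝒳 × 𝒳) × I) × ((𝒳 × 𝒳) × I) =>
        1 / 2 * hatKernel (pairKernel f) z.1 z.2) 2 ((pairTime ν).prod (pairTime ν)) :=
    fun hf => (memLp_hatKernel (memLp_pairKernel hf)).const_mul (1 / 2)
  have hB := fun b => hK (f := fun x y => d b * (p b x * q b y)) ((memLp_mul_prod (hp.memLp b) (hq.memLp b)).const_mul (d b))
  refine tendsto_integral_sq_of_hasSum hF (hK hg) ?_
  obtain ⟨S, hS⟩ := hψ.summable_toLp hψ (summable_areaCoeff_sq hd) hF
  have hH : ∀ (b : β) (k : ℕ), MemLp (fun z : ((𝒳 × 𝒳) × I) × ((𝒳 × 𝒳) × I) =>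
      d b * (1 / freq k) *
      ((pairLift (-1) (p b) z.1.1 * cosBasis k z.1.2) * (pairLift 1 (q b) z.2.1 * sinBasis k z.2.2)
      + (pairLift (-1) (p b) z.2.1 * cosBasis k z.2.2) *
        (pairLift 1 (q b) z.1.1 * sinBasis k z.1.2))) 2 ((pairTime ν).prod (pairTime ν)) := by
    intro b k
    have h1 := memLp_mul_prod (memLp_pairLift_cosBasis (-1) (hp.memLp b) k)
      (memLp_pairLift_sinBasis 1 (hq.memLp b) k)
    have h2 := memLp_mul_prod (memLp_pairLift_sinBasis 1 (hq.memLp b) k)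
      (memLp_pairLift_cosBasis (-1) (hp.memLp b) k)
    refine ((h1.add h2).const_mul (d b * (1 / freq k))).ae_eq (ae_of_all _ fun z => ?_)
    simp only [Pi.add_apply]
    ring
  have s1 : HasSum (fun x : β × ℕ => (hH x.1 x.2).toLp _) S := by
    refine hS.prod_fiberwise fun x => ?_
    have h1 := hasSum_fintype fun s : Bool => (hF (x, s)).toLp _
    convert h1 using 1
    rw [Fintype.sum_bool, ← MemLp.toLp_add]
    refine MemLp.toLp_congr _ _ (ae_of_all _ fun z => ?_)
    have h2 : (√2 : ℝ)⁻¹ * (√2)⁻¹ = 1 / 2 := by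
      rw [← mul_inv, Real.mul_self_sqrt two_pos.le, one_div]
    simp only [Pi.add_apply, areaCoeff, areaBasis, if_true, Bool.false_eq_true, if_false]
    set A := pairLift (-1) (p x.1) z.1.1 * cosBasis x.2 z.1.2
    set A' := pairLift (-1) (p x.1) z.2.1 * cosBasis x.2 z.2.2
    set C := pairLift 1 (q x.1) z.1.1 * sinBasis x.2 z.1.2
    set C' := pairLift 1 (q x.1) z.2.1 * sinBasis x.2 z.2.2
    linear_combination (-(2 * (d x.1 * (1 / freq x.2)) * (A * C' + A' * C))) * h2
  have s2 := s1.prod_fiberwise fun b => hasSum_half_hatKernel_mul (hp.memLp b) (hq.memLp b) (d b)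
    (fun _ _ => rfl) (fun _ => rfl) (hH b) (hB b)
  have s3 := hasSum_half_hatKernel hm hg hgd hp hq hpm hqm d hlim hB (hK hg)
  rw [← s2.unique s3]
  exact hS

/-- The limit law of the alternating statistic of a degenerate kernel with a bilinear expansion
in two orthonormal systems. -/
theorem tendsto_charFun_alternating_bilinear {Ω : Type*} [MeasurableSpace Ω] {P : Measure Ω}
    [IsProbabilityMeasure P] {X : ℕ → Ω → 𝒳} (h : IsIID X ν P)
    {g : 𝒳 → 𝒳 → ℝ} (hm : Measurable (Function.uncurry g))
    (hg : MemLp (Function.uncurry g) 2 (ν.prod ν)) (hgd : IsDegenerate ν g)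
    (hp : IsCenteredOrthonormal ν p) (hq : IsCenteredOrthonormal ν q)
    (hpm : ∀ b, Measurable (p b)) (hqm : ∀ b, Measurable (q b)) (hd : Summable fun b => d b ^ 2)
    (hlim : Tendsto (fun s : Finset β => ∫ z, (g z.1 z.2 -
      ∑ b ∈ s, d b * (p b z.1 * q b z.2)) ^ 2 ∂(ν.prod ν)) atTop (𝓝 0)) {t : ℝ} {z : ℂ}
    (hz : HasProd (fun b => ((1 / √(Real.cosh (d b * t)) : ℝ) : ℂ)) z) :
    Tendsto (fun n : ℕ => charFun (P.map fun ω => ∑ p ∈ pairs n,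
      ((n : ℝ)⁻¹ * (-1 : ℝ) ^ p.2) * g (X p.2 ω) (X p.1 ω)) t) atTop (𝓝 z) :=
  tendsto_charFun_alternating h hm hg hgd (isCenteredOrthonormal_areaBasis hp hq) _
    (tendsto_integral_areaBasis hm hg hgd hp hq hpm hqm hd hlim) (hasProd_areaCoeff hd hz)

end Bilinear

/-! ### The Hoeffding decomposition of the alternating statistic -/

section Hoeffding

variable {𝒳 : Type*} [MeasurableSpace 𝒳] {ν : Measure 𝒳} [IsProbabilityMeasure ν]
  {f : 𝒳 → 𝒳 → ℝ}

theorem measurable_hoeffding₁ (hm : Measurable (Function.uncurry f)) :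
    Measurable (hoeffding₁ ν f) :=
  (hm.stronglyMeasurable.integral_prod_right (ν := ν)).measurable.sub_const _

theorem measurable_hoeffding₂ (hm : Measurable (Function.uncurry f)) :
    Measurable (hoeffding₂ ν f) :=
  (hm.stronglyMeasurable.integral_prod_left (μ := ν)).measurable.sub_const _

theorem measurable_hoeffding₁₂ (hm : Measurable (Function.uncurry f)) :
    Measurable (Function.uncurry (hoeffding₁₂ ν f)) :=
  ((hm.sub ((measurable_hoeffding₁ hm).comp measurable_fst)).sub
    ((measurable_hoeffding₂ hm).comp measurable_snd)).sub_const _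

theorem integral_hoeffding₁ (hf : MemLp (Function.uncurry f) 2 (ν.prod ν)) :
    ∫ x, hoeffding₁ ν f x ∂ν = 0 := by
  have hi := hf.integrable one_le_two
  have h1 := hi.integral_prod_left
  have h2 := integral_prod _ hi
  simp only [Function.uncurry_apply_pair] at h1 h2
  unfold hoeffding₁
  rw [integral_sub h1 (integrable_const _), ← h2, integral_const]
  simp [hoeffdingMean, Function.uncurry_def]

theorem integral_hoeffding₂ (hf : MemLp (Function.uncurry f) 2 (ν.prod ν)) :
    ∫ x, hoeffding₂ ν f x ∂ν = 0 := by
  have hi := hf.integrable one_le_two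
  have h1 := hi.integral_prod_right
  have h2 := integral_prod_symm _ hi
  simp only [Function.uncurry_apply_pair] at h1 h2
  unfold hoeffding₂
  rw [integral_sub h1 (integrable_const _), ← h2, integral_const]
  simp [hoeffdingMean, Function.uncurry_def]

theorem isDegenerate_hoeffding₁₂ (hf : MemLp (Function.uncurry f) 2 (ν.prod ν)) :
    IsDegenerate ν (hoeffding₁₂ ν f) := by
  have i1 := (memLp_hoeffding₁ hf).integrable one_le_two
  have i2 := (memLp_hoeffding₂ hf).integrable one_le_two
  constructor
  · filter_upwards [ae_memLp_section (memLp_flip hf)] with y hy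
    have hy' := hy.integrable one_le_two
    have e := integral_sub (hy'.sub i1)
      (integrable_const (hoeffding₂ ν f y + hoeffdingMean ν f) (μ := ν))
    refine (integral_congr_ae (ae_of_all _ fun x => ?_)).trans (e.trans ?_)
    · simp only [hoeffding₁₂, Pi.sub_apply]
      ring
    · rw [integral_sub' hy' i1, integral_hoeffding₁ hf]
      simp [hoeffding₂]
  · filter_upwards [ae_memLp_section hf] with x hx
    have hx' := hx.integrable one_le_two
    have e := integral_sub (hx'.sub i2)
      (integrable_const (hoeffding₁ ν f x + hoeffdingMean ν f) (μ := ν))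
    refine (integral_congr_ae (ae_of_all _ fun y => ?_)).trans (e.trans ?_)
    · simp only [hoeffding₁₂, Pi.sub_apply]
      ring
    · rw [integral_sub' hx' i2, integral_hoeffding₂ hf]
      simp [hoeffding₁]

theorem IsDegenerate.integral_eq_zero {g : 𝒳 → 𝒳 → ℝ} (hd : IsDegenerate ν g)
    (hg : MemLp (Function.uncurry g) 2 (ν.prod ν)) : ∫ z, g z.1 z.2 ∂(ν.prod ν) = 0 := by
  have h := integral_prod _ (hg.integrable one_le_two)
  simp only [Function.uncurry_def] at h
  rw [h, integral_congr_ae hd.right, integral_zero]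

theorem sum_range_neg_one_pow (j : ℕ) :
    ∑ i ∈ Finset.range j, (-1 : ℝ) ^ i = ((j % 2 : ℕ) : ℝ) := by
  induction j with
  | zero => simp
  | succ j ih =>
    rw [Finset.sum_range_succ, ih]
    rcases Nat.even_or_odd j with h | h
    · rw [h.neg_one_pow, Nat.even_iff.1 h, Nat.odd_iff.1 h.add_one]
      simp
    · rw [h.neg_one_pow, Nat.odd_iff.1 h, Nat.even_iff.1 h.add_one]
      simp

theorem sum_range_mod_two (n : ℕ) : ∑ j ∈ Finset.range n, ((j % 2 : ℕ) : ℝ) = ((n / 2 : ℕ) : ℝ) := by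
  induction n with
  | zero => simp
  | succ n ih =>
    rw [Finset.sum_range_succ, ih]
    norm_cast
    omega

theorem sum_range_sum_range (a : ℕ → ℝ) (n : ℕ) :
    ∑ j ∈ Finset.range n, ∑ i ∈ Finset.range j, a i =
      ∑ i ∈ Finset.range n, (n - 1 - i) * a i := by
  induction n with
  | zero => simp
  | succ n ih =>
    rw [Finset.sum_range_succ, ih, Finset.sum_range_succ, ← Finset.sum_add_distrib]
    push_cast
    simp only [add_sub_cancel_right, sub_self, zero_mul, add_zero]
    exact Finset.sum_congr rfl fun i _ => by ring

theorem sum_range_sq_reflect (n : ℕ) :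
    ∑ i ∈ Finset.range n, ((n : ℝ) - 1 - i) ^ 2 = ((n : ℝ) - 1) * n * (2 * n - 1) / 6 := by
  induction n with
  | zero => simp
  | succ n ih =>
    rw [Finset.sum_range_succ']
    have e : ∀ i : ℕ, (((n + 1 : ℕ) : ℝ) - 1 - ((i + 1 : ℕ) : ℝ)) = (n : ℝ) - 1 - i := fun i => by
      push_cast; ring
    simp only [e, ih]
    push_cast
    ring

variable {Ω : Type*} {X : ℕ → Ω → 𝒳}

/-- `∑_{i<j} (-1)^{i+1} g(X_i, X_j)`. -/
def quadPart (g : 𝒳 → 𝒳 → ℝ) (X : ℕ → Ω → 𝒳) (n : ℕ) (ω : Ω) : ℝ :=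
  ∑ p ∈ pairs n, (-1 : ℝ) ^ p.2 * g (X p.2 ω) (X p.1 ω)

/-- `∑_i (-1)^{i+1} (n - i) φ(X_i)`. -/
def leftPart (φ : 𝒳 → ℝ) (X : ℕ → Ω → 𝒳) (n : ℕ) (ω : Ω) : ℝ :=
  ∑ i ∈ Finset.range n, ((-1 : ℝ) ^ i * (n - 1 - i)) * φ (X i ω)

/-- The sum of `φ(X_j)` over even `j`, with the variables numbered from `1`. -/
def rightPart (φ : 𝒳 → ℝ) (X : ℕ → Ω → 𝒳) (n : ℕ) (ω : Ω) : ℝ :=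
  ∑ j ∈ Finset.range n, ((j % 2 : ℕ) : ℝ) * φ (X j ω)

/-- With indices from zero the sign at i is (-1)^i. A function of the earlier variable occurs once
for each of the n-1-i later indices, and a function of the later variable is multiplied by the
alternating sum of length j, which is j mod 2. The constant term collects n/2, rounded down. -/
theorem altU_eq (ν : Measure 𝒳) (f : 𝒳 → 𝒳 → ℝ) (X : ℕ → Ω → 𝒳) (n : ℕ) (ω : Ω) :
    altU f X n ω = quadPart (hoeffding₁₂ ν f) X n ω + leftPart (hoeffding₁ ν f) X n ω +
      rightPart (hoeffding₂ ν f) X n ω + ((n / 2 : ℕ) : ℝ) * hoeffdingMean ν f := by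
  have e1 := sum_range_sum_range (fun i => (-1 : ℝ) ^ i * hoeffding₁ ν f (X i ω)) n
  have e2 : leftPart (hoeffding₁ ν f) X n ω =
      ∑ i ∈ Finset.range n, ((n : ℝ) - 1 - i) * ((-1 : ℝ) ^ i * hoeffding₁ ν f (X i ω)) :=
    Finset.sum_congr rfl fun i _ => by ring
  rw [e2, ← e1, quadPart,
    sum_pairs n fun i j => (-1 : ℝ) ^ i * hoeffding₁₂ ν f (X i ω) (X j ω), rightPart, altU,
    ← sum_range_mod_two, Finset.sum_mul, ← Finset.sum_add_distrib, ← Finset.sum_add_distrib,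
    ← Finset.sum_add_distrib]
  refine Finset.sum_congr rfl fun j _ => ?_
  rw [← sum_range_neg_one_pow, Finset.sum_mul, Finset.sum_mul, ← Finset.sum_add_distrib,
    ← Finset.sum_add_distrib, ← Finset.sum_add_distrib]
  refine Finset.sum_congr rfl fun i _ => ?_
  rw [hoeffding₁₂, pow_succ, pow_succ]
  ring

end Hoeffding

/-! ### Means and variances of the three parts -/

section Moments

variable {Ω 𝒳 : Type*} [MeasurableSpace Ω] [MeasurableSpace 𝒳] {P : Measure Ω}
  [IsProbabilityMeasure P] {ν : Measure 𝒳} [IsProbabilityMeasure ν] {X : ℕ → Ω → 𝒳}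
  {f g : 𝒳 → 𝒳 → ℝ} {φ : 𝒳 → ℝ}

theorem IsIID.memLp_quadPart (h : IsIID X ν P) (hg : MemLp (Function.uncurry g) 2 (ν.prod ν))
    (n : ℕ) : MemLp (quadPart g X n) 2 P :=
  h.memLp_sum_pairs hg (fun _ hp => (mem_pairs.1 hp).2) _

theorem IsIID.memLp_leftPart (h : IsIID X ν P) (hφ : MemLp φ 2 ν) (n : ℕ) :
    MemLp (leftPart φ X n) 2 P :=
  h.memLp_sum_single hφ _ _

theorem IsIID.memLp_rightPart (h : IsIID X ν P) (hφ : MemLp φ 2 ν) (n : ℕ) :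
    MemLp (rightPart φ X n) 2 P :=
  h.memLp_sum_single hφ _ _

theorem IsIID.integral_sum_single_eq_zero (h : IsIID X ν P) (hφ : MemLp φ 2 ν)
    (h0 : ∫ x, φ x ∂ν = 0) (S : Finset ℕ) (b : ℕ → ℝ) :
    ∫ ω, ∑ j ∈ S, b j * φ (X j ω) ∂P = 0 := by
  rw [integral_finsetSum _ fun j _ =>
    ((h.memLp_single hφ j).integrable one_le_two).const_mul (b j)]
  refine Finset.sum_eq_zero fun j _ => ?_
  rw [integral_const_mul, h.integral_single hφ.1, h0, mul_zero]

theorem IsIID.integral_quadPart (h : IsIID X ν P) (hg : MemLp (Function.uncurry g) 2 (ν.prod ν))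
    (hd : IsDegenerate ν g) (n : ℕ) : ∫ ω, quadPart g X n ω ∂P = 0 := by
  unfold quadPart
  rw [integral_finsetSum _ fun p hp =>
    ((h.memLp_pair hg (mem_pairs.1 hp).2.ne).integrable one_le_two).const_mul _]
  refine Finset.sum_eq_zero fun p hp => ?_
  rw [integral_const_mul, h.integral_pair (φ := fun z => g z.1 z.2) hg.1 (mem_pairs.1 hp).2.ne,
    hd.integral_eq_zero hg, mul_zero]

theorem IsIID.memLp_altU (h : IsIID X ν P) (hf : MemLp (Function.uncurry f) 2 (ν.prod ν))
    (n : ℕ) : MemLp (altU f X n) 2 P := by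
  have e : altU f X n = fun ω => quadPart (hoeffding₁₂ ν f) X n ω + leftPart (hoeffding₁ ν f) X n ω +
      rightPart (hoeffding₂ ν f) X n ω + ((n / 2 : ℕ) : ℝ) * hoeffdingMean ν f :=
    funext (altU_eq ν f X n)
  rw [e]
  exact (((h.memLp_quadPart (memLp_hoeffding₁₂ hf) n).add
    (h.memLp_leftPart (memLp_hoeffding₁ hf) n)).add
    (h.memLp_rightPart (memLp_hoeffding₂ hf) n)).add (memLp_const _)

theorem IsIID.integral_altU (h : IsIID X ν P) (hf : MemLp (Function.uncurry f) 2 (ν.prod ν))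
    (n : ℕ) : ∫ ω, altU f X n ω ∂P = ((n / 2 : ℕ) : ℝ) * hoeffdingMean ν f := by
  have i1 := (h.memLp_quadPart (memLp_hoeffding₁₂ hf) n).integrable one_le_two
  have i2 := (h.memLp_leftPart (memLp_hoeffding₁ hf) n).integrable one_le_two
  have i3 := (h.memLp_rightPart (memLp_hoeffding₂ hf) n).integrable one_le_two
  have z2 : ∫ ω, leftPart (hoeffding₁ ν f) X n ω ∂P = 0 :=
    h.integral_sum_single_eq_zero (memLp_hoeffding₁ hf) (integral_hoeffding₁ hf) _ _
  have z3 : ∫ ω, rightPart (hoeffding₂ ν f) X n ω ∂P = 0 :=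
    h.integral_sum_single_eq_zero (memLp_hoeffding₂ hf) (integral_hoeffding₂ hf) _ _
  simp only [altU_eq ν f X n]
  have e := integral_add_add i1 i2 i3 (integrable_const (((n / 2 : ℕ) : ℝ) * hoeffdingMean ν f))
  rw [h.integral_quadPart (memLp_hoeffding₁₂ hf) (isDegenerate_hoeffding₁₂ hf), z2, z3] at e
  simp only [integral_const, probReal_univ, smul_eq_mul, one_mul, zero_add] at e
  exact (integral_congr_ae (ae_of_all _ fun ω => by ring)).trans e

theorem IsIID.altU_sub_integral (h : IsIID X ν P) (hf : MemLp (Function.uncurry f) 2 (ν.prod ν))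
    (n : ℕ) (ω : Ω) : altU f X n ω - ∫ ω, altU f X n ω ∂P =
      quadPart (hoeffding₁₂ ν f) X n ω + leftPart (hoeffding₁ ν f) X n ω +
        rightPart (hoeffding₂ ν f) X n ω := by
  rw [h.integral_altU hf, altU_eq ν f X n ω]
  ring

/-- Degenerate double sums are orthogonal to linear sums, and the weights j mod 2 equal their own
squares. -/
theorem IsIID.integral_quad_add_right_sq (h : IsIID X ν P)
    (hg : MemLp (Function.uncurry g) 2 (ν.prod ν)) (hd : IsDegenerate ν g) (hφ : MemLp φ 2 ν)
    (h0 : ∫ x, φ x ∂ν = 0) (n : ℕ) :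
    ∫ ω, (quadPart g X n ω + rightPart φ X n ω) ^ 2 ∂P =
      n * (n - 1) / 2 * (∫ z, g z.1 z.2 ^ 2 ∂(ν.prod ν)) +
        ((n / 2 : ℕ) : ℝ) * ∫ x, φ x ^ 2 ∂ν := by
  have hp : ∀ p ∈ pairs n, p.2 < p.1 := fun p hp => (mem_pairs.1 hp).2
  have hQ := h.memLp_quadPart hg n
  have hR := h.memLp_rightPart hφ n
  have e1 : ∫ ω, quadPart g X n ω ^ 2 ∂P = _ := h.integral_sum_pairs_sq hg hd hp _
  have e2 : ∫ ω, rightPart φ X n ω ^ 2 ∂P = _ := h.integral_sum_single_sq hφ h0 _ _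
  have e3 : ∫ ω, quadPart g X n ω * rightPart φ X n ω ∂P = 0 :=
    h.integral_sum_pairs_mul_sum_single hg hd hφ hp _ _ _
  have e4 : ∀ p : (Σ _ : ℕ, ℕ), (((-1 : ℝ)) ^ p.2) ^ 2 = 1 := fun p => by
    rw [← pow_mul, mul_comm, pow_mul]; simp
  have e5 : ∀ j : ℕ, (((j % 2 : ℕ) : ℝ)) ^ 2 = ((j % 2 : ℕ) : ℝ) := fun j => by
    rcases Nat.mod_two_eq_zero_or_one j with hj | hj <;> simp [hj]
  simp only [e4, Finset.sum_const, nsmul_eq_mul, mul_one, card_pairs] at e1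
  simp only [e5, sum_range_mod_two] at e2
  rw [← e1, ← e2]
  have e6 : ∫ ω, (quadPart g X n ω ^ 2 + rightPart φ X n ω ^ 2 +
      (quadPart g X n ω * rightPart φ X n ω + quadPart g X n ω * rightPart φ X n ω)) ∂P = _ :=
    integral_add_add hQ.integrable_sq hR.integrable_sq (hQ.integrable_mul hR)
      (hQ.integrable_mul hR)
  rw [e3, add_zero, add_zero] at e6
  exact (integral_congr_ae (ae_of_all _ fun ω => by ring)).trans e6

theorem IsIID.variance_altU (h : IsIID X ν P) (hf : MemLp (Function.uncurry f) 2 (ν.prod ν))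
    (n : ℕ) : Var[altU f X n; P] = ∫ ω, (quadPart (hoeffding₁₂ ν f) X n ω +
      leftPart (hoeffding₁ ν f) X n ω + rightPart (hoeffding₂ ν f) X n ω) ^ 2 ∂P := by
  rw [variance_eq_integral (h.memLp_altU hf n).1.aemeasurable]
  simp only [h.altU_sub_integral hf n]

theorem IsIID.leftPart_ae_eq_zero (h : IsIID X ν P) (h0 : ∀ᵐ x ∂ν, φ x = 0) (n : ℕ) :
    ∀ᵐ ω ∂P, leftPart φ X n ω = 0 := by
  have h1 : ∀ᵐ ω ∂P, ∀ i, φ (X i ω) = 0 :=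
    ae_all_iff.2 fun i => (h.measurePreserving i).quasiMeasurePreserving.ae h0
  filter_upwards [h1] with ω hω
  simp [leftPart, hω]

theorem IsIID.variance_altU_of_degenerate (h : IsIID X ν P)
    (hf : MemLp (Function.uncurry f) 2 (ν.prod ν)) (h1 : ∀ᵐ x ∂ν, hoeffding₁ ν f x = 0) (n : ℕ) :
    Var[altU f X n; P] = n * (n - 1) / 2 * (∫ z, hoeffding₁₂ ν f z.1 z.2 ^ 2 ∂(ν.prod ν)) +
      ((n / 2 : ℕ) : ℝ) * ∫ x, hoeffding₂ ν f x ^ 2 ∂ν := by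
  rw [h.variance_altU hf, ← h.integral_quad_add_right_sq (memLp_hoeffding₁₂ hf)
    (isDegenerate_hoeffding₁₂ hf) (memLp_hoeffding₂ hf) (integral_hoeffding₂ hf)]
  refine integral_congr_ae ?_
  filter_upwards [h.leftPart_ae_eq_zero h1 n] with ω hω
  rw [hω, add_zero]

theorem IsIID.variance_hoeffding₁₂ (h : IsIID X ν P)
    (hf : MemLp (Function.uncurry f) 2 (ν.prod ν)) :
    Var[fun ω => hoeffding₁₂ ν f (X 0 ω) (X 1 ω); P] =
      ∫ z, hoeffding₁₂ ν f z.1 z.2 ^ 2 ∂(ν.prod ν) := by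
  have hm := memLp_hoeffding₁₂ hf
  have e := h.integral_pair (φ := fun z => hoeffding₁₂ ν f z.1 z.2) hm.1 zero_ne_one
  simp only [(isDegenerate_hoeffding₁₂ hf).integral_eq_zero hm] at e
  rw [variance_of_integral_eq_zero (h.memLp_pair hm zero_ne_one).1.aemeasurable e]
  exact h.integral_pair (φ := fun z => hoeffding₁₂ ν f z.1 z.2 ^ 2) (hm.1.pow 2) zero_ne_one

theorem IsIID.variance_hoeffding₂ (h : IsIID X ν P)
    (hf : MemLp (Function.uncurry f) 2 (ν.prod ν)) :
    Var[fun ω => hoeffding₂ ν f (X 0 ω); P] = ∫ x, hoeffding₂ ν f x ^ 2 ∂ν := by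
  have hm := memLp_hoeffding₂ hf
  have e := h.integral_single hm.1 0
  rw [integral_hoeffding₂ hf] at e
  rw [variance_of_integral_eq_zero (h.memLp_single hm 0).1.aemeasurable e]
  exact h.integral_single (φ := fun x => hoeffding₂ ν f x ^ 2) (hm.1.pow 2) 0

end Moments

/-! ### Normal limits -/

section Limits

/-- The reverse triangle inequality in L². -/
theorem tendsto_integral_sq_of_sub {Ω : Type*} [MeasurableSpace Ω] {P : Measure Ω}
    {V V' : ℕ → Ω → ℝ} (hV : ∀ n, MemLp (V n) 2 P) (hV' : ∀ n, MemLp (V' n) 2 P)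
    (h0 : Tendsto (fun n => ∫ ω, (V n ω - V' n ω) ^ 2 ∂P) atTop (𝓝 0)) {s : ℝ}
    (h : Tendsto (fun n => ∫ ω, V' n ω ^ 2 ∂P) atTop (𝓝 s)) :
    Tendsto (fun n => ∫ ω, V n ω ^ 2 ∂P) atTop (𝓝 s) := by
  have hs : 0 ≤ s := ge_of_tendsto' h fun n => integral_nonneg fun _ => sq_nonneg _
  have e : ∀ n, ∫ ω, (V n ω - V' n ω) ^ 2 ∂P = ‖(hV n).toLp (V n) - (hV' n).toLp (V' n)‖ ^ 2 :=
    fun n => by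
      rw [← MemLp.toLp_sub, norm_toLp_sq]
      rfl
  simp only [e] at h0
  simp only [← norm_toLp_sq (hV' _)] at h
  simp only [← norm_toLp_sq (hV _)]
  have h1 := h0.sqrt
  have h2 := h.sqrt
  simp only [Real.sqrt_sq (norm_nonneg _), Real.sqrt_zero] at h1 h2
  have h3 : Tendsto (fun n => ‖(hV n).toLp (V n)‖ - ‖(hV' n).toLp (V' n)‖) atTop (𝓝 0) :=
    squeeze_zero_norm (fun n => abs_norm_sub_norm_le _ _) h1
  have h4 := ((h3.add h2).pow 2)
  simpa [Real.sq_sqrt hs] using h4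

theorem charFun_map_id_gaussianReal {v : ℝ} (hv : 0 ≤ v) (t : ℝ) :
    charFun ((gaussianReal 0 v.toNNReal).map id) t = Complex.exp (-(v * t ^ 2 : ℝ) / 2) := by
  rw [Measure.map_id, charFun_gaussianReal, Real.coe_toNNReal v hv]
  congr 1
  push_cast
  ring

theorem natCast_rpow_neg_half_sq (n k : ℕ) :
    ((n : ℝ) ^ (-(k / 2) : ℝ)) ^ 2 = ((n : ℝ) ^ k)⁻¹ := by
  rw [← Real.rpow_natCast, ← Real.rpow_mul (Nat.cast_nonneg n), ← Real.rpow_natCast,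
    ← Real.rpow_neg (Nat.cast_nonneg n)]
  congr 1
  push_cast
  ring

variable {Ω 𝒳 : Type*} [MeasurableSpace Ω] [MeasurableSpace 𝒳] {P : Measure Ω}
  [IsProbabilityMeasure P] {ν : Measure 𝒳} [IsProbabilityMeasure ν] {X : ℕ → Ω → 𝒳}
  {f g : 𝒳 → 𝒳 → ℝ} {φ : 𝒳 → ℝ}

theorem tendsto_natCast_div_two : Tendsto (fun n : ℕ => ((n / 2 : ℕ) : ℝ) / n) atTop (𝓝 (1 / 2)) := by
  have h := (tendsto_inv_atTop_nhds_zero_nat (𝕜 := ℝ))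
  refine tendsto_of_tendsto_of_tendsto_of_le_of_le' (g := fun n : ℕ => 1 / 2 - (n : ℝ)⁻¹)
    (h := fun _ => 1 / 2) (by simpa only [sub_zero] using h.const_sub (1 / 2)) tendsto_const_nhds ?_ ?_
  · filter_upwards [eventually_gt_atTop 0] with n hn
    have hn' : (0 : ℝ) < n := by exact_mod_cast hn
    have h2 : (n : ℝ) ≤ 2 * ((n / 2 : ℕ) : ℝ) + 1 := by
      have : n ≤ 2 * (n / 2) + 1 := by omega
      exact_mod_cast this
    rw [le_div_iff₀ hn', sub_mul, inv_mul_cancel₀ hn'.ne']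
    linarith
  · filter_upwards [eventually_gt_atTop 0] with n hn
    have hn' : (0 : ℝ) < n := by exact_mod_cast hn
    have h2 : 2 * ((n / 2 : ℕ) : ℝ) ≤ (n : ℝ) := by
      have : 2 * (n / 2) ≤ n := by omega
      exact_mod_cast this
    rw [div_le_iff₀ hn']
    linarith

/-- The sum of (n-1-i)² is asymptotic to n³/3, the source of the constant in the variance. -/
theorem tendsto_sum_left_weights : Tendsto (fun n : ℕ => ∑ i ∈ Finset.range n,
    ((n : ℝ) ^ (-(3 / 2) : ℝ) * ((-1 : ℝ) ^ i * (n - 1 - i))) ^ 2) atTop (𝓝 (1 / 3)) := by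
  have h := (tendsto_inv_atTop_nhds_zero_nat (𝕜 := ℝ))
  have h1 : Tendsto (fun n : ℕ => (1 - (n : ℝ)⁻¹) * (2 - (n : ℝ)⁻¹) / 6) atTop (𝓝 (1 / 3)) := by
    have := ((h.const_sub 1).mul (h.const_sub 2)).div_const 6
    norm_num at this
    simpa using this
  refine h1.congr' ?_
  filter_upwards [eventually_gt_atTop 0] with n hn
  have hn' : (n : ℝ) ≠ 0 := by exact_mod_cast hn.ne'
  have e : ∀ i : ℕ, (((-1 : ℝ)) ^ i) ^ 2 = 1 := fun i => by
    rw [← pow_mul, mul_comm, pow_mul]; simp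
  have e3 := natCast_rpow_neg_half_sq n 3
  push_cast at e3
  simp only [mul_pow, e, one_mul, ← Finset.mul_sum, sum_range_sq_reflect, e3]
  field_simp

theorem IsIID.memLp_altU_sub (h : IsIID X ν P) (hf : MemLp (Function.uncurry f) 2 (ν.prod ν))
    (n : ℕ) (a : ℝ) : MemLp (fun ω => a * (altU f X n ω - ∫ ω, altU f X n ω ∂P)) 2 P :=
  ((h.memLp_altU hf n).sub (memLp_const _)).const_mul a

/-- The other two parts together have second moment O(n²), against the normalization n³. -/
theorem IsIID.tendsto_integral_altU_sub_leftPart_sq (h : IsIID X ν P)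
    (hf : MemLp (Function.uncurry f) 2 (ν.prod ν)) :
    Tendsto (fun n : ℕ => ∫ ω, ((n : ℝ) ^ (-(3 / 2) : ℝ) *
      (altU f X n ω - ∫ ω, altU f X n ω ∂P) -
        (n : ℝ) ^ (-(3 / 2) : ℝ) * leftPart (hoeffding₁ ν f) X n ω) ^ 2 ∂P) atTop (𝓝 0) := by
  have hi := (tendsto_inv_atTop_nhds_zero_nat (𝕜 := ℝ))
  set A := ∫ z, hoeffding₁₂ ν f z.1 z.2 ^ 2 ∂(ν.prod ν) with hA
  set B := ∫ x, hoeffding₂ ν f x ^ 2 ∂ν with hB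
  have h1 : Tendsto (fun n : ℕ => (n : ℝ)⁻¹ * (1 - (n : ℝ)⁻¹) / 2 * A +
      ((n / 2 : ℕ) : ℝ) / n * ((n : ℝ)⁻¹ * (n : ℝ)⁻¹) * B) atTop (𝓝 0) := by
    have := (((hi.mul (hi.const_sub 1)).div_const 2).mul_const A).add
      ((tendsto_natCast_div_two.mul (hi.mul hi)).mul_const B)
    simpa using this
  refine h1.congr' ?_
  filter_upwards [eventually_gt_atTop 0] with n hn
  have hn' : (n : ℝ) ≠ 0 := by exact_mod_cast hn.ne'
  have e3 := natCast_rpow_neg_half_sq n 3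
  push_cast at e3
  have e : ∀ ω, ((n : ℝ) ^ (-(3 / 2) : ℝ) * (altU f X n ω - ∫ ω, altU f X n ω ∂P) -
        (n : ℝ) ^ (-(3 / 2) : ℝ) * leftPart (hoeffding₁ ν f) X n ω) ^ 2 = ((n : ℝ) ^ 3)⁻¹ *
      (quadPart (hoeffding₁₂ ν f) X n ω + rightPart (hoeffding₂ ν f) X n ω) ^ 2 := fun ω => by
    rw [h.altU_sub_integral hf, ← e3]
    ring
  simp only [e]
  rw [integral_const_mul, h.integral_quad_add_right_sq (memLp_hoeffding₁₂ hf)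
    (isDegenerate_hoeffding₁₂ hf) (memLp_hoeffding₂ hf) (integral_hoeffding₂ hf), ← hA, ← hB]
  field_simp

theorem IsIID.tendsto_variance_altU (h : IsIID X ν P)
    (hf : MemLp (Function.uncurry f) 2 (ν.prod ν)) :
    Tendsto (fun n : ℕ => Var[altU f X n; P] / (n : ℝ) ^ 3) atTop
      (𝓝 (1 / 3 * ∫ x, hoeffding₁ ν f x ^ 2 ∂ν)) := by
  have h1 := tendsto_integral_sq_of_sub (fun n => h.memLp_altU_sub hf n _)
    (fun n => (h.memLp_leftPart (memLp_hoeffding₁ hf) n).const_mul _)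
    (h.tendsto_integral_altU_sub_leftPart_sq hf)
    (s := 1 / 3 * ∫ x, hoeffding₁ ν f x ^ 2 ∂ν) ?_
  · refine h1.congr fun n => ?_
    have e3 := natCast_rpow_neg_half_sq n 3
    push_cast at e3
    rw [variance_eq_integral (h.memLp_altU hf n).1.aemeasurable]
    simp only [mul_pow]
    rw [integral_const_mul, e3, div_eq_inv_mul]
  · refine (tendsto_sum_left_weights.mul_const (∫ x, hoeffding₁ ν f x ^ 2 ∂ν)).congr fun n => ?_
    rw [← h.integral_sum_single_sq (memLp_hoeffding₁ hf) (integral_hoeffding₁ hf)]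
    simp only [leftPart, Finset.mul_sum, mul_assoc]

theorem tendsto_rpow_neg_half : Tendsto (fun n : ℕ => (n : ℝ) ^ (-(1 / 2) : ℝ)) atTop (𝓝 0) :=
  (tendsto_rpow_neg_atTop (by norm_num)).comp tendsto_natCast_atTop_atTop

theorem IsIID.tendstoInDistribution_altU (h : IsIID X ν P)
    (hf : MemLp (Function.uncurry f) 2 (ν.prod ν)) :
    TendstoInDistribution (fun (n : ℕ) ω => (n : ℝ) ^ (-(3 / 2) : ℝ) *
        (altU f X n ω - ∫ ω, altU f X n ω ∂P)) atTop (id : ℝ → ℝ) (fun _ => P)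
      (gaussianReal 0 (1 / 3 * ∫ x, hoeffding₁ ν f x ^ 2 ∂ν).toNNReal) := by
  have hV := fun n => h.memLp_altU_sub hf n ((n : ℝ) ^ (-(3 / 2) : ℝ))
  have hV' := fun n => (h.memLp_leftPart (memLp_hoeffding₁ hf) n).const_mul
    ((n : ℝ) ^ (-(3 / 2) : ℝ))
  have hv : 0 ≤ 1 / 3 * ∫ x, hoeffding₁ ν f x ^ 2 ∂ν :=
    mul_nonneg (by norm_num) (integral_nonneg fun _ => sq_nonneg _)
  refine tendstoInDistribution_of_charFun (fun n => (hV n).1.aemeasurable) aemeasurable_id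
    fun t => ?_
  rw [charFun_map_id_gaussianReal hv]
  refine tendsto_charFun_of_sub (fun n => (hV n).1.aemeasurable) (fun n => (hV' n).1.aemeasurable)
    (fun n => (hV n).sub (hV' n)) (h.tendsto_integral_altU_sub_leftPart_sq hf) ?_
  -- Each factor n-1-i is at most n, so every weight is at most n^(-3/2) n = n^(-1/2).
  have h1 := tendsto_charFun_weighted_sum h (memLp_hoeffding₁ hf) (integral_hoeffding₁ hf)
    (a := fun n i => (n : ℝ) ^ (-(3 / 2) : ℝ) * ((-1 : ℝ) ^ i * (n - 1 - i)))
    tendsto_rpow_neg_half (fun n j hj => ?_) tendsto_sum_left_weights t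
  · refine h1.congr fun n => ?_
    simp only [leftPart, Finset.mul_sum, mul_assoc]
  · have hn : (0 : ℝ) < n := by exact_mod_cast (Nat.zero_le j).trans_lt hj
    have hj' : ((j : ℝ)) + 1 ≤ n := by exact_mod_cast hj
    have e : (n : ℝ) ^ (-(1 / 2) : ℝ) = (n : ℝ) ^ (-(3 / 2) : ℝ) * n := by
      rw [← Real.rpow_add_one hn.ne']
      norm_num
    rw [abs_mul, abs_mul, abs_neg_one_pow, one_mul, e, abs_of_nonneg (Real.rpow_nonneg hn.le _),
      abs_of_nonneg (by linarith)]
    refine mul_le_mul_of_nonneg_left ?_ (Real.rpow_nonneg hn.le _)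
    have : (0 : ℝ) ≤ j := Nat.cast_nonneg j
    linarith

theorem IsIID.isBigO_variance_of_degenerate (h : IsIID X ν P)
    (hf : MemLp (Function.uncurry f) 2 (ν.prod ν)) (h1 : ∀ᵐ x ∂ν, hoeffding₁ ν f x = 0) :
    (fun n : ℕ => Var[altU f X n; P] - 1 / 2 * (n : ℝ) ^ 2 *
      ∫ z, hoeffding₁₂ ν f z.1 z.2 ^ 2 ∂(ν.prod ν)) =O[atTop] (fun n : ℕ => (n : ℝ)) := by
  set A := ∫ z, hoeffding₁₂ ν f z.1 z.2 ^ 2 ∂(ν.prod ν) with hA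
  set B := ∫ x, hoeffding₂ ν f x ^ 2 ∂ν with hB
  have hA0 : 0 ≤ A := integral_nonneg fun _ => sq_nonneg _
  have hB0 : 0 ≤ B := integral_nonneg fun _ => sq_nonneg _
  refine IsBigO.of_bound (A + B) (Eventually.of_forall fun n => ?_)
  rw [h.variance_altU_of_degenerate hf h1, ← hA, ← hB]
  have h2 : ((n / 2 : ℕ) : ℝ) ≤ n := by exact_mod_cast Nat.div_le_self n 2
  have h3 : (0 : ℝ) ≤ ((n / 2 : ℕ) : ℝ) := Nat.cast_nonneg _
  have h4 : (0 : ℝ) ≤ n := Nat.cast_nonneg _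
  rw [Real.norm_eq_abs, Real.norm_eq_abs, abs_of_nonneg h4,
    show (n : ℝ) * (n - 1) / 2 * A + ((n / 2 : ℕ) : ℝ) * B - 1 / 2 * (n : ℝ) ^ 2 * A =
      ((n / 2 : ℕ) : ℝ) * B - n / 2 * A by ring]
  refine (abs_sub _ _).trans ?_
  rw [abs_of_nonneg (by positivity), abs_of_nonneg (by positivity)]
  nlinarith [mul_le_mul_of_nonneg_right h2 hB0, mul_nonneg h4 hA0]

theorem IsIID.isBigO_variance_of_linear (h : IsIID X ν P)
    (hf : MemLp (Function.uncurry f) 2 (ν.prod ν)) (h1 : ∀ᵐ x ∂ν, hoeffding₁ ν f x = 0)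
    (h12 : ∫ z, hoeffding₁₂ ν f z.1 z.2 ^ 2 ∂(ν.prod ν) = 0) :
    (fun n : ℕ => Var[altU f X n; P] - n * (1 / 2 * ∫ x, hoeffding₂ ν f x ^ 2 ∂ν))
      =O[atTop] (fun _ : ℕ => (1 : ℝ)) := by
  set B := ∫ x, hoeffding₂ ν f x ^ 2 ∂ν with hB
  have hB0 : 0 ≤ B := integral_nonneg fun _ => sq_nonneg _
  refine IsBigO.of_bound B (Eventually.of_forall fun n => ?_)
  rw [h.variance_altU_of_degenerate hf h1, h12, ← hB, norm_one, mul_one, mul_zero, zero_add,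
    Real.norm_eq_abs]
  have h2 : 2 * ((n / 2 : ℕ) : ℝ) ≤ (n : ℝ) := by
    have : 2 * (n / 2) ≤ n := by omega
    exact_mod_cast this
  have h3 : (n : ℝ) ≤ 2 * ((n / 2 : ℕ) : ℝ) + 1 := by
    have : n ≤ 2 * (n / 2) + 1 := by omega
    exact_mod_cast this
  rw [show ((n / 2 : ℕ) : ℝ) * B - n * (1 / 2 * B) = (((n / 2 : ℕ) : ℝ) - n / 2) * B by ring,
    abs_mul, abs_of_nonneg hB0]
  refine mul_le_of_le_one_left hB0 (abs_le.2 ⟨by linarith, by linarith⟩)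

/-- In the degenerate case the quadratic part determines the limit. -/
theorem IsIID.tendsto_charFun_altU_of_degenerate (h : IsIID X ν P)
    (hf : MemLp (Function.uncurry f) 2 (ν.prod ν)) (h1 : ∀ᵐ x ∂ν, hoeffding₁ ν f x = 0)
    {t : ℝ} {z : ℂ}
    (hz : Tendsto (fun n : ℕ => charFun (P.map fun ω => ∑ p ∈ pairs n,
      ((n : ℝ)⁻¹ * (-1 : ℝ) ^ p.2) * hoeffding₁₂ ν f (X p.2 ω) (X p.1 ω)) t) atTop (𝓝 z)) :
    Tendsto (fun n : ℕ => charFun (P.map fun ω =>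
      (n : ℝ)⁻¹ * (altU f X n ω - ∫ ω, altU f X n ω ∂P)) t) atTop (𝓝 z) := by
  have hV := fun n => h.memLp_altU_sub hf n ((n : ℝ)⁻¹)
  have hV' := fun n => (h.memLp_quadPart (memLp_hoeffding₁₂ hf) n).const_mul ((n : ℝ)⁻¹)
  refine tendsto_charFun_of_sub (fun n => (hV n).1.aemeasurable) (fun n => (hV' n).1.aemeasurable)
    (fun n => (hV n).sub (hV' n)) ?_ (hz.congr fun n => by
      simp only [quadPart, Finset.mul_sum, mul_assoc])
  have hi := (tendsto_inv_atTop_nhds_zero_nat (𝕜 := ℝ))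
  -- What is left beside the quadratic part is `rightPart`, whose second moment is of order n and is
  -- divided by n².
  have h2 := (tendsto_natCast_div_two.mul hi).mul_const (∫ x, hoeffding₂ ν f x ^ 2 ∂ν)
  rw [mul_zero, zero_mul] at h2
  refine h2.congr' ?_
  filter_upwards [eventually_gt_atTop 0] with n hn
  have hn' : (n : ℝ) ≠ 0 := by exact_mod_cast hn.ne'
  have e : ∫ ω, rightPart (hoeffding₂ ν f) X n ω ^ 2 ∂P = _ :=
    h.integral_sum_single_sq (memLp_hoeffding₂ hf) (integral_hoeffding₂ hf) _ _
  have e5 : ∀ j : ℕ, (((j % 2 : ℕ) : ℝ)) ^ 2 = ((j % 2 : ℕ) : ℝ) := fun j => by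
    rcases Nat.mod_two_eq_zero_or_one j with hj | hj <;> simp [hj]
  simp only [e5, sum_range_mod_two] at e
  have e2 : ∫ ω, ((n : ℝ)⁻¹ * (altU f X n ω - ∫ ω, altU f X n ω ∂P) -
      (n : ℝ)⁻¹ * quadPart (hoeffding₁₂ ν f) X n ω) ^ 2 ∂P =
      ∫ ω, ((n : ℝ)⁻¹) ^ 2 * rightPart (hoeffding₂ ν f) X n ω ^ 2 ∂P := by
    refine integral_congr_ae ?_
    filter_upwards [h.leftPart_ae_eq_zero h1 n] with ω hω
    rw [h.altU_sub_integral hf, hω]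
    ring
  rw [e2, integral_const_mul, e]
  field_simp

theorem IsIID.tendstoInDistribution_altU_of_linear (h : IsIID X ν P)
    (hf : MemLp (Function.uncurry f) 2 (ν.prod ν)) (h1 : ∀ᵐ x ∂ν, hoeffding₁ ν f x = 0)
    (h12 : ∫ z, hoeffding₁₂ ν f z.1 z.2 ^ 2 ∂(ν.prod ν) = 0) :
    TendstoInDistribution (fun (n : ℕ) ω => (n : ℝ) ^ (-(1 / 2) : ℝ) *
        (altU f X n ω - ∫ ω, altU f X n ω ∂P)) atTop (id : ℝ → ℝ) (fun _ => P)
      (gaussianReal 0 (1 / 2 * ∫ x, hoeffding₂ ν f x ^ 2 ∂ν).toNNReal) := by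
  have hV := fun n => h.memLp_altU_sub hf n ((n : ℝ) ^ (-(1 / 2) : ℝ))
  have hV' := fun n => (h.memLp_rightPart (memLp_hoeffding₂ hf) n).const_mul
    ((n : ℝ) ^ (-(1 / 2) : ℝ))
  have hv : 0 ≤ 1 / 2 * ∫ x, hoeffding₂ ν f x ^ 2 ∂ν :=
    mul_nonneg (by norm_num) (integral_nonneg fun _ => sq_nonneg _)
  refine tendstoInDistribution_of_charFun (fun n => (hV n).1.aemeasurable) aemeasurable_id
    fun t => ?_
  rw [charFun_map_id_gaussianReal hv]
  -- The quadratic part vanishes in L² by `integral_sum_pairs_sq`, so replacing the statistic by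
  -- `rightPart` costs nothing.
  have hz : ∀ n : ℕ, ∫ ω, ((n : ℝ) ^ (-(1 / 2) : ℝ) * (altU f X n ω - ∫ ω, altU f X n ω ∂P) -
      (n : ℝ) ^ (-(1 / 2) : ℝ) * rightPart (hoeffding₂ ν f) X n ω) ^ 2 ∂P = 0 := fun n => by
    have e2 : ∫ ω, ((n : ℝ) ^ (-(1 / 2) : ℝ) * (altU f X n ω - ∫ ω, altU f X n ω ∂P) -
        (n : ℝ) ^ (-(1 / 2) : ℝ) * rightPart (hoeffding₂ ν f) X n ω) ^ 2 ∂P =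
        ∫ ω, ((n : ℝ) ^ (-(1 / 2) : ℝ)) ^ 2 * quadPart (hoeffding₁₂ ν f) X n ω ^ 2 ∂P := by
      refine integral_congr_ae ?_
      filter_upwards [h.leftPart_ae_eq_zero h1 n] with ω hω
      rw [h.altU_sub_integral hf, hω]
      ring
    have e : ∫ ω, quadPart (hoeffding₁₂ ν f) X n ω ^ 2 ∂P = _ :=
      h.integral_sum_pairs_sq (memLp_hoeffding₁₂ hf) (isDegenerate_hoeffding₁₂ hf)
        (fun p hp => (mem_pairs.1 hp).2) _
    rw [e2, integral_const_mul, e, h12, mul_zero, mul_zero]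
  refine tendsto_charFun_of_sub (fun n => (hV n).1.aemeasurable) (fun n => (hV' n).1.aemeasurable)
    (fun n => (hV n).sub (hV' n)) (by simp only [hz]; exact tendsto_const_nhds) ?_
  have e1 := fun n => natCast_rpow_neg_half_sq n 1
  push_cast at e1
  have e5 : ∀ j : ℕ, (((j % 2 : ℕ) : ℝ)) ^ 2 = ((j % 2 : ℕ) : ℝ) := fun j => by
    rcases Nat.mod_two_eq_zero_or_one j with hj | hj <;> simp [hj]
  have h1 := tendsto_charFun_weighted_sum h (memLp_hoeffding₂ hf) (integral_hoeffding₂ hf)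
    (a := fun n j => (n : ℝ) ^ (-(1 / 2) : ℝ) * ((j % 2 : ℕ) : ℝ))
    tendsto_rpow_neg_half (fun n j hj => ?_) (v := 1 / 2) ?_ t
  · refine h1.congr fun n => ?_
    simp only [rightPart, Finset.mul_sum, mul_assoc]
  · rw [abs_of_nonneg (by positivity)]
    refine mul_le_of_le_one_right (by positivity) ?_
    have : j % 2 ≤ 1 := by omega
    exact_mod_cast this
  · refine tendsto_natCast_div_two.congr fun n => ?_
    simp only [mul_pow, e1, e5, ← Finset.mul_sum, sum_range_mod_two, pow_one]
    rw [div_eq_inv_mul]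

end Limits

/-! ### The degenerate case -/

section Degenerate

variable {Ω 𝒳 : Type*} [MeasurableSpace Ω] [MeasurableSpace 𝒳] {P : Measure Ω}
  [IsProbabilityMeasure P] {ν : Measure 𝒳} [IsProbabilityMeasure ν] {X : ℕ → Ω → 𝒳}
  {f g : 𝒳 → 𝒳 → ℝ}

/-- Spectral expansion of the kernel on pairs with times, with multiplicities transferred to the
block operator. The limit is stated for any value of the infinite product, which is supplied once
the limit variable has been constructed. -/
theorem exists_quadratic_limit (h : IsIID X ν P) (hm : Measurable (Function.uncurry g))
    (hg : MemLp (Function.uncurry g) 2 (ν.prod ν)) (hd : IsDegenerate ν g) :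
    ∃ (R : ℕ∞) (c : Idx R → ℝ), ListsNonzeroEigenvalues (altOp ν g hg) c ∧
      Summable (fun r => c r ^ 2) ∧ ∑' r, c r ^ 2 = ∫ z, g z.1 z.2 ^ 2 ∂(ν.prod ν) ∧
      ∀ (t : ℝ) (z : ℂ), HasProd (fun r => quadChar (c r * t)) z →
        Tendsto (fun n : ℕ => charFun (P.map fun ω => ∑ p ∈ pairs n,
          ((n : ℝ)⁻¹ * (-1 : ℝ) ^ p.2) * g (X p.2 ω) (X p.1 ω)) t) atTop (𝓝 z) := by
  have hp := memLp_pairKernel hg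
  have hG : MemLp (Function.uncurry fun a b => 1 / 2 * hatKernel (pairKernel g) a b) 2
      ((pairTime ν).prod (pairTime ν)) := (memLp_hatKernel hp).const_mul (1 / 2)
  obtain ⟨R, c, ψ, hc, hcs, hct, hψ, -, hlim⟩ := exists_eigen_expansion hG
    ((isDegenerate_hatKernel hp (isDegenerate_pairKernel hg hd)).const_mul (1 / 2))
    (ae_of_all _ fun z => by rw [hatKernel_symm])
  refine ⟨R, c, ⟨hc.1, fun z hz => ?_⟩, hcs, hct.trans (integral_hat_pairKernel_sq hm hg hd),
    fun t z hz => tendsto_charFun_alternating h hm hg hd hψ c hlim hz⟩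
  rw [hc.2 z hz, eigenMult_altOp hg hd hG hz]

/-- A convergent series of independent multiples of a given centered law. -/
theorem exists_isL2Sum_of_law {κ : Measure ℝ} [IsProbabilityMeasure κ] (h2 : MemLp id 2 κ)
    (h0 : ∫ x, x ∂κ = 0) {ι : Type} {c : ι → ℝ} (hc : Summable fun r => c r ^ 2) :
    ∃ (P' : Measure (ι → ℝ)) (_ : IsProbabilityMeasure P') (ξ : ι → (ι → ℝ) → ℝ)
      (W : (ι → ℝ) → ℝ), iIndepFun ξ P' ∧ (∀ r, MeasurePreserving (ξ r) P' κ) ∧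
      IsL2Sum (fun r ω => c r * ξ r ω) W P' ∧
      Var[W; P'] = (∫ x, x ^ 2 ∂κ) * ∑' r, c r ^ 2 ∧
      ∀ t, HasProd (fun r => charFun κ (c r * t)) (charFun (P'.map W) t) := by
  set P' : Measure (ι → ℝ) := Measure.infinitePi fun _ => κ
  have hmp : ∀ r, MeasurePreserving (fun ω : ι → ℝ => ω r) P' κ := fun r =>
    measurePreserving_eval_infinitePi _ r
  have hY : iIndepFun (fun r (ω : ι → ℝ) => c r * ω r) P' :=
    iIndepFun_infinitePi (X := fun r x => c r * x) fun _ => by fun_prop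
  have hm2 : ∀ r, MemLp (fun ω : ι → ℝ => ω r) 2 P' := fun r => h2.comp_measurePreserving (hmp r)
  have hi : ∀ (r : ι) {φ : ℝ → ℝ}, Measurable φ → ∫ ω, φ (ω r) ∂P' = ∫ x, φ x ∂κ :=
    fun r φ hφ => by
      rw [← (hmp r).map_eq, integral_map (hmp r).aemeasurable hφ.aestronglyMeasurable]
  have hsq : ∀ r, ∫ ω, (c r * ω r) ^ 2 ∂P' = (∫ x, x ^ 2 ∂κ) * c r ^ 2 := fun r => by
    simp only [mul_pow]
    rw [integral_const_mul, hi r (φ := fun x => x ^ 2) (by fun_prop), mul_comm]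
  obtain ⟨W, hW, -, hv, hp⟩ := exists_isL2Sum hY (fun r => (hm2 r).const_mul (c r)) (fun r => by
    rw [integral_const_mul, hi r (φ := fun x => x) (by fun_prop), h0, mul_zero])
    (by simp only [hsq]; exact hc.mul_left _)
  refine ⟨P', inferInstance, fun r ω => ω r, W,
    iIndepFun_infinitePi (X := fun _ x => x) fun _ => measurable_id, hmp, hW, ?_, fun t => ?_⟩
  · rw [hv]
    simp only [hsq]
    rw [tsum_mul_left]
  · refine (hp t).congr_fun fun r => ?_
    have e : P'.map (fun ω => c r * ω r) = κ.map fun x => c r * x := by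
      rw [← (hmp r).map_eq, Measure.map_map (by fun_prop) (hmp r).measurable]
      rfl
    rw [e, charFun_map_mul]

theorem IsIID.ae_eq_zero (h : IsIID X ν P) {φ : 𝒳 → ℝ} (hφ : Measurable φ)
    (h1 : ∀ᵐ ω ∂P, φ (X 0 ω) = 0) : ∀ᵐ x ∂ν, φ x = 0 := by
  rw [← h.law 0]
  exact (ae_map_iff (h.meas 0).aemeasurable (hφ (measurableSet_singleton 0))).2 h1

theorem IsIID.integral_sq_eq_zero (h : IsIID X ν P) (hg : Measurable (Function.uncurry g))
    (h1 : ∀ᵐ ω ∂P, g (X 0 ω) (X 1 ω) = 0) : ∫ z, g z.1 z.2 ^ 2 ∂(ν.prod ν) = 0 := by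
  rw [← h.integral_pair (φ := fun z => g z.1 z.2 ^ 2) (hg.pow_const 2).aestronglyMeasurable
    zero_ne_one]
  refine integral_eq_zero_of_ae ?_
  filter_upwards [h1] with ω hω
  simp [hω]

theorem hoeffding₁₂_symm (hs : ∀ᵐ z ∂(ν.prod ν), f z.1 z.2 = f z.2 z.1) :
    ∀ᵐ z ∂(ν.prod ν), hoeffding₁₂ ν f z.1 z.2 = hoeffding₁₂ ν f z.2 z.1 := by
  have h1 : ∀ᵐ x ∂ν, hoeffding₁ ν f x = hoeffding₂ ν f x := by
    filter_upwards [Measure.ae_ae_of_ae_prod hs] with x hx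
    rw [hoeffding₁, hoeffding₂, integral_congr_ae hx]
  filter_upwards [hs, (Measure.quasiMeasurePreserving_fst (μ := ν) (ν := ν)).ae h1,
    (Measure.quasiMeasurePreserving_snd (μ := ν) (ν := ν)).ae h1] with z hz h2 h3
  rw [hoeffding₁₂, hoeffding₁₂, hz, h2, h3]
  ring

/-- The spectral expansion of g itself is bilinear with p = q, the eigenfunctions. -/
theorem exists_symmetric_limit (h : IsIID X ν P) (hm : Measurable (Function.uncurry g))
    (hg : MemLp (Function.uncurry g) 2 (ν.prod ν)) (hd : IsDegenerate ν g)
    (hs : ∀ᵐ z ∂(ν.prod ν), g z.1 z.2 = g z.2 z.1) :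
    ∃ (R : ℕ∞) (c : Idx R → ℝ), ListsNonzeroEigenvalues (integralOp ν g hg) c ∧
      Summable (fun r => c r ^ 2) ∧ ∑' r, c r ^ 2 = ∫ z, g z.1 z.2 ^ 2 ∂(ν.prod ν) ∧
      ∀ (t : ℝ) (z : ℂ), HasProd (fun r => ((1 / √(Real.cosh (c r * t)) : ℝ) : ℂ)) z →
        Tendsto (fun n : ℕ => charFun (P.map fun ω => ∑ p ∈ pairs n,
          ((n : ℝ)⁻¹ * (-1 : ℝ) ^ p.2) * g (X p.2 ω) (X p.1 ω)) t) atTop (𝓝 z) := by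
  obtain ⟨R, c, ψ, hc, hcs, hct, hψ, hψm, hlim⟩ := exists_eigen_expansion hg hd hs
  exact ⟨R, c, hc, hcs, hct, fun t z hz =>
    tendsto_charFun_alternating_bilinear h hm hg hd hψ hψ hψm hψm hcs hlim hz⟩

end Degenerate

/-! ### Antisymmetric kernels -/

section Antisymmetric

variable {𝒳 : Type*} [MeasurableSpace 𝒳] {ν : Measure 𝒳} [IsProbabilityMeasure ν]
  {g : 𝒳 → 𝒳 → ℝ}

open scoped ComplexConjugate

theorem integralOp_const_mul {𝕜 : Type*} [RCLike 𝕜] {k : 𝒳 → 𝒳 → 𝕜}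
    (hk : MemLp (Function.uncurry k) 2 (ν.prod ν)) (c : 𝕜)
    (hck : MemLp (Function.uncurry fun x y => c * k x y) 2 (ν.prod ν)) :
    integralOp ν (fun x y => c * k x y) hck = c • integralOp ν k hk := by
  ext φ : 1
  apply Lp.ext
  refine (integralOp_ae_eq ν _ hck φ).trans (EventuallyEq.trans ?_ (Lp.coeFn_smul c _).symm)
  filter_upwards [integralOp_ae_eq ν k hk φ] with x hx
  change _ = c * integralOp ν k hk φ x
  rw [hx, ← integral_const_mul]
  simp only [mul_assoc]

theorem memLp_complex_const_mul (hg : MemLp (Function.uncurry g) 2 (ν.prod ν)) (c : ℂ) :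
    MemLp (Function.uncurry fun x y => c * (g x y : ℂ)) 2 (ν.prod ν) :=
  (memLp_complex hg).const_mul c

theorem mem_skewAdjoint_integralOp (hg : MemLp (Function.uncurry g) 2 (ν.prod ν))
    (ha : ∀ᵐ z ∂(ν.prod ν), g z.1 z.2 = -g z.2 z.1) :
    integralOp ν (fun x y => (g x y : ℂ)) (memLp_complex hg) ∈
      skewAdjoint (Lp ℂ 2 ν →L[ℂ] Lp ℂ 2 ν) := by
  rw [skewAdjoint.mem_iff, ContinuousLinearMap.star_eq_adjoint, eq_comm,
    ContinuousLinearMap.eq_adjoint_iff]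
  intro φ ψ
  rw [← inner_integralOp_swap (memLp_complex hg) (memLp_complex_const_mul hg (-1)) ?_ φ ψ,
    integralOp_const_mul (memLp_complex hg)]
  · simp
  · filter_upwards [ha] with z hz
    rw [hz]
    simp

/-- For real antisymmetric g the kernel -ig is Hermitian, so the self-adjoint theory applies to
-iT_g; an eigenvalue ia of T_g becomes a. -/
theorem isSymmetric_integralOp_neg_I (hg : MemLp (Function.uncurry g) 2 (ν.prod ν))
    (ha : ∀ᵐ z ∂(ν.prod ν), g z.1 z.2 = -g z.2 z.1) :
    (integralOp ν (fun x y => -Complex.I * (g x y : ℂ))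
      (memLp_complex_const_mul hg _)).IsSymmetric := fun φ ψ => by
  refine inner_integralOp_swap _ _ ?_ φ ψ
  filter_upwards [ha] with z hz
  rw [hz]
  simp

theorem eigenMult_integralOp_neg_I (hg : MemLp (Function.uncurry g) 2 (ν.prod ν)) (a : ℝ) :
    eigenMult (integralOp ν (fun x y => (g x y : ℂ)) (memLp_complex hg)) (Complex.I * (a : ℂ)) =
      eigenMult (integralOp ν (fun x y => -Complex.I * (g x y : ℂ))
        (memLp_complex_const_mul hg _)) (a : ℂ) := by
  rw [integralOp_const_mul (memLp_complex hg)]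
  set T := integralOp ν (fun x y => (g x y : ℂ)) (memLp_complex hg)
  have h : Module.End.eigenspace (T : Lp ℂ 2 ν →ₗ[ℂ] Lp ℂ 2 ν) (Complex.I * (a : ℂ)) =
      Module.End.eigenspace ((-Complex.I • T : Lp ℂ 2 ν →L[ℂ] Lp ℂ 2 ν) :
        Lp ℂ 2 ν →ₗ[ℂ] Lp ℂ 2 ν) (a : ℂ) := by
    ext x
    rw [Module.End.mem_eigenspace_iff, Module.End.mem_eigenspace_iff]
    simp only [ContinuousLinearMap.coe_coe, smul_apply]
    constructor
    · intro h
      rw [h, smul_smul]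
      congr 1
      linear_combination (-(a : ℂ)) * Complex.I_mul_I
    · intro h
      rw [mul_smul, ← h, smul_smul]
      simp
  rw [eigenMult, eigenMult, h]

/-- Since g is real, complex conjugation anticommutes with -iT_g; eigenvectors at a are conjugated
into eigenvectors at -a for real a. -/
theorem integralOp_neg_I_star (hg : MemLp (Function.uncurry g) 2 (ν.prod ν)) (φ : Lp ℂ 2 ν) :
    integralOp ν (fun x y => -Complex.I * (g x y : ℂ)) (memLp_complex_const_mul hg _) (star φ) =
      -star (integralOp ν (fun x y => -Complex.I * (g x y : ℂ))
        (memLp_complex_const_mul hg _) φ) := by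
  apply Lp.ext
  refine (integralOp_ae_eq _ _ _ _).trans (EventuallyEq.trans ?_ (Lp.coeFn_neg _).symm)
  filter_upwards [integralOp_ae_eq _ _ (memLp_complex_const_mul hg (-Complex.I)) φ,
    Lp.coeFn_star (integralOp ν (fun x y => -Complex.I * (g x y : ℂ))
        (memLp_complex_const_mul hg _) φ)] with x h1 h2
  rw [Pi.neg_apply, h2, Pi.star_apply, h1, RCLike.star_def, ← integral_conj, ← integral_neg]
  refine integral_congr_ae ?_
  filter_upwards [Lp.coeFn_star φ] with y hy
  rw [hy]
  simp

theorem inner_star_star (φ ψ : Lp ℂ 2 ν) :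
    inner ℂ (star φ) (star ψ) = inner ℂ ψ φ := by
  rw [L2.inner_def, L2.inner_def]
  refine integral_congr_ae ?_
  filter_upwards [Lp.coeFn_star φ, Lp.coeFn_star ψ] with x h1 h2
  rw [h1, h2]
  simp [RCLike.inner_apply, mul_comm]

/-- The real and imaginary parts of a complex function, normalized. -/
def reIm (φ : 𝒳 → ℂ) (s : Bool) (x : 𝒳) : ℝ :=
  √2 * if s then (φ x).re else (φ x).im

theorem measurable_reIm (φ : Lp ℂ 2 ν) (s : Bool) : Measurable (reIm φ s) := by
  have h := (Lp.stronglyMeasurable φ).measurable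
  unfold reIm
  cases s
  · simpa using (Complex.measurable_im.comp h).const_mul √2
  · simpa using (Complex.measurable_re.comp h).const_mul √2

theorem memLp_reIm (φ : Lp ℂ 2 ν) (s : Bool) : MemLp (reIm φ s) 2 ν := by
  unfold reIm
  cases s
  · simpa using (Lp.memLp φ).im.const_mul √2
  · simpa using (Lp.memLp φ).re.const_mul √2

theorem integral_reIm (φ : Lp ℂ 2 ν) (h : ∫ x, φ x ∂ν = 0) (s : Bool) :
    ∫ x, reIm φ s x ∂ν = 0 := by
  have hi := (Lp.memLp φ).integrable one_le_two
  have h1 : ∫ x, (φ x).re ∂ν = (∫ x, φ x ∂ν).re := Complex.reCLM.integral_comp_comm hi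
  have h2 : ∫ x, (φ x).im ∂ν = (∫ x, φ x ∂ν).im := Complex.imCLM.integral_comp_comm hi
  unfold reIm
  rw [integral_const_mul]
  cases s
  · simp [h2, h]
  · simp [h1, h]

/-- Products of real and imaginary parts are combinations of the parts of ψ·conj φ and ψ·φ, whose
integrals are the two given inner products. A unit vector orthogonal to its conjugate has real and
imaginary parts of squared norm ½, hence the factor √2 in `reIm`. -/
theorem integral_reIm_mul {φ ψ : Lp ℂ 2 ν} {r : ℝ} (h1 : inner ℂ φ ψ = (r : ℂ))
    (h2 : inner ℂ (star φ) ψ = 0) (s s' : Bool) :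
    ∫ x, reIm φ s x * reIm ψ s' x ∂ν = if s = s' then r else 0 := by
  have e1 : ∫ x, ψ x * conj (φ x) ∂ν = r := by
    rw [← h1, L2.inner_def]
    exact integral_congr_ae (ae_of_all _ fun x => (RCLike.inner_apply _ _).symm)
  have e2 : ∫ x, ψ x * φ x ∂ν = 0 := by
    rw [← h2, L2.inner_def]
    refine integral_congr_ae ?_
    filter_upwards [Lp.coeFn_star φ] with x hx
    rw [hx]
    simp [RCLike.inner_apply]
  have i1 : Integrable (fun x => ψ x * conj (φ x)) ν :=
    (Lp.memLp ψ).integrable_mul (Lp.memLp φ).star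
  have i2 : Integrable (fun x => ψ x * φ x) ν := (Lp.memLp ψ).integrable_mul (Lp.memLp φ)
  have a1 : ∫ x, (ψ x * conj (φ x)).re ∂ν = (∫ x, ψ x * conj (φ x) ∂ν).re :=
    Complex.reCLM.integral_comp_comm i1
  have a2 : ∫ x, (ψ x * conj (φ x)).im ∂ν = (∫ x, ψ x * conj (φ x) ∂ν).im :=
    Complex.imCLM.integral_comp_comm i1
  have a3 : ∫ x, (ψ x * φ x).re ∂ν = (∫ x, ψ x * φ x ∂ν).re :=
    Complex.reCLM.integral_comp_comm i2
  have a4 : ∫ x, (ψ x * φ x).im ∂ν = (∫ x, ψ x * φ x ∂ν).im :=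
    Complex.imCLM.integral_comp_comm i2
  rw [e1] at a1 a2
  rw [e2] at a3 a4
  have hs : √2 * √2 = (2 : ℝ) := Real.mul_self_sqrt two_pos.le
  have key : ∀ x, reIm φ s x * reIm ψ s' x = 2 * ((if s then (φ x).re else (φ x).im) *
      if s' then (ψ x).re else (ψ x).im) := fun x => by
    rw [reIm, reIm, mul_mul_mul_comm, hs]
  have b1 := i1.re
  have b2 := i1.im
  have b3 := i2.re
  have b4 := i2.im
  cases s <;> cases s'
  · rw [integral_congr_ae (ae_of_all _ fun x => show reIm φ false x * reIm ψ false x =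
      (ψ x * conj (φ x)).re - (ψ x * φ x).re by rw [key]; simp; ring)]
    refine (integral_sub b1 b3).trans ?_
    refine (congrArg₂ (· - ·) a1 a3).trans ?_
    simp
  · rw [integral_congr_ae (ae_of_all _ fun x => show reIm φ false x * reIm ψ true x =
      (ψ x * φ x).im - (ψ x * conj (φ x)).im by rw [key]; simp; ring)]
    refine (integral_sub b4 b2).trans ?_
    refine (congrArg₂ (· - ·) a4 a2).trans ?_
    simp
  · rw [integral_congr_ae (ae_of_all _ fun x => show reIm φ true x * reIm ψ false x =
      (ψ x * φ x).im + (ψ x * conj (φ x)).im by rw [key]; simp; ring)]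
    refine (integral_add b4 b2).trans ?_
    refine (congrArg₂ (· + ·) a4 a2).trans ?_
    simp
  · rw [integral_congr_ae (ae_of_all _ fun x => show reIm φ true x * reIm ψ true x =
      (ψ x * conj (φ x)).re + (ψ x * φ x).re by rw [key]; simp; ring)]
    refine (integral_add b1 b3).trans ?_
    refine (congrArg₂ (· + ·) a1 a3).trans ?_
    simp

theorem isCenteredOrthonormal_reIm {κ : Type*} {e : κ → Lp ℂ 2 ν} (he : Orthonormal ℂ e)
    (hs : ∀ α β, inner ℂ (star (e α)) (e β) = 0) (h0 : ∀ α, ∫ x, e α x ∂ν = 0) :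
    IsCenteredOrthonormal ν fun b : κ × Bool => reIm (e b.1) b.2 := by
  classical
  have h : ∀ b b' : κ × Bool, ∫ x, reIm (e b.1) b.2 x * reIm (e b'.1) b'.2 x ∂ν =
      if b.2 = b'.2 then (if b.1 = b'.1 then 1 else 0) else 0 := fun b b' =>
    integral_reIm_mul (r := if b.1 = b'.1 then 1 else 0)
      (by rw [orthonormal_iff_ite.1 he]; split_ifs <;> simp) (hs _ _) _ _
  refine ⟨fun b => memLp_reIm _ _, fun b => integral_reIm _ (h0 _) _, fun b => ?_,
    fun b b' hb => ?_⟩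
  · simp only [sq]
    rw [h]
    simp
  · simp only
    rw [h]
    split_ifs with h1 h2
    · exact absurd (Prod.ext h2 h1) hb
    · rfl
    · rfl

end Antisymmetric

/-! ### Real expansion of antisymmetric kernels and their limit law -/

section Antisymmetric

variable {𝒳 : Type*} [MeasurableSpace 𝒳] {ν : Measure 𝒳} [IsProbabilityMeasure ν]
  {g : 𝒳 → 𝒳 → ℝ}

open scoped ComplexConjugate

/-- The positive reals as a set of complex numbers. -/
def posReal : Set ℂ := {z | ∃ a : ℝ, 0 < a ∧ z = a}

/-- The kernel φ(x) conj φ(y) minus its conjugate is purely imaginary; its imaginary part is an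
antisymmetric combination of the real and imaginary parts of φ. -/
theorem neg_im_tens_sub (φ : Lp ℂ 2 ν) :
    (fun z => -(tens φ φ z - tens (star φ) (star φ) z).im) =ᵐ[ν.prod ν] fun z =>
      reIm φ true z.1 * reIm φ false z.2 - reIm φ false z.1 * reIm φ true z.2 := by
  have h1 := (Measure.quasiMeasurePreserving_fst (μ := ν) (ν := ν)).ae_eq_comp (Lp.coeFn_star φ)
  have h2 := (Measure.quasiMeasurePreserving_snd (μ := ν) (ν := ν)).ae_eq_comp (Lp.coeFn_star φ)
  filter_upwards [coeFn_tens φ φ, coeFn_tens (star φ) (star φ), h1, h2] with z e1 e2 e3 e4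
  simp only [Function.comp_apply, Pi.star_apply] at e3 e4
  rw [e1, e2, e3, e4]
  have hs : √2 * √2 = (2 : ℝ) := Real.mul_self_sqrt two_pos.le
  simp only [reIm, if_true, Bool.false_eq_true, if_false, RCLike.star_def, Complex.sub_im,
    Complex.mul_im, Complex.conj_re, Complex.conj_im, neg_neg]
  linear_combination ((φ z.1).im * (φ z.2).re - (φ z.1).re * (φ z.2).im) * hs

theorem hasSum_of_hasSum_bool {κ : Type*} {a : κ → ℝ} {r : ℝ}
    (h : HasSum (fun b : κ × Bool => a b.1) r) : HasSum a (1 / 2 * r) := by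
  have h1 := h.prod_fiberwise (g := fun α => 2 * a α) fun α => by
    have h4 := hasSum_fintype fun _ : Bool => a α
    rwa [Fintype.sum_bool, ← two_mul] at h4
  refine (h1.mul_left (1 / 2)).congr_fun fun α => ?_
  ring

theorem star_lp_smul (c : ℂ) (φ : Lp ℂ 2 ν) : star (c • φ) = conj c • star φ := by
  apply Lp.ext
  refine (Lp.coeFn_star _).trans (EventuallyEq.trans ?_ (Lp.coeFn_smul _ _).symm)
  filter_upwards [Lp.coeFn_smul c φ, Lp.coeFn_star φ] with x h1 h2
  rw [Pi.star_apply, h1, Pi.smul_apply, Pi.smul_apply, h2]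
  simp

theorem star_lp_add (φ ψ : Lp ℂ 2 ν) : star (φ + ψ) = star φ + star ψ := by
  apply Lp.ext
  refine (Lp.coeFn_star _).trans (EventuallyEq.trans ?_ (Lp.coeFn_add _ _).symm)
  filter_upwards [Lp.coeFn_add φ ψ, Lp.coeFn_star φ, Lp.coeFn_star ψ] with x h1 h2 h3
  rw [Pi.star_apply, h1, Pi.add_apply, Pi.add_apply, h2, h3]
  simp

/-- The eigenvectors of the self-adjoint operator `-i T_g` and their complex conjugates. -/
theorem exists_conj_eigenbasis (hg : MemLp (Function.uncurry g) 2 (ν.prod ν))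
    (ha : ∀ᵐ z ∂(ν.prod ν), g z.1 z.2 = -g z.2 z.1) {T : Lp ℂ 2 ν →L[ℂ] Lp ℂ 2 ν}
    (hT : T = integralOp ν (fun x y => -Complex.I * (g x y : ℂ)) (memLp_complex_const_mul hg _))
    (hc : IsCompactOperator T) :
    ∃ (e : EigenIdx T posReal → Lp ℂ 2 ν) (a : EigenIdx T posReal → ℝ), (∀ α, 0 < a α) ∧
      (∀ α, (α.1 : ℂ) = a α) ∧ Orthonormal ℂ e ∧ (∀ α, T (e α) = (a α : ℂ) • e α) ∧
      (∀ α β, inner ℂ (star (e α)) (e β) = 0) ∧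
      ∀ z : ℂ, z ≠ 0 → ∀ x, T x = z • x → x ∈ Submodule.span ℂ
        (Set.range fun b : EigenIdx T posReal × Bool => if b.2 then e b.1 else star (e b.1)) := by
  have hs : T.IsSymmetric := hT ▸ isSymmetric_integralOp_neg_I hg ha
  have hstar : ∀ φ, T (star φ) = -star (T φ) := fun φ => hT ▸ integralOp_neg_I_star hg φ
  have h0 : (0 : ℂ) ∉ posReal := by
    rintro ⟨a, ha, h⟩
    exact ha.ne (by exact_mod_cast h)
  obtain ⟨e, heo, hee, hes⟩ := exists_eigenbasis hc hs h0
  choose a ha0 ha1 using fun α : EigenIdx T posReal => α.1.2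
  have hTe : ∀ α, T (e α) = (a α : ℂ) • e α := fun α => by rw [hee, ← ha1]
  have hTs : ∀ α, T (star (e α)) = (-(a α : ℂ)) • star (e α) := fun α => by
    rw [hstar, hTe, star_lp_smul, neg_smul, Complex.conj_ofReal]
  refine ⟨e, a, ha0, ha1, heo, hTe, fun α β => ?_, fun z hz x hx => ?_⟩
  -- The conjugate of e α belongs to the negative eigenvalue -a α and e β to a positive one, so
  -- symmetry of T makes them orthogonal.
  · have h1 : inner ℂ (T (star (e α))) (e β) = inner ℂ (star (e α)) (T (e β)) := hs _ _
    rw [hTs, hTe, inner_smul_left, inner_smul_right] at h1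
    have h2 : ((a α : ℂ) + a β) * inner ℂ (star (e α)) (e β) = 0 := by
      simp only [map_neg, Complex.conj_ofReal] at h1
      linear_combination -h1
    refine (mul_eq_zero.1 h2).resolve_left ?_
    have := add_pos (ha0 α) (ha0 β)
    exact_mod_cast this.ne'
  · rcases eq_or_ne x 0 with rfl | hx0
    · exact Submodule.zero_mem _
    have hre : conj z = z := by
      have h1 : inner ℂ (T x) x = inner ℂ x (T x) := hs x x
      rw [hx, inner_smul_left, inner_smul_right] at h1
      exact mul_right_cancel₀ (inner_self_ne_zero.2 hx0) h1
    obtain ⟨r, rfl⟩ := Complex.conj_eq_iff_real.1 hre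
    have hr : r ≠ 0 := by exact_mod_cast hz
    rcases lt_or_gt_of_ne hr with hr | hr
    -- For a negative eigenvalue the conjugate of x is an eigenvector at a positive one; it is
    -- expanded there and the expansion is conjugated back.
    · have h1 : T (star x) = ((-r : ℝ) : ℂ) • star x := by
        rw [hstar, hx, star_lp_smul, Complex.conj_ofReal, Complex.ofReal_neg, neg_smul]
      have h2 := hes _ ⟨-r, by linarith, rfl⟩ _ h1
      have key : ∀ y ∈ Submodule.span ℂ (Set.range e), star y ∈ Submodule.span ℂ
          (Set.range fun b : EigenIdx T posReal × Bool =>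
            if b.2 then e b.1 else star (e b.1)) := by
        intro y hy
        induction hy using Submodule.span_induction with
        | mem y hy =>
          obtain ⟨α, rfl⟩ := hy
          exact Submodule.subset_span ⟨(α, false), by simp⟩
        | zero =>
          have h3 := star_lp_smul 0 (0 : Lp ℂ 2 ν)
          rw [map_zero, zero_smul, zero_smul] at h3
          rw [h3]
          exact Submodule.zero_mem _
        | add u v _ _ hu hv => rw [star_lp_add]; exact Submodule.add_mem _ hu hv
        | smul c u _ hu => rw [star_lp_smul]; exact Submodule.smul_mem _ _ hu
      simpa using key _ h2
    · refine Submodule.span_mono ?_ (hes _ ⟨r, hr, rfl⟩ _ hx)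
      rintro _ ⟨α, rfl⟩
      exact ⟨(α, true), by simp⟩

set_option maxHeartbeats 400000 in
-- The kernel -ig is expanded in the eigenvectors with positive eigenvalues and their conjugates.
-- Grouping each vector with its conjugate and taking minus the imaginary part gives a real
-- expansion of g.
theorem exists_antisymmetric_expansion (hg : MemLp (Function.uncurry g) 2 (ν.prod ν))
    (hd : IsDegenerate ν g) (ha : ∀ᵐ z ∂(ν.prod ν), g z.1 z.2 = -g z.2 z.1) :
    ∃ (Q : ℕ∞) (c : Idx Q → ℝ) (p : Idx Q × Bool → 𝒳 → ℝ),
      ListsPosImaginaryEigenvalues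
        (integralOp ν (fun x y => (g x y : ℂ)) (memLp_complex hg)) c ∧
      Summable (fun r => c r ^ 2) ∧ ∑' r, c r ^ 2 = 1 / 2 * ∫ z, g z.1 z.2 ^ 2 ∂(ν.prod ν) ∧
      IsCenteredOrthonormal ν p ∧ (∀ b, Measurable (p b)) ∧
      ∀ hF : ∀ r, MemLp (fun z : 𝒳 × 𝒳 => c r * (p (r, true) z.1 * p (r, false) z.2 -
        p (r, false) z.1 * p (r, true) z.2)) 2 (ν.prod ν),
      HasSum (fun r => (hF r).toLp _) (hg.toLp _) := by
  have hB := memLp_complex_const_mul hg (-Complex.I)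
  set K : Lp ℂ 2 (ν.prod ν) := hB.toLp _ with hK
  have hT : kerOp K = integralOp ν (fun x y => -Complex.I * (g x y : ℂ)) hB :=
    (integralOp_eq_kerOp hB).symm
  have hc := isCompactOperator_kerOp K
  obtain ⟨e, a, ha0, ha1, heo, hTe, hes, hspan⟩ := exists_conj_eigenbasis hg ha hT hc
  have hs : (kerOp K).IsSymmetric := hT ▸ isSymmetric_integralOp_neg_I hg ha
  have hstar : ∀ φ, kerOp K (star φ) = -star (kerOp K φ) :=
    fun φ => hT ▸ integralOp_neg_I_star hg φ
  set E : EigenIdx (kerOp K) posReal × Bool → Lp ℂ 2 ν :=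
    fun b => if b.2 then e b.1 else star (e b.1) with hE
  set lam : EigenIdx (kerOp K) posReal × Bool → ℂ :=
    fun b => if b.2 then (a b.1 : ℂ) else -(a b.1 : ℂ) with hlam
  have hEo : Orthonormal ℂ E := by
    classical
    rw [orthonormal_iff_ite]
    rintro ⟨α, s⟩ ⟨β, s'⟩
    have h1 := orthonormal_iff_ite.1 heo α β
    have h2 := orthonormal_iff_ite.1 heo β α
    have h3 := hes α β
    have h4 := inner_eq_zero_symm.1 (hes β α)
    cases s <;> cases s'
    · simp only [hE, Bool.false_eq_true, if_false, inner_star_star, h2, Prod.mk.injEq, and_true]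
      simp only [eq_comm]
    · simpa [hE] using h3
    · simpa [hE] using h4
    · simp only [hE, if_true, h1, Prod.mk.injEq, and_true]
  have hEe : ∀ b, kerOp K (E b) = lam b • E b := by
    rintro ⟨α, s⟩
    cases s
    · simp only [hE, hlam, Bool.false_eq_true, if_false]
      rw [hstar, hTe, star_lp_smul, Complex.conj_ofReal, neg_smul]
    · simp [hE, hlam, hTe]
  obtain ⟨hsum, hsq, htsum⟩ := hasSum_kernel hs hEo hEe hspan
  have hlam2 : ∀ b, ‖lam b‖ ^ 2 = a b.1 ^ 2 := by
    rintro ⟨α, s⟩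
    cases s <;> simp [hlam]
  simp only [hlam2] at hsq htsum
  -- Each a α occurs twice among the absolute eigenvalues, for e α and for its conjugate, so the
  -- squared norm of g is halved.
  have hsa : HasSum (fun α => a α ^ 2) (1 / 2 * ∫ z, g z.1 z.2 ^ 2 ∂(ν.prod ν)) := by
    have h1 := hsq.hasSum
    have hn : ‖K‖ ^ 2 = ∫ z, g z.1 z.2 ^ 2 ∂(ν.prod ν) := by
      have e : ‖K‖ = ‖hg.toLp (Function.uncurry g)‖ := by
        rw [hK, Lp.norm_toLp, Lp.norm_toLp]
        congr 1
        exact eLpNorm_congr_norm_ae (ae_of_all _ fun z => by simp [Function.uncurry_def])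
      rw [e, norm_toLp_sq]
      rfl
    rw [htsum, hn] at h1
    exact hasSum_of_hasSum_bool h1
  have hcount : Countable (EigenIdx (kerOp K) posReal) := by
    have := hsa.summable.countable_support
    rwa [Set.eq_univ_of_forall (s := Function.support fun α => a α ^ 2)
      fun α => pow_ne_zero 2 (ha0 α).ne', Set.countable_univ_iff] at this
  obtain ⟨Q, ⟨N⟩⟩ := exists_idx_equiv (EigenIdx (kerOp K) posReal)
  have hdB : ∀ᵐ y ∂ν, ∫ x, -Complex.I * (g x y : ℂ) ∂ν = 0 := by
    filter_upwards [hd.left] with y hy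
    rw [integral_const_mul, integral_complex_ofReal, hy]
    simp
  have hmean : ∀ α, ∫ x, e α x ∂ν = 0 := fun α =>
    integral_eq_zero_of_eigen hB hdB (c := (a α : ℂ)) (by exact_mod_cast (ha0 α).ne')
      (hT ▸ hTe α)
  refine ⟨Q, fun r => a (N r), fun b => reIm (e (N b.1)) b.2, ⟨fun r => ha0 _, fun r hr => ?_⟩,
    N.summable_iff.2 hsa.summable, (N.tsum_eq fun α => a α ^ 2).trans hsa.tsum_eq,
    isCenteredOrthonormal_reIm (heo.comp _ N.injective) (fun _ _ => hes _ _) fun _ => hmean _,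
    fun b => measurable_reIm _ _, fun hF => ?_⟩
  · rw [eigenMult_integralOp_neg_I hg, ← hT,
      ← encard_eigenIdx hc (Z := posReal) ⟨r, hr, rfl⟩ (by exact_mod_cast hr.ne'),
      ← encard_preimage_equiv N]
    congr 1
    ext q
    simp only [Set.mem_ofPred_eq, ha1]
    exact_mod_cast Iff.rfl
  · have h1 : HasSum (fun α => (a α : ℂ) • (tens (e α) (e α) - tens (star (e α)) (star (e α)))) K := by
      refine hsum.prod_fiberwise fun α => ?_
      have h2 := hasSum_fintype fun s : Bool => lam (α, s) • tens (E (α, s)) (E (α, s))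
      rw [Fintype.sum_bool] at h2
      convert h2 using 1
      simp only [hlam, hE, if_true, Bool.false_eq_true, if_false, neg_smul]
      rw [smul_sub, sub_eq_add_neg]
    -- As K is -ig, minus its imaginary part is g; this real linear map is continuous on L² and acts
    -- termwise.
    have h2 := (N.hasSum_iff.2 h1).mapL (-(Complex.imCLM.compLpL 2 (ν.prod ν)))
    convert h2 using 1
    · funext r
      simp only [Function.comp_apply]
      apply Lp.ext
      refine (hF r).coeFn_toLp.trans ?_
      refine EventuallyEq.trans ?_ (Lp.coeFn_neg _).symm
      filter_upwards [Complex.imCLM.coeFn_compLpL ((a (N r) : ℂ) • (tens (e (N r)) (e (N r)) -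
        tens (star (e (N r))) (star (e (N r))))), Lp.coeFn_smul (a (N r) : ℂ)
        (tens (e (N r)) (e (N r)) - tens (star (e (N r))) (star (e (N r)))),
        Lp.coeFn_sub (tens (e (N r)) (e (N r))) (tens (star (e (N r))) (star (e (N r)))),
        neg_im_tens_sub (e (N r))] with z e1 e2 e3 e4
      rw [Pi.neg_apply]
      refine Eq.trans ?_ (congrArg Neg.neg e1.symm)
      rw [e2, Pi.smul_apply, e3, Pi.sub_apply, ← e4]
      simp
      ring
    · apply Lp.ext
      refine hg.coeFn_toLp.trans ?_
      refine EventuallyEq.trans ?_ (Lp.coeFn_neg _).symm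
      filter_upwards [Complex.imCLM.coeFn_compLpL K, hB.coeFn_toLp] with z e1 e2
      rw [Pi.neg_apply]
      refine Eq.trans ?_ (congrArg Neg.neg e1.symm)
      rw [hK, e2]
      simp [Function.uncurry_def]

/-- Each antisymmetric block is two bilinear terms with coefficients c and -c, where q is p with
real and imaginary parts exchanged. As cosh is even, the two factors cosh(ct)^(-1/2) multiply to
1/cosh(ct). -/
theorem exists_antisymmetric_limit {Ω : Type*} [MeasurableSpace Ω] {P : Measure Ω}
    [IsProbabilityMeasure P] {X : ℕ → Ω → 𝒳} (h : IsIID X ν P)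
    (hm : Measurable (Function.uncurry g)) (hg : MemLp (Function.uncurry g) 2 (ν.prod ν))
    (hd : IsDegenerate ν g) (ha : ∀ᵐ z ∂(ν.prod ν), g z.1 z.2 = -g z.2 z.1) :
    ∃ (Q : ℕ∞) (c : Idx Q → ℝ), ListsPosImaginaryEigenvalues
        (integralOp ν (fun x y => (g x y : ℂ)) (memLp_complex hg)) c ∧
      Summable (fun r => c r ^ 2) ∧ ∑' r, c r ^ 2 = 1 / 2 * ∫ z, g z.1 z.2 ^ 2 ∂(ν.prod ν) ∧
      ∀ (t : ℝ) (z : ℂ), HasProd (fun r => ((1 / Real.cosh (c r * t) : ℝ) : ℂ)) z →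
        Tendsto (fun n : ℕ => charFun (P.map fun ω => ∑ p ∈ pairs n,
          ((n : ℝ)⁻¹ * (-1 : ℝ) ^ p.2) * g (X p.2 ω) (X p.1 ω)) t) atTop (𝓝 z) := by
  obtain ⟨Q, c, p, hc, hcs, hct, hp, hpm, hexp⟩ := exists_antisymmetric_expansion hg hd ha
  refine ⟨Q, c, hc, hcs, hct, fun t z hz => ?_⟩
  set d : Idx Q × Bool → ℝ := fun b => if b.2 then c b.1 else -c b.1 with hdd
  set q : Idx Q × Bool → 𝒳 → ℝ := fun b => p (b.1, !b.2) with hqq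
  have hq : IsCenteredOrthonormal ν q := ⟨fun _ => hp.memLp _, fun _ => hp.mean _,
    fun _ => hp.norm _, fun b b' hb => hp.orth fun e => hb (by
      rw [Prod.mk.injEq, Bool.not_inj_iff] at e
      exact Prod.ext e.1 e.2)⟩
  have hd2 : ∀ b, d b ^ 2 = c b.1 ^ 2 * 1 := fun b => by
    simp only [hdd]
    split_ifs <;> ring
  have hds : Summable fun b => d b ^ 2 := by
    simp only [hd2]
    exact hcs.mul_of_nonneg (g := fun _ : Bool => (1 : ℝ)) (hasSum_fintype _).summable
      (fun _ => sq_nonneg _) fun _ => zero_le_one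
  have hF := fun b => (memLp_mul_prod (hp.memLp b) (hq.memLp b)).const_mul (d b)
  have hG : ∀ r, MemLp (fun z : 𝒳 × 𝒳 => c r * (p (r, true) z.1 * p (r, false) z.2 -
      p (r, false) z.1 * p (r, true) z.2)) 2 (ν.prod ν) := fun r =>
    ((memLp_mul_prod (hp.memLp _) (hp.memLp _)).sub
      (memLp_mul_prod (hp.memLp _) (hp.memLp _))).const_mul _
  have hsum : HasSum (fun b => (hF b).toLp _) (hg.toLp _) := by
    obtain ⟨S, hS⟩ := hp.summable_toLp hq hds hF
    have h1 : HasSum (fun r => (hG r).toLp _) S := by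
      refine hS.prod_fiberwise fun r => ?_
      have h2 := hasSum_fintype fun s : Bool => (hF (r, s)).toLp _
      convert h2 using 1
      rw [Fintype.sum_bool, ← MemLp.toLp_add]
      refine MemLp.toLp_congr _ _ (ae_of_all _ fun z => ?_)
      simp only [hdd, hqq, Pi.add_apply, if_true, Bool.false_eq_true, if_false, Bool.not_true,
        Bool.not_false]
      ring
    rwa [← h1.unique (hexp hG)]
  refine tendsto_charFun_alternating_bilinear h hm hg hd hp hq hpm (fun _ => hpm _) hds
    (tendsto_integral_sq_of_hasSum hF hg hsum) ?_
  -- A random series with the doubled coefficients certifies that the product over both signs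
  -- converges; its value is then found by grouping.
  obtain ⟨κ, _, hκ2, hκ0, -, hκ⟩ := exists_halfAreaLaw
  obtain ⟨P', _, ξ, W, -, -, -, -, hW⟩ := exists_isL2Sum_of_law hκ2 hκ0 hds
  have h1 := hW t
  simp only [hκ] at h1
  have h2 : HasProd (fun r => ((1 / Real.cosh (c r * t) : ℝ) : ℂ)) (charFun (P'.map W) t) := by
    refine h1.prod_fiberwise fun r => ?_
    have h3 := hasProd_fintype fun s : Bool => ((1 / √(Real.cosh (d (r, s) * t)) : ℝ) : ℂ)
    convert h3 using 1
    rw [Fintype.prod_bool]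
    simp only [hdd, if_true, Bool.false_eq_true, if_false, neg_mul, Real.cosh_neg]
    rw [← Complex.ofReal_mul, one_div_mul_one_div, Real.mul_self_sqrt (Real.cosh_pos _).le]
  rwa [← h2.unique hz]

end Antisymmetric

/-! ### Antisymmetric kernels without linear parts -/

section Reduction

variable {𝒳 : Type*} [MeasurableSpace 𝒳] {ν : Measure 𝒳} [IsProbabilityMeasure ν]
  {f : 𝒳 → 𝒳 → ℝ}

theorem hoeffdingMean_eq_zero (ha : ∀ᵐ z ∂(ν.prod ν), f z.1 z.2 = -f z.2 z.1) :
    hoeffdingMean ν f = 0 := by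
  have h1 : hoeffdingMean ν f = -hoeffdingMean ν f := by
    rw [hoeffdingMean, ← integral_neg, ← integral_prod_swap]
    refine integral_congr_ae ?_
    filter_upwards [ha] with z hz
    rw [Prod.fst_swap, Prod.snd_swap, hz, neg_neg]
  linarith

/-- Antisymmetry makes the mean zero and f₂ = -f₁ almost everywhere, so nothing is subtracted from
f. -/
theorem hoeffding₁₂_ae_eq_of_antisymm (ha : ∀ᵐ z ∂(ν.prod ν), f z.1 z.2 = -f z.2 z.1)
    (h1 : ∀ᵐ x ∂ν, hoeffding₁ ν f x = 0) :
    ∀ᵐ z ∂(ν.prod ν), hoeffding₁₂ ν f z.1 z.2 = f z.1 z.2 := by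
  have h0 := hoeffdingMean_eq_zero ha
  have h2 : ∀ᵐ y ∂ν, hoeffding₂ ν f y = 0 := by
    filter_upwards [Measure.ae_ae_of_ae_prod ha, h1] with y hy hy'
    rw [hoeffding₁, integral_congr_ae hy, integral_neg] at hy'
    rw [hoeffding₂]
    linarith
  filter_upwards [(Measure.quasiMeasurePreserving_fst (μ := ν) (ν := ν)).ae h1,
    (Measure.quasiMeasurePreserving_snd (μ := ν) (ν := ν)).ae h2] with z e1 e2
  rw [hoeffding₁₂, e1, e2, h0]
  ring

end Reduction

end AltU

end

/-! ### Assembly of the limit theorems -/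

theorem theorem6p3 {Ω 𝒳 : Type*} [MeasurableSpace Ω] [MeasurableSpace 𝒳]
    (P : Measure Ω) [IsProbabilityMeasure P] (ν : Measure 𝒳) [IsProbabilityMeasure ν]
    (X : ℕ → Ω → 𝒳) (hX : ∀ k, Measurable (X k)) (hlaw : ∀ k, P.map (X k) = ν)
    (hindep : iIndepFun X P)
    (f : 𝒳 → 𝒳 → ℝ) (hmeas : Measurable (Function.uncurry f))
    (hf : MemLp (Function.uncurry f) 2 (ν.prod ν)) :
    -- all the statistics are square integrable, and their means
    (∀ n, MemLp (AltU.altU f X n) 2 P) ∧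
    (∀ n, P[AltU.altU f X n] = ((n / 2 : ℕ) : ℝ) * AltU.hoeffdingMean ν f) ∧
    -- order `n ^ 3` variance and normal limit
    (Tendsto (fun n : ℕ => Var[AltU.altU f X n; P] / (n : ℝ) ^ 3) atTop
        (𝓝 (1 / 3 * P[fun ω => AltU.hoeffding₁ ν f (X 0 ω) ^ 2])) ∧
      TendstoInDistribution
        (fun (n : ℕ) ω => (n : ℝ) ^ (-(3 / 2) : ℝ) *
          (AltU.altU f X n ω - P[AltU.altU f X n])) atTop
        (id : ℝ → ℝ) (fun _ => P)
        (gaussianReal 0 (1 / 3 * P[fun ω => AltU.hoeffding₁ ν f (X 0 ω) ^ 2]).toNNReal)) ∧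
    -- the degenerate case
    ((∀ᵐ ω ∂P, AltU.hoeffding₁ ν f (X 0 ω) = 0) →
      1 / 3 * P[fun ω => AltU.hoeffding₁ ν f (X 0 ω) ^ 2] = 0 ∧
      (fun n : ℕ => Var[AltU.altU f X n; P] -
          1 / 2 * (n : ℝ) ^ 2 * Var[fun ω => AltU.hoeffding₁₂ ν f (X 0 ω) (X 1 ω); P])
        =O[atTop] (fun n : ℕ => (n : ℝ)) ∧
      IsSelfAdjoint (AltU.altOp ν (AltU.hoeffding₁₂ ν f) (AltU.memLp_hoeffding₁₂ hf)) ∧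
      ∃ (R : ℕ∞) (c : AltU.Idx R → ℝ),
        AltU.ListsNonzeroEigenvalues
          (AltU.altOp ν (AltU.hoeffding₁₂ ν f) (AltU.memLp_hoeffding₁₂ hf)) c ∧
        ∃ (Ω' : Type) (_ : MeasurableSpace Ω') (P' : Measure Ω') (_ : IsProbabilityMeasure P')
          (ζ : AltU.Idx R → Ω' → ℝ) (W : Ω' → ℝ),
          iIndepFun ζ P' ∧ (∀ r, HasLaw (ζ r) (gaussianReal 0 1) P') ∧
          AltU.IsL2Sum (fun r ω => 1 / 2 * c r * (ζ r ω ^ 2 - 1)) W P' ∧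
          TendstoInDistribution
            (fun (n : ℕ) ω => (n : ℝ)⁻¹ * (AltU.altU f X n ω - P[AltU.altU f X n])) atTop
            W (fun _ => P) P' ∧
          Summable (fun r => c r ^ 2) ∧
          Var[W; P'] = 1 / 2 * ∑' r, c r ^ 2 ∧
          1 / 2 * ∑' r, c r ^ 2 =
            1 / 2 * Var[fun ω => AltU.hoeffding₁₂ ν f (X 0 ω) (X 1 ω); P]) ∧
    -- the degenerate case with `f` symmetric
    ((∀ᵐ ω ∂P, AltU.hoeffding₁ ν f (X 0 ω) = 0) →
      (∀ᵐ z ∂(ν.prod ν), f z.1 z.2 = f z.2 z.1) →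
      ∃ (R : ℕ∞) (c : AltU.Idx R → ℝ),
        AltU.ListsNonzeroEigenvalues
          (AltU.integralOp ν (AltU.hoeffding₁₂ ν f) (AltU.memLp_hoeffding₁₂ hf)) c ∧
        ∃ (Ω' : Type) (_ : MeasurableSpace Ω') (P' : Measure Ω') (_ : IsProbabilityMeasure P')
          (ξ : AltU.Idx R → Ω' → ℝ) (W : Ω' → ℝ),
          iIndepFun ξ P' ∧ (∀ r, AltU.HasHalfStochasticAreaLaw (ξ r) P') ∧
          AltU.IsL2Sum (fun r ω => c r * ξ r ω) W P' ∧
          TendstoInDistribution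
            (fun (n : ℕ) ω => (n : ℝ)⁻¹ * (AltU.altU f X n ω - P[AltU.altU f X n])) atTop
            W (fun _ => P) P' ∧
          Summable (fun r => c r ^ 2) ∧
          Var[W; P'] = 1 / 2 * ∑' r, c r ^ 2 ∧
          1 / 2 * ∑' r, c r ^ 2 =
            1 / 2 * Var[fun ω => AltU.hoeffding₁₂ ν f (X 0 ω) (X 1 ω); P]) ∧
    -- the degenerate case with `f` antisymmetric
    ((∀ᵐ ω ∂P, AltU.hoeffding₁ ν f (X 0 ω) = 0) →
      (∀ᵐ z ∂(ν.prod ν), f z.1 z.2 = -f z.2 z.1) →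
      AltU.integralOp ν (fun x y => (f x y : ℂ)) (AltU.memLp_complex hf) ∈
        skewAdjoint (Lp ℂ 2 ν →L[ℂ] Lp ℂ 2 ν) ∧
      ∃ (Q : ℕ∞) (c : AltU.Idx Q → ℝ),
        AltU.ListsPosImaginaryEigenvalues
          (AltU.integralOp ν (fun x y => (f x y : ℂ)) (AltU.memLp_complex hf)) c ∧
        ∃ (Ω' : Type) (_ : MeasurableSpace Ω') (P' : Measure Ω') (_ : IsProbabilityMeasure P')
          (η : AltU.Idx Q → Ω' → ℝ) (W : Ω' → ℝ),
          iIndepFun η P' ∧ (∀ q, AltU.HasStochasticAreaLaw (η q) P') ∧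
          AltU.IsL2Sum (fun q ω => c q * η q ω) W P' ∧
          TendstoInDistribution (fun (n : ℕ) ω => (n : ℝ)⁻¹ * AltU.altU f X n ω) atTop
            W (fun _ => P) P' ∧
          Summable (fun q => c q ^ 2) ∧
          Var[W; P'] = ∑' q, c q ^ 2 ∧
          ∑' q, c q ^ 2 =
            1 / 2 * Var[fun ω => AltU.hoeffding₁₂ ν f (X 0 ω) (X 1 ω); P]) ∧
    -- the case where the statistic reduces to a sum of independent variables
    ((∀ᵐ ω ∂P, AltU.hoeffding₁ ν f (X 0 ω) = 0) →
      (∀ᵐ ω ∂P, AltU.hoeffding₁₂ ν f (X 0 ω) (X 1 ω) = 0) →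
      (fun n : ℕ => Var[AltU.altU f X n; P] -
          n * (1 / 2 * Var[fun ω => AltU.hoeffding₂ ν f (X 0 ω); P]))
        =O[atTop] (fun _ : ℕ => (1 : ℝ)) ∧
      TendstoInDistribution
        (fun (n : ℕ) ω => (n : ℝ) ^ (-(1 / 2) : ℝ) *
          (AltU.altU f X n ω - P[AltU.altU f X n])) atTop
        (id : ℝ → ℝ) (fun _ => P)
        (gaussianReal 0 (1 / 2 * Var[fun ω => AltU.hoeffding₂ ν f (X 0 ω); P]).toNNReal)) := by
  have h : AltU.IsIID X ν P := ⟨hX, hlaw, hindep⟩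
  have hm12 := AltU.measurable_hoeffding₁₂ (ν := ν) hmeas
  have hf12 := AltU.memLp_hoeffding₁₂ hf
  have hd12 := AltU.isDegenerate_hoeffding₁₂ hf
  have e1 : P[fun ω => AltU.hoeffding₁ ν f (X 0 ω) ^ 2] = ∫ x, AltU.hoeffding₁ ν f x ^ 2 ∂ν :=
    h.integral_single (φ := fun x => AltU.hoeffding₁ ν f x ^ 2)
      ((AltU.measurable_hoeffding₁ hmeas).pow_const 2).aestronglyMeasurable 0
  have hdeg : (∀ᵐ ω ∂P, AltU.hoeffding₁ ν f (X 0 ω) = 0) → ∀ᵐ x ∂ν, AltU.hoeffding₁ ν f x = 0 :=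
    h.ae_eq_zero (AltU.measurable_hoeffding₁ hmeas)
  rw [h.variance_hoeffding₁₂ hf, h.variance_hoeffding₂ hf, e1]
  refine ⟨h.memLp_altU hf, h.integral_altU hf,
    ⟨h.tendsto_variance_altU hf, h.tendstoInDistribution_altU hf⟩, fun h1 => ?_, fun h1 hs => ?_,
    fun h1 ha => ?_, fun h1 h12 => ?_⟩
  · refine ⟨?_, h.isBigO_variance_of_degenerate hf (hdeg h1), AltU.isSelfAdjoint_altOp hf12, ?_⟩
    · have : ∫ x, AltU.hoeffding₁ ν f x ^ 2 ∂ν = 0 := by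
        refine integral_eq_zero_of_ae ?_
        filter_upwards [hdeg h1] with x hx
        simp [hx]
      rw [this, mul_zero]
    · obtain ⟨R, c, hc, hcs, hct, hlim⟩ := AltU.exists_quadratic_limit h hm12 hf12 hd12
      obtain ⟨P', hP', ζ, W, hind, hζ, hW, -, hvar, hchar⟩ := AltU.exists_quadratic_sum hcs
      exact ⟨R, c, hc, _, _, P', hP', ζ, W, hind, hζ, hW,
        AltU.tendstoInDistribution_of_charFun (fun n => (h.memLp_altU_sub hf n _).1.aemeasurable)
          hW.2.1.1.aemeasurable fun t =>
            h.tendsto_charFun_altU_of_degenerate hf (hdeg h1) (hlim t _ (hchar t)),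
        hcs, hvar, by rw [hct]⟩
  · obtain ⟨R, c, hc, hcs, hct, hlim⟩ := AltU.exists_symmetric_limit h hm12 hf12 hd12
      (AltU.hoeffding₁₂_symm hs)
    obtain ⟨κ, hκ, hκ2, hκ0, hκv, hκc⟩ := AltU.exists_halfAreaLaw
    obtain ⟨P', hP', ξ, W, hind, hξ, hW, hvar, hchar⟩ :=
      AltU.exists_isL2Sum_of_law hκ2 hκ0 hcs
    rw [hκv] at hvar
    simp only [hκc] at hchar
    exact ⟨R, c, hc, _, _, P', hP', ξ, W, hind,
      fun r => ⟨(hξ r).aemeasurable, fun t => by rw [(hξ r).map_eq, hκc]⟩, hW,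
      AltU.tendstoInDistribution_of_charFun (fun n => (h.memLp_altU_sub hf n _).1.aemeasurable)
        hW.2.1.1.aemeasurable fun t =>
          h.tendsto_charFun_altU_of_degenerate hf (hdeg h1) (hlim t _ (hchar t)),
      hcs, hvar, by rw [hct]⟩
  · refine ⟨AltU.mem_skewAdjoint_integralOp hf ha, ?_⟩
    have hae := AltU.hoeffding₁₂_ae_eq_of_antisymm ha (hdeg h1)
    have hsw := (Measure.measurePreserving_swap (μ := ν) (ν := ν)).quasiMeasurePreserving.ae hae
    obtain ⟨Q, c, hc, hcs, hct, hlim⟩ := AltU.exists_antisymmetric_limit h hm12 hf12 hd12 (by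
      filter_upwards [hae, hsw, ha] with z e2 e3 e4
      rw [Prod.fst_swap, Prod.snd_swap] at e3
      rw [e2, e3, e4])
    -- The expansion was obtained for f₁₂, whereas the eigenvalues are those of f; kernels equal
    -- almost everywhere have the same operator.
    have hop := AltU.integralOp_congr (AltU.memLp_complex hf12) (AltU.memLp_complex hf) (by
      filter_upwards [hae] with z hz
      simp only [Function.uncurry_def]
      rw [hz])
    rw [hop] at hc
    obtain ⟨κ, hκ, hκ2, hκ0, hκv, hκc⟩ := AltU.exists_areaLaw
    obtain ⟨P', hP', η, W, hind, hη, hW, hvar, hchar⟩ :=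
      AltU.exists_isL2Sum_of_law hκ2 hκ0 hcs
    rw [hκv, one_mul] at hvar
    simp only [hκc] at hchar
    -- By antisymmetry the statistic is already centred.
    have hmean : ∀ n, ∫ ω, AltU.altU f X n ω ∂P = 0 := fun n => by
      rw [h.integral_altU hf, AltU.hoeffdingMean_eq_zero ha, mul_zero]
    refine ⟨Q, c, hc, _, _, P', hP', η, W, hind,
      fun r => ⟨(hη r).aemeasurable, fun t => by rw [(hη r).map_eq, hκc]⟩, hW,
      AltU.tendstoInDistribution_of_charFun
        (fun n => ((h.memLp_altU hf n).const_mul _).1.aemeasurable)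
        hW.2.1.1.aemeasurable fun t => ?_, hcs, hvar, hct⟩
    have := h.tendsto_charFun_altU_of_degenerate hf (hdeg h1) (hlim t _ (hchar t))
    simpa only [hmean, sub_zero] using this
  · have h0 := h.integral_sq_eq_zero hm12 h12
    exact ⟨h.isBigO_variance_of_linear hf (hdeg h1) h0,
      h.tendstoInDistribution_altU_of_linear hf (hdeg h1) h0⟩
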